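/- An instance $I$ of \textsc{FIFO Stack-Up} is a list $Q=(q_1,\dots,q_k)$ of finite sequences of bins, each bin $b$ carrying a pallet symbol $\mathrm{plt}(b)\in\mathbb N$ such that every pallet symbol that occurs at all is carried by at least two bins, together with an integer $p\ge 1$ (the number of stack-up places). A configuration is a tuple $(i_1,\dots,i_k)$ with $0\le i_j\le |q_j|$, where $i_j$ is the number of bins already removed from the front of $q_j$. A pallet is open in a configuration if at least one of its bins has been removed and at least one has not. A processing of $Q$ is a sequence of configurations from $(0,\dots,0)$ to $(|q_1|,\dots,|q_k|)$, each of which arises from the preceding one by increasing exactly one $i_j$ by one. The question is whether $Q$ has a processing in each configuration of which at most $p$ pallets are open. Let $n$ be the total number of bins, $m$ the number of distinct pallet symbols, and $|I|$ the length in bits of the binary encoding of $I$. Running times are those of a unit-cost random access machine with addition and subtraction. **Theorem.** There is an xp-algorithm that solves \textsc{FIFO Stack-Up}, parameterized by $p$, in time $\mathcal O(n+m^{p+2})$. That is, there is one algorithm $A$ such that: 1. $A$ halts on every instance and accepts exactly the yes-instances, and there are computable functions $f,g:\mathbb N\to\mathbb N$ such that the running time of $A$ on every instance $I$ is at most $f(p)\cdot|I|^{g(p)}$;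 2. there is an absolute constant $c$ such that the running time of $A$ is at most $c\,(n+m^{p+2})$ on every instance with $k<m$ (fewer sequences than pallets). -/

import Mathlib

namespace FifoStackUp

/-! ### The FIFO Stack-Up problem

A sequence of bins is given by the list of the pallet symbols of its bins, a list of sequences
`Q = (q_1, …, q_k)` by a list of such lists. -/

/-- The set `plts(Q)` of all pallets of the bins in `Q`. -/
def plts (Q : List (List ℕ)) : Finset ℕ := Q.flatten.toFinset

/-- A tuple `(i_1, …, i_k)`; `i_j` is the number of bins removed so far from the `j`-th sequence. -/
abbrev Tuple (Q : List (List ℕ)) : Type := Fin Q.length → ℕ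

/-- The tuple is a configuration of `Q`: `0 ≤ i_j ≤ |q_j|` for every `j`. -/
def IsConfig (Q : List (List ℕ)) (C : Tuple Q) : Prop := ∀ j, C j ≤ (Q.get j).length

/-- Pallet `t` is open in `C`: some bin for `t` has been removed, and some bin for `t` has not. -/
def IsOpenPallet (Q : List (List ℕ)) (C : Tuple Q) (t : ℕ) : Prop :=
  (∃ j, t ∈ (Q.get j).take (C j)) ∧ (∃ l, t ∈ (Q.get l).drop (C l))

instance (Q : List (List ℕ)) (C : Tuple Q) (t : ℕ) : Decidable (IsOpenPallet Q C t) := by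
  unfold IsOpenPallet; infer_instance

/-- The set of the pallets that are open in `C`. -/
def openPallets (Q : List (List ℕ)) (C : Tuple Q) : Finset ℕ :=
  (plts Q).filter (fun t => IsOpenPallet Q C t)

/-- A transformation step: `C'` arises from `C` by the removal of the first remaining bin of one
of the sequences. -/
def Step (Q : List (List ℕ)) (C C' : Tuple Q) : Prop :=
  ∃ j, C j < (Q.get j).length ∧ C' = Function.update C j (C j + 1)

/-- A processing of `Q`, given by the list of its successive configurations: it leads from the
initial configuration `(0, …, 0)` to the final configuration `(|q_1|, …, |q_k|)` by transformation
steps. -/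
def IsProcessing (Q : List (List ℕ)) (P : List (Tuple Q)) : Prop :=
  P.head? = some (fun _ => 0) ∧ P.getLast? = some (fun j => (Q.get j).length) ∧
    P.IsChain (Step Q) ∧ ∀ C ∈ P, IsConfig Q C

/-- There is a processing of `Q` such that in each of its configurations at most `p` pallets are
open. -/
def Processable (Q : List (List ℕ)) (p : ℕ) : Prop :=
  ∃ P : List (Tuple Q), IsProcessing Q P ∧ ∀ C ∈ P, (openPallets Q C).card ≤ p

/-- An instance of FIFO Stack-Up: a list of sequences that contains at least two bins for each
pallet, and a positive number `p` of stack-up places. -/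
structure Inst where
  seqs : List (List ℕ)
  p : ℕ
  p_pos : 1 ≤ p
  two_bins : ∀ t ∈ plts seqs, 2 ≤ seqs.flatten.count t

/-- The number `k` of sequences. -/
def Inst.k (I : Inst) : ℕ := I.seqs.length

/-- The number `m` of pallets. -/
def Inst.m (I : Inst) : ℕ := (plts I.seqs).card

/-- The total number `n` of bins. -/
def Inst.n (I : Inst) : ℕ := I.seqs.flatten.length

/-- The question: can the sequences be processed with at most `p` stack-up places? -/
def Inst.Yes (I : Inst) : Prop := Processable I.seqs I.p

/-- The input words: `p`, then `k`, then for each sequence its length followed by the pallet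
symbols of its bins. -/
def Inst.encode (I : Inst) : List ℕ :=
  I.p :: I.seqs.length :: I.seqs.flatMap (fun q => q.length :: q)

/-! ### The machine model

Random access machines with unit cost, programmed with structured control flow. A program uses
finitely many registers and finitely many arrays (of unbounded length), all of which hold natural
numbers. The arithmetic instructions are addition and truncated subtraction only (no
multiplication, division, shift or bitwise operation), so that unit cost is polynomially related
to the bit cost. -/

/-- The contents of the registers and of the arrays. -/
structure Store where
  reg : ℕ → ℕ
  arr : ℕ → ℕ → ℕ

/-- Assign the value `v` to register `x`. -/
def Store.setReg (s : Store) (x v : ℕ) : Store :=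
  { s with reg := Function.update s.reg x v }

/-- Assign the value `v` to cell `i` of array `a`. -/
def Store.setArr (s : Store) (a i v : ℕ) : Store :=
  { s with arr := Function.update s.arr a (Function.update (s.arr a) i v) }

/-- Comparisons of two registers. -/
inductive Test where
  | lt (x y : ℕ)
  | eq (x y : ℕ)

def Test.Holds (s : Store) : Test → Prop
  | .lt x y => s.reg x < s.reg y
  | .eq x y => s.reg x = s.reg y

/-- Programs; `x y z` name registers and `a` names an array. -/
inductive Prog where
  | skip
  /-- `x := c` for a constant `c` -/
  | const (x c : ℕ)
  /-- `x := y` -/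
  | copy (x y : ℕ)
  /-- `x := y + z` -/
  | add (x y z : ℕ)
  /-- `x := y - z` (truncated at zero) -/
  | sub (x y z : ℕ)
  /-- `x := a[y]` -/
  | load (x a y : ℕ)
  /-- `a[y] := x` -/
  | store (a y x : ℕ)
  /-- first `P`, then `R` -/
  | seq (P R : Prog)
  /-- if `b` then `P` else `R` -/
  | cond (b : Test) (P R : Prog)
  /-- while `b` do `P` -/
  | loop (b : Test) (P : Prog)

/-- `Exec P s t s'`: the program `P`, started in the store `s`, halts after exactly `t` steps in the
store `s'`. Each execution of an elementary instruction and each evaluation of a test is a step. -/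
inductive Exec : Prog → Store → ℕ → Store → Prop where
  | skip (s : Store) : Exec .skip s 1 s
  | const (s : Store) (x c : ℕ) : Exec (.const x c) s 1 (s.setReg x c)
  | copy (s : Store) (x y : ℕ) : Exec (.copy x y) s 1 (s.setReg x (s.reg y))
  | add (s : Store) (x y z : ℕ) : Exec (.add x y z) s 1 (s.setReg x (s.reg y + s.reg z))
  | sub (s : Store) (x y z : ℕ) : Exec (.sub x y z) s 1 (s.setReg x (s.reg y - s.reg z))
  | load (s : Store) (x a y : ℕ) : Exec (.load x a y) s 1 (s.setReg x (s.arr a (s.reg y)))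
  | store (s : Store) (a y x : ℕ) : Exec (.store a y x) s 1 (s.setArr a (s.reg y) (s.reg x))
  | seq {P R : Prog} {s s' s'' : Store} {t t' : ℕ} :
      Exec P s t s' → Exec R s' t' s'' → Exec (.seq P R) s (t + t') s''
  | cond_true {b : Test} {P R : Prog} {s s' : Store} {t : ℕ} :
      b.Holds s → Exec P s t s' → Exec (.cond b P R) s (t + 1) s'
  | cond_false {b : Test} {P R : Prog} {s s' : Store} {t : ℕ} :
      ¬ b.Holds s → Exec R s t s' → Exec (.cond b P R) s (t + 1) s'
  | loop_done {b : Test} {P : Prog} {s : Store} :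
      ¬ b.Holds s → Exec (.loop b P) s 1 s
  | loop_step {b : Test} {P : Prog} {s s' s'' : Store} {t t' : ℕ} :
      b.Holds s → Exec P s t s' → Exec (.loop b P) s' t' s'' →
        Exec (.loop b P) s (t + t' + 1) s''

/-- Programs are deterministic: the running time and the result of a halting program are unique. -/
theorem Exec.unique {P : Prog} {s s₁ s₂ : Store} {t₁ t₂ : ℕ}
    (h₁ : Exec P s t₁ s₁) (h₂ : Exec P s t₂ s₂) : t₁ = t₂ ∧ s₁ = s₂ := by
  induction h₁ generalizing t₂ s₂ with
  | skip | const | copy | add | sub | load | store => cases h₂; exact ⟨rfl, rfl⟩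
  | seq _ _ ih ih' =>
    cases h₂ with
    | seq g g' =>
      obtain ⟨rfl, rfl⟩ := ih g
      obtain ⟨rfl, rfl⟩ := ih' g'
      exact ⟨rfl, rfl⟩
  | cond_true hb _ ih =>
    cases h₂ with
    | cond_true _ g => obtain ⟨rfl, rfl⟩ := ih g; exact ⟨rfl, rfl⟩
    | cond_false hb' _ => exact absurd hb hb'
  | cond_false hb _ ih =>
    cases h₂ with
    | cond_true hb' _ => exact absurd hb' hb
    | cond_false _ g => obtain ⟨rfl, rfl⟩ := ih g; exact ⟨rfl, rfl⟩
  | loop_done hb =>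
    cases h₂ with
    | loop_done => exact ⟨rfl, rfl⟩
    | loop_step hb' _ _ => exact absurd hb' hb
  | loop_step hb _ _ ih ih' =>
    cases h₂ with
    | loop_done hb' => exact absurd hb hb'
    | loop_step _ g g' =>
      obtain ⟨rfl, rfl⟩ := ih g
      obtain ⟨rfl, rfl⟩ := ih' g'
      exact ⟨rfl, rfl⟩

/-- The initial store on the input words `w`: they stand in array `0`, and every other cell and
every register is `0`. -/
def Store.init (w : List ℕ) : Store where
  reg := fun _ => 0
  arr := fun a i => if a = 0 then w.getD i 0 else 0

/-- On the input words `w` the program `P` halts after at most `T` steps. -/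
def Prog.HaltsWithin (P : Prog) (w : List ℕ) (T : ℕ) : Prop :=
  ∃ t s, Exec P (Store.init w) t s ∧ t ≤ T

/-- On the input words `w` the program `P` halts and accepts, that is, register `0` finally
holds `1`. -/
def Prog.Accepts (P : Prog) (w : List ℕ) : Prop :=
  ∃ t s, Exec P (Store.init w) t s ∧ s.reg 0 = 1

/-! ### Parameterized problems and xp-algorithms -/

/-- A decision problem (with an encoding of its instances by input words) together with a
parameter. -/
structure ParamProblem where
  Instance : Type
  Yes : Instance → Prop
  encode : Instance → List ℕ
  param : Instance → ℕ

/-- The size of an instance: the total number of bits of its input words in binary (a word `0`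
has one bit). -/
def ParamProblem.size (Pi : ParamProblem) (I : Pi.Instance) : ℕ :=
  ((Pi.encode I).map (fun x => max 1 x.size)).sum

/-- The algorithm halts on every instance and accepts exactly the yes-instances. -/
def ParamProblem.Decides (Pi : ParamProblem) (A : Prog) : Prop :=
  ∀ I : Pi.Instance, (∃ T, A.HaltsWithin (Pi.encode I) T) ∧
    (A.Accepts (Pi.encode I) ↔ Pi.Yes I)

/-- `A` is an xp-algorithm that decides the problem: for two computable functions `f` and `g`, its
running time on every instance `I` is at most `f (κ I) * |I| ^ g (κ I)`. -/
def ParamProblem.IsXPAlgorithm (Pi : ParamProblem) (A : Prog) : Prop :=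
  Pi.Decides A ∧ ∃ f g : ℕ → ℕ, Computable f ∧ Computable g ∧
    ∀ I : Pi.Instance,
      A.HaltsWithin (Pi.encode I) (f (Pi.param I) * Pi.size I ^ g (Pi.param I))

/-- FIFO Stack-Up, parameterized by the number `p` of stack-up places. -/
def pFifoStackUp : ParamProblem where
  Instance := Inst
  Yes := Inst.Yes
  encode := Inst.encode
  param := Inst.p

end FifoStackUp

/-!
The pallets are the vertices of a directed graph with an arc from `u` to `v` whenever some sequence
has a bin for `u` before a bin for `v`. The boundary of a set `X` of pallets consists of the pallets
of `X` with an in-neighbour outside `X`. An opened pallet can be completed only when every pallet with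
a bin in front of one of its bins has been opened. Hence `Q` has a processing with at most `p` open
pallets if and only if the pallets can be added to the empty set one at a time such that all sets
have at most `w = p - 1` boundary vertices (`processable_iff_reach`). Such a layout is sought in time
`O(m ^ (w + 3))`, where `m` is the number of pallets.

The number of boundary vertices is submodular (`bd_submodular`). So if `B` can be reached from `Y`
and no set between `Y` and `B` has fewer boundary vertices than `B`, then replacing `Y` by `B` loses
nothing (`Safe`, `Reach.union`). The search keeps for each list of at most `w` vertices (a node of a
tree) a set that has grown by such safe extensions; a node at depth `d` on the path to the current
node has a set with `d` boundary vertices. At a node with the set `Y`, the child at a vertex `v`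
holds a safe extension `B` of `Y` and `v`. If `B` has no more boundary vertices than `Y`, then `Y`
is replaced by a set with fewest boundary vertices between `Y` and `B`. Otherwise the child is
searched until its set is closed, that is, nothing else reachable from it has as few boundary
vertices. A node all of whose branches are closed and have more boundary vertices is closed itself
(`ClosedSet.of_branches`), and a closed root without boundary vertices settles the question
(`ClosedSet.eq_univ`). Sets and marks of the children survive changes of the set of their parent, up
to a union with the new set (`Safe.grow`, `MinOver.grow`), which is what makes the search fast.

The sets only grow, so that a potential that counts the missing vertices and marks of all nodes pays
for the running time (`Search.potential`). There are `O(m ^ w)` nodes at depth `w`, each of which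
changes `O(m)` times at a cost of `O(m ^ 2)`. A node above them changes `O(m)` times as well, and
between changes the search passes over its `m` children at a cost of `O(m ^ 2)` each, which amounts
to `O(m ^ 4)` for each of `O(m ^ (w - 1))` nodes. A set with fewest boundary vertices between `Y` and
`B` is found in time `O(m ^ 3)` by matching the vertices of `B` outside `Y` into the vertices of `B`
off its boundary (`MinOver.of_matching`, `bd_sdiff_lt`).

The machine programs are verified with weakest preconditions (`Runs`): for each of the programs the
part of the store that it can write is computed, and a loop rule carries a budget for the remaining
running time (`Runs.loop`). The sets of the nodes stand in one array, at addresses that are computed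
along the path by additions only (`code`).
-/

namespace FifoStackUp

/-! ### Boundaries of vertex sets and layouts of bounded width -/

section Boundary

variable (V : Finset ℕ) (E : ℕ → ℕ → Prop)

open Classical in
/-- The boundary of `X`: the vertices of `X` that have an in-neighbour in `V` outside `X`. -/
noncomputable def boundary (X : Finset ℕ) : Finset ℕ :=
  X.filter (fun u => ∃ v ∈ V, v ∉ X ∧ E v u)

/-- The number of boundary vertices of `X`. -/
noncomputable def bd (X : Finset ℕ) : ℕ := (boundary V E X).card

/-- `Reach V E w X Y`: the set `Y` arises from `X` by adding vertices one at a time such that every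
set after `X` has at most `w` boundary vertices. -/
inductive Reach (w : ℕ) (X : Finset ℕ) : Finset ℕ → Prop where
  | refl : Reach w X X
  | step {Y : Finset ℕ} {v : ℕ} : Reach w X Y → v ∈ V → v ∉ Y → bd V E (insert v Y) ≤ w →
      Reach w X (insert v Y)

/-- `B` has the fewest boundary vertices among the sets between `Y` and `B`. -/
def MinOver (Y B : Finset ℕ) : Prop :=
  Y ⊆ B ∧ ∀ U, Y ⊆ U → U ⊆ B → bd V E B ≤ bd V E U

/-- A safe extension of `Y`: whatever is reachable from `Y` is, after the union with `B`, reachable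
from `B` (see `Reach.union`). -/
def Safe (w : ℕ) (Y B : Finset ℕ) : Prop := MinOver V E Y B ∧ Reach V E w Y B

/-- Nothing else reachable from `X` has as few boundary vertices as `X`. -/
def ClosedSet (w : ℕ) (X : Finset ℕ) : Prop :=
  ∀ Z, Reach V E w X Z → bd V E Z ≤ bd V E X → Z = X

variable {V E}

theorem mem_boundary {X : Finset ℕ} {u : ℕ} :
    u ∈ boundary V E X ↔ u ∈ X ∧ ∃ v ∈ V, v ∉ X ∧ E v u := by
  classical
  simp [boundary]

theorem bd_submodular (X Y : Finset ℕ) :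
    bd V E (X ∪ Y) + bd V E (X ∩ Y) ≤ bd V E X + bd V E Y := by
  unfold bd
  rw [← Finset.card_union_add_card_inter (boundary V E X), ← Finset.card_union_add_card_inter]
  refine add_le_add (Finset.card_le_card ?_) (Finset.card_le_card ?_)
  · intro u hu
    simp only [Finset.mem_union, mem_boundary, Finset.mem_inter, not_or, not_and] at hu ⊢
    rcases hu with ⟨h1 | h1, v, hv, ⟨h2, h3⟩, h4⟩ | ⟨⟨h0, h1⟩, v, hv, h2, h4⟩
    · exact Or.inl ⟨h1, v, hv, h2, h4⟩
    · exact Or.inr ⟨h1, v, hv, h3, h4⟩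
    · by_cases h : v ∈ X
      · exact Or.inr ⟨h1, v, hv, h2 h, h4⟩
      · exact Or.inl ⟨h0, v, hv, h, h4⟩
  · intro u hu
    simp only [Finset.mem_union, mem_boundary, Finset.mem_inter, not_or, not_and] at hu ⊢
    obtain ⟨⟨-, v, hv, ⟨h2, h3⟩, h4⟩, ⟨⟨h5, h6⟩, -⟩⟩ := hu
    exact ⟨⟨h5, v, hv, h2, h4⟩, ⟨h6, v, hv, h3, h4⟩⟩

@[simp] theorem bd_empty : bd V E ∅ = 0 := by simp [bd, boundary]

theorem bd_univ : bd V E V = 0 := by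
  unfold bd
  rw [Finset.card_eq_zero, Finset.eq_empty_iff_forall_notMem]
  intro u hu
  obtain ⟨-, v, hv, h, -⟩ := mem_boundary.1 hu
  exact h hv

theorem bd_le_card (X : Finset ℕ) : bd V E X ≤ X.card :=
  Finset.card_le_card fun _ hu => (mem_boundary.1 hu).1

theorem bd_insert_le (X : Finset ℕ) (v : ℕ) : bd V E (insert v X) ≤ bd V E X + 1 := by
  unfold bd
  refine le_trans (Finset.card_le_card ?_) (Finset.card_insert_le v _)
  intro u hu
  obtain ⟨h1, x, hx, h2, h3⟩ := mem_boundary.1 hu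
  rw [Finset.mem_insert] at h1 ⊢
  rcases h1 with h1 | h1
  · exact Or.inl h1
  · exact Or.inr (mem_boundary.2 ⟨h1, x, hx, fun h => h2 (Finset.mem_insert_of_mem h), h3⟩)

theorem bd_lt_card (hV : V.Nonempty) {X : Finset ℕ} (hX : X ⊆ V) : bd V E X < V.card := by
  rcases eq_or_ne X V with rfl | h
  · rw [bd_univ]; exact hV.card_pos
  · exact lt_of_le_of_lt (bd_le_card X) (Finset.card_lt_card (hX.ssubset_of_ne h))

variable {w : ℕ}

theorem Reach.subset {X Y : Finset ℕ} (h : Reach V E w X Y) : X ⊆ Y := by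
  induction h with
  | refl => exact Finset.Subset.refl _
  | step _ _ _ _ ih => exact ih.trans (Finset.subset_insert _ _)

theorem Reach.subset_univ {X Y : Finset ℕ} (h : Reach V E w X Y) (hX : X ⊆ V) : Y ⊆ V := by
  induction h with
  | refl => exact hX
  | step _ hv _ _ ih => exact Finset.insert_subset hv ih

theorem Reach.trans {X Y Z : Finset ℕ} (h : Reach V E w X Y) (h' : Reach V E w Y Z) :
    Reach V E w X Z := by
  induction h' with
  | refl => exact h
  | step _ hv h1 h2 ih => exact ih.step hv h1 h2

theorem Reach.single {X : Finset ℕ} {v : ℕ} (hv : v ∈ V) (h : bd V E (insert v X) ≤ w) :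
    Reach V E w X (insert v X) := by
  by_cases h' : v ∈ X
  · rw [Finset.insert_eq_of_mem h']; exact .refl
  · exact Reach.refl.step hv h' h

/-- A layout is decomposed at its first vertex. -/
theorem Reach.head {X Z : Finset ℕ} (h : Reach V E w X Z) :
    Z = X ∨ ∃ u ∈ V, u ∉ X ∧ bd V E (insert u X) ≤ w ∧
      Reach V E w (insert u X) Z := by
  induction h with
  | refl => exact Or.inl rfl
  | @step Y v h hv h1 h2 ih =>
    right
    rcases ih with rfl | ⟨u, hu, hu', h3, h4⟩
    · exact ⟨v, hv, h1, h2, .refl⟩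
    · exact ⟨u, hu, hu', h3, h4.step hv h1 h2⟩

theorem MinOver.refl (Y : Finset ℕ) : MinOver V E Y Y :=
  ⟨Finset.Subset.refl _, fun _ h h' => by rw [Finset.Subset.antisymm h h']⟩

theorem MinOver.union_le {Y B Z : Finset ℕ} (h : MinOver V E Y B) (hZ : Y ⊆ Z) :
    bd V E (Z ∪ B) ≤ bd V E Z := by
  have h1 := bd_submodular (V := V) (E := E) Z B
  have h2 := h.2 (Z ∩ B) (Finset.subset_inter hZ h.1) Finset.inter_subset_right
  omega

theorem MinOver.trans {Y B C : Finset ℕ} (h : MinOver V E Y B) (h' : MinOver V E B C) :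
    MinOver V E Y C := by
  refine ⟨h.1.trans h'.1, fun U h1 h2 => ?_⟩
  exact (h'.2 (U ∪ B) Finset.subset_union_right (Finset.union_subset h2 h'.1)).trans
    (h.union_le h1)

theorem Safe.trans {Y B C : Finset ℕ} (h : Safe V E w Y B) (h' : Safe V E w B C) :
    Safe V E w Y C := ⟨h.1.trans h'.1, h.2.trans h'.2⟩

theorem Safe.refl (Y : Finset ℕ) : Safe V E w Y Y := ⟨.refl Y, .refl⟩

theorem Safe.single {Y : Finset ℕ} {v : ℕ} (hv : v ∈ V) (hw : bd V E (insert v Y) ≤ w)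
    (h : bd V E (insert v Y) ≤ bd V E Y) : Safe V E w Y (insert v Y) := by
  refine ⟨⟨Finset.subset_insert _ _, fun U h1 h2 => ?_⟩, .single hv hw⟩
  by_cases hU : v ∈ U
  · rw [Finset.Subset.antisymm h2 (Finset.insert_subset hU h1)]
  · rw [Finset.Subset.antisymm ((Finset.subset_insert_iff_of_notMem hU).1 h2) h1]
    exact h

/-- The union with a set that is minimal over a subset of the start turns a feasible extension into
a feasible extension. -/
theorem Reach.union {A Y C Z : Finset ℕ} (h : Reach V E w A Z) (hY : Y ⊆ A)
    (hC : MinOver V E Y C) : Reach V E w (A ∪ C) (Z ∪ C) := by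
  induction h with
  | refl => exact .refl
  | @step Z v h hv h1 h2 ih =>
    rw [Finset.insert_union]
    refine ih.trans (.single hv ?_)
    rw [← Finset.insert_union]
    exact (hC.union_le (hY.trans (h.subset.trans (Finset.subset_insert _ _)))).trans h2

/-- A set that is minimal in the reverse direction is reached on the way. -/
theorem Reach.inter {Y B W : Finset ℕ} (h : Reach V E w Y B) (hY : Y ⊆ W) (hB : W ⊆ B)
    (hmin : ∀ U, W ⊆ U → U ⊆ B → bd V E W ≤ bd V E U) : Reach V E w Y W := by
  suffices H : ∀ Z, Reach V E w Y Z → Z ⊆ B → Reach V E w Y (Z ∩ W) by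
    have := H B h (Finset.Subset.refl _)
    rwa [Finset.inter_eq_right.2 hB] at this
  intro Z hZ
  induction hZ with
  | refl => intro _; rw [Finset.inter_eq_left.2 hY]; exact .refl
  | @step Z v h hv h1 h2 ih =>
    intro hZB
    have ih := ih ((Finset.subset_insert _ _).trans hZB)
    by_cases hvW : v ∈ W
    · rw [Finset.insert_inter_of_mem hvW]
      refine ih.trans (.single hv ?_)
      rw [← Finset.insert_inter_of_mem hvW]
      have h3 := bd_submodular (V := V) (E := E) (insert v Z) W
      have h4 := hmin (insert v Z ∪ W) Finset.subset_union_right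
        (Finset.union_subset hZB hB)
      omega
    · rwa [Finset.insert_inter_of_notMem hvW]

/-- A safe extension of `Y + v` stays safe when `Y` grows to a set that is minimal over `Y`. -/
theorem Safe.grow {Y Y' B : Finset ℕ} {v : ℕ} (h : Safe V E w (insert v Y) B)
    (hY : MinOver V E Y Y') : Safe V E w (insert v Y') (B ∪ Y') := by
  have h1 : insert v Y ∪ Y' = insert v Y' := by
    rw [Finset.insert_union, Finset.union_eq_right.2 hY.1]
  constructor
  · refine ⟨?_, fun U hU hU' => ?_⟩
    · exact Finset.insert_subset (Finset.mem_union_left _ (h.1.1 (Finset.mem_insert_self _ _)))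
        Finset.subset_union_right
    · have h2 : insert v Y ⊆ U := (Finset.insert_subset_insert _ hY.1).trans hU
      have h3 := h.1.union_le h2
      have h4 : U ∪ B = B ∪ Y' := by
        apply Finset.Subset.antisymm
        · exact Finset.union_subset hU' Finset.subset_union_left
        · exact Finset.union_subset Finset.subset_union_right
            (((Finset.subset_insert _ _).trans hU).trans Finset.subset_union_left)
      rwa [h4] at h3
  · have := h.2.union (Finset.subset_insert v Y) hY
    rwa [h1] at this

/-- When a set is minimal over its old lower end, it stays so after the lower end has grown. -/
theorem MinOver.grow {L Y X : Finset ℕ} (h : MinOver V E L Y) (hX : L ⊆ X) :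
    MinOver V E X (X ∪ Y) := by
  refine ⟨Finset.subset_union_left, fun U h1 h2 => ?_⟩
  have h3 := h.union_le (hX.trans h1)
  have h4 : U ∪ Y = X ∪ Y := Finset.Subset.antisymm
    (Finset.union_subset h2 Finset.subset_union_right)
    (Finset.union_subset_union_left h1)
  rwa [h4] at h3

/-- The branching criterion: a set is closed when every further vertex has been absorbed in a safe
extension that is closed and has more boundary vertices. -/
theorem ClosedSet.of_branches {X : Finset ℕ}
    (h : ∀ u ∈ V, u ∉ X → ∃ B, Safe V E w (insert u X) B ∧ ClosedSet V E w B ∧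
      bd V E X < bd V E B) : ClosedSet V E w X := by
  intro Z hZ hle
  rcases hZ.head with rfl | ⟨u, hu, huX, -, hr⟩
  · rfl
  · exfalso
    obtain ⟨B, h1, h2, h3⟩ := h u hu huX
    have h4 := hr.union (Finset.Subset.refl _) h1.1
    rw [Finset.union_eq_right.2 h1.1.1] at h4
    have h5 := h1.1.union_le hr.subset
    have h6 := h2 _ h4 (by omega)
    rw [h6] at h5
    omega

theorem ClosedSet.of_no_step {X : Finset ℕ} (h : ∀ u ∈ V, u ∉ X → w < bd V E (insert u X)) :
    ClosedSet V E w X := by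
  intro Z hZ _
  rcases hZ.head with rfl | ⟨u, hu, huX, hb, -⟩
  · rfl
  · exact absurd hb (not_le.2 (h u hu huX))

/-- A closed set without boundary vertices contains all vertices as soon as a layout exists: the union
with it turns the layout into one that starts from this set. -/
theorem ClosedSet.eq_univ {X : Finset ℕ} (h : ClosedSet V E w X) (h0 : bd V E X = 0)
    (hr : Reach V E w ∅ V) : X = V ∨ ¬ X ⊆ V := by
  by_cases hX : X ⊆ V
  · left
    have h1 : MinOver V E ∅ X := ⟨Finset.empty_subset _, fun _ _ _ => by omega⟩
    have h2 := hr.union (Finset.Subset.refl _) h1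
    rw [Finset.empty_union, Finset.union_eq_left.2 hX] at h2
    exact (h V h2 (by rw [bd_univ]; omega)).symm
  · exact Or.inr hX

/-- The set to which `Y` is extended when its branch `B` at `v` has few boundary vertices: a set
`W` between `Y` and `B` with fewest boundary vertices. It is reached on the way to `B`. -/
theorem Safe.of_min {Y B W : Finset ℕ} {v : ℕ} (hv : v ∈ V) (hw : bd V E (insert v Y) ≤ w)
    (h : Safe V E w (insert v Y) B) (hY : Y ⊆ W) (hB : W ⊆ B)
    (hmin : ∀ U, Y ⊆ U → U ⊆ B → bd V E W ≤ bd V E U) : Safe V E w Y W :=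
  ⟨⟨hY, fun U h1 h2 => hmin U h1 (h2.trans hB)⟩,
    ((Reach.single hv hw).trans h.2).inter hY hB fun U h1 h2 => hmin U (hY.trans h1) h2⟩

/-- A branch `B` at `v` has at most one boundary vertex more than any set between `Y` and `B`, so that
any set with fewer boundary vertices than `B` has fewest. -/
theorem Safe.le_add_one {Y B U : Finset ℕ} {v : ℕ} (h : Safe V E w (insert v Y) B)
    (hY : Y ⊆ U) (hU : U ⊆ B) : bd V E B ≤ bd V E U + 1 :=
  (h.1.2 (insert v U) (Finset.insert_subset_insert _ hY)
    (Finset.insert_subset (h.1.1 (Finset.mem_insert_self _ _)) hU)).trans (bd_insert_le U v)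

/-- Hall's condition bounds the boundary from below: if the vertices of `B` outside `Y` have
distinct out-neighbours in `B` off the boundary of `B`, then `B` is minimal over `Y`. -/
theorem MinOver.of_matching {Y B : Finset ℕ} (hBV : B ⊆ V) (hY : Y ⊆ B) (f : ℕ → ℕ)
    (hf : ∀ l ∈ B, l ∉ Y → f l ∈ B ∧ f l ∉ boundary V E B ∧ E l (f l))
    (hinj : ∀ l ∈ B, l ∉ Y → ∀ l' ∈ B, l' ∉ Y → f l = f l' → l = l') : MinOver V E Y B := by
  refine ⟨hY, fun U hYU hUB => ?_⟩
  -- The image of `B \ U` splits into vertices of `B \ U` and boundary vertices of `U`.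
  have hcard : ((B \ U).image f).card = (B \ U).card := by
    apply Finset.card_image_of_injOn
    intro a ha b hb hab
    simp only [Finset.coe_sdiff, Set.mem_sdiff, Finset.mem_coe] at ha hb
    exact hinj a ha.1 (fun h => ha.2 (hYU h)) b hb.1 (fun h => hb.2 (hYU h)) hab
  have hsub : (B \ U).image f ∪ boundary V E B ⊆ (B \ U) ∪ boundary V E U := by
    intro x hx
    rw [Finset.mem_union] at hx ⊢
    rcases hx with hx | hx
    · obtain ⟨l, hl, rfl⟩ := Finset.mem_image.1 hx
      rw [Finset.mem_sdiff] at hl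
      obtain ⟨h1, h2, h3⟩ := hf l hl.1 (fun h => hl.2 (hYU h))
      by_cases h : f l ∈ U
      · exact Or.inr (mem_boundary.2 ⟨h, l, hBV hl.1, hl.2, h3⟩)
      · exact Or.inl (Finset.mem_sdiff.2 ⟨h1, h⟩)
    · obtain ⟨h1, v, h2, h3, h4⟩ := mem_boundary.1 hx
      by_cases h : x ∈ U
      · exact Or.inr (mem_boundary.2 ⟨h, v, h2, fun h' => h3 (hUB h'), h4⟩)
      · exact Or.inl (Finset.mem_sdiff.2 ⟨h1, h⟩)
  have hdisj : Disjoint ((B \ U).image f) (boundary V E B) := by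
    rw [Finset.disjoint_left]
    intro x hx
    obtain ⟨l, hl, rfl⟩ := Finset.mem_image.1 hx
    rw [Finset.mem_sdiff] at hl
    exact (hf l hl.1 (fun h => hl.2 (hYU h))).2.1
  have h1 := Finset.card_le_card hsub
  rw [Finset.card_union_of_disjoint hdisj, hcard] at h1
  have h2 := Finset.card_union_le (B \ U) (boundary V E U)
  unfold bd
  omega

/-- The opposite direction: removing a set `S` of vertices whose out-neighbours in `B` off the
boundary number fewer than `S` makes the boundary smaller. -/
theorem bd_sdiff_lt {B S N : Finset ℕ} (hrefl : ∀ v, E v v) (hS : S ⊆ B)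
    (hN : ∀ l ∈ S, ∀ x ∈ B, x ∉ boundary V E B → E l x → x ∈ N) (hcard : N.card < S.card) :
    bd V E (B \ S) < bd V E B := by
  have hsub : boundary V E (B \ S) ∪ S ⊆ boundary V E B ∪ N := by
    intro x hx
    rw [Finset.mem_union] at hx ⊢
    by_cases hb : x ∈ boundary V E B
    · exact Or.inl hb
    right
    rcases hx with hx | hx
    · obtain ⟨h1, v, h2, h3, h4⟩ := mem_boundary.1 hx
      rw [Finset.mem_sdiff] at h1 h3
      by_cases hvB : v ∈ B
      · exact hN v (by by_contra h; exact h3 ⟨hvB, h⟩) x h1.1 hb h4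
      · exact absurd (mem_boundary.2 ⟨h1.1, v, h2, hvB, h4⟩) hb
    · exact hN x hx x (hS hx) hb (hrefl x)
  have hdisj : Disjoint (boundary V E (B \ S)) S := by
    rw [Finset.disjoint_left]
    intro x hx
    exact (Finset.mem_sdiff.1 (mem_boundary.1 hx).1).2
  have h1 := Finset.card_le_card hsub
  rw [Finset.card_union_of_disjoint hdisj] at h1
  have h2 := Finset.card_union_le (boundary V E B) N
  unfold bd
  omega

end Boundary

/-! ### Processings and layouts of the pallets -/

/-- In some sequence a bin for `u` stands before a bin for `v`; or `u = v`, which makes no difference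
for boundaries. -/
def Before (Q : List (List ℕ)) (u v : ℕ) : Prop :=
  u = v ∨ ∃ j : Fin Q.length, ∃ i, u ∈ (Q.get j).take i ∧ v ∈ (Q.get j).drop i

/-- The pallets of which some bin has been removed in `C`. -/
def opened (Q : List (List ℕ)) (C : Tuple Q) : Finset ℕ :=
  (plts Q).filter fun t => ∃ j, t ∈ (Q.get j).take (C j)

section Processing

variable {Q : List (List ℕ)}

theorem mem_plts {t : ℕ} : t ∈ plts Q ↔ ∃ j, t ∈ Q.get j := by
  simp only [plts, List.mem_toFinset, List.mem_flatten, List.get_eq_getElem]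
  constructor
  · rintro ⟨l, hl, ht⟩
    obtain ⟨i, hi, rfl⟩ := List.mem_iff_getElem.1 hl
    exact ⟨⟨i, hi⟩, ht⟩
  · rintro ⟨j, hj⟩
    exact ⟨_, List.getElem_mem j.2, hj⟩

theorem mem_opened {C : Tuple Q} {t : ℕ} : t ∈ opened Q C ↔ ∃ j, t ∈ (Q.get j).take (C j) := by
  simp only [opened, Finset.mem_filter, and_iff_right_iff_imp]
  rintro ⟨j, hj⟩
  exact mem_plts.2 ⟨j, List.mem_of_mem_take hj⟩

theorem mem_openPallets {C : Tuple Q} {t : ℕ} :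
    t ∈ openPallets Q C ↔
      (∃ j, t ∈ (Q.get j).take (C j)) ∧ (∃ l, t ∈ (Q.get l).drop (C l)) := by
  rw [openPallets, Finset.mem_filter, IsOpenPallet, and_iff_right_iff_imp]
  rintro ⟨⟨j, hj⟩, -⟩
  exact mem_plts.2 ⟨j, List.mem_of_mem_take hj⟩

theorem mem_drop_of_le {l : List ℕ} {a b x : ℕ} (h : a ≤ b) (hx : x ∈ l.drop b) :
    x ∈ l.drop a := by
  obtain ⟨c, rfl⟩ := Nat.exists_eq_add_of_le h
  rw [← List.drop_drop] at hx
  exact List.mem_of_mem_drop hx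

theorem mem_take_of_le {l : List ℕ} {a b x : ℕ} (h : a ≤ b) (hx : x ∈ l.take a) :
    x ∈ l.take b := List.take_subset_take_left l h hx

theorem boundary_opened_subset (C : Tuple Q) :
    boundary (plts Q) (Before Q) (opened Q C) ⊆ openPallets Q C := by
  intro u hu
  obtain ⟨h1, v, -, h3, h4⟩ := mem_boundary.1 hu
  refine mem_openPallets.2 ⟨mem_opened.1 h1, ?_⟩
  rcases h4 with rfl | ⟨j, i, h4, h5⟩
  · exact absurd h1 h3
  · refine ⟨j, mem_drop_of_le ?_ h5⟩
    by_contra h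
    exact h3 (mem_opened.2 ⟨j, mem_take_of_le (by omega) h4⟩)

/-- A step removes one bin. If this bin opens a pallet, the number of open pallets grows, since
every pallet has a second bin. -/
theorem Step.opened {C C' : Tuple Q} (h : Step Q C C')
    (h2 : ∀ t ∈ plts Q, 2 ≤ Q.flatten.count t) :
    opened Q C' = opened Q C ∨ ∃ t ∈ plts Q, opened Q C' = insert t (opened Q C) ∧
      (openPallets Q C).card + 1 ≤ (openPallets Q C').card := by
  obtain ⟨j, hj, rfl⟩ := h
  set t := (Q.get j)[C j] with ht
  have htake : (Q.get j).take (C j + 1) = (Q.get j).take (C j) ++ [t] :=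
    (List.take_append_getElem hj).symm
  have hdrop : (Q.get j).drop (C j) = t :: (Q.get j).drop (C j + 1) :=
    List.drop_eq_getElem_cons hj
  have htV : t ∈ plts Q := mem_plts.2 ⟨j, List.getElem_mem hj⟩
  have hop : FifoStackUp.opened Q (Function.update C j (C j + 1)) = insert t (FifoStackUp.opened Q C) := by
    ext u
    rw [Finset.mem_insert, mem_opened, mem_opened]
    constructor
    · rintro ⟨l, hl⟩
      by_cases hlj : l = j
      · subst hlj
        rw [Function.update_self, htake, List.mem_append, List.mem_singleton] at hl
        exact hl.elim (fun h => Or.inr ⟨l, h⟩) Or.inl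
      · rw [Function.update_of_ne hlj] at hl
        exact Or.inr ⟨l, hl⟩
    · rintro (rfl | ⟨l, hl⟩)
      · exact ⟨j, by rw [Function.update_self, htake]; simp⟩
      · refine ⟨l, mem_take_of_le ?_ hl⟩
        by_cases hlj : l = j
        · subst hlj; rw [Function.update_self]; omega
        · rw [Function.update_of_ne hlj]
  by_cases hto : t ∈ FifoStackUp.opened Q C
  · left; rw [hop, Finset.insert_eq_of_mem hto]
  right
  refine ⟨t, htV, hop, ?_⟩
  have hto' : ∀ l, t ∉ (Q.get l).take (C l) := fun l hl => hto (mem_opened.2 ⟨l, hl⟩)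
  have hnot : t ∉ openPallets Q C := fun h => hto (mem_opened.2 (mem_openPallets.1 h).1)
  rw [← Finset.card_insert_of_notMem hnot]
  refine Finset.card_le_card (Finset.insert_subset ?_ ?_)
  · refine mem_openPallets.2 ⟨mem_opened.1 (hop ▸ Finset.mem_insert_self _ _), ?_⟩
    by_contra hno
    push Not at hno
    have hcount : ∀ l, (Q.get l).count t = if l = j then 1 else 0 := by
      intro l
      have h3 := hno l
      rw [← List.take_append_drop (C l) (Q.get l), List.count_append,
        List.count_eq_zero_of_not_mem (hto' l)]
      split_ifs with hlj
      · subst hlj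
        rw [Function.update_self] at h3
        rw [hdrop, List.count_cons_self, List.count_eq_zero_of_not_mem h3]
      · rw [Function.update_of_ne hlj] at h3
        rw [List.count_eq_zero_of_not_mem h3]
    have h4 := h2 t htV
    rw [List.count_flatten, ← List.ofFn_get (l := Q), List.map_ofFn, List.sum_ofFn] at h4
    have h5 : ∀ l, (List.count t ∘ Q.get) l = if l = j then 1 else 0 := hcount
    rw [Finset.sum_congr rfl (fun l _ => h5 l)] at h4
    simp at h4
  · intro u hu
    obtain ⟨h3, l, h4⟩ := mem_openPallets.1 hu
    have hut : u ≠ t := fun h => hnot (h ▸ hu)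
    refine mem_openPallets.2 ⟨mem_opened.1 ?_, l, ?_⟩
    · rw [hop]; exact Finset.mem_insert_of_mem (mem_opened.2 h3)
    · by_cases hlj : l = j
      · subst hlj
        rw [Function.update_self]
        rw [hdrop, List.mem_cons] at h4
        exact h4.resolve_left hut
      · rwa [Function.update_of_ne hlj]

/-- The pallets in the order in which they are opened form a layout. A boundary vertex of the set of
the opened pallets is open, and a pallet that has just been opened is open as well, because it has
a second bin; this accounts for the difference between `p` and `p - 1`. -/
theorem reach_of_processable {p : ℕ} (h2 : ∀ t ∈ plts Q, 2 ≤ Q.flatten.count t)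
    (h : Processable Q p) : Reach (plts Q) (Before Q) (p - 1) ∅ (plts Q) := by
  -- All opened pallets except possibly the last one form a reachable set.
  let Inv : Tuple Q → Prop := fun C => ∃ Y, Reach (plts Q) (Before Q) (p - 1) ∅ Y ∧
    (opened Q C = Y ∨ ∃ t ∈ plts Q, opened Q C = insert t Y)
  have hreach : ∀ C, Inv C → bd (plts Q) (Before Q) (opened Q C) ≤ p - 1 →
      Reach (plts Q) (Before Q) (p - 1) ∅ (opened Q C) := by
    rintro C ⟨Y, hY, h | ⟨t, ht, h⟩⟩ hb
    · rwa [h]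
    · rw [h] at hb ⊢
      exact hY.trans (.single ht hb)
  have hstep : ∀ C C', Inv C → Step Q C C' → (openPallets Q C').card ≤ p → Inv C' := by
    intro C C' hC hs hc
    rcases hs.opened h2 with h3 | ⟨t, ht, h3, h4⟩
    · obtain ⟨Y, hY⟩ := hC
      exact ⟨Y, by rwa [h3]⟩
    · refine ⟨opened Q C, hreach C hC ?_, Or.inr ⟨t, ht, h3⟩⟩
      exact (Finset.card_le_card (boundary_opened_subset C)).trans (by omega)
  have hchain : ∀ (l : List (Tuple Q)) C, Inv C → (C :: l).IsChain (Step Q) →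
      (∀ D ∈ C :: l, (openPallets Q D).card ≤ p) →
      ∀ D, (C :: l).getLast? = some D → Inv D := by
    intro l
    induction l with
    | nil => intro C hC _ _ D hD; simp at hD; exact hD ▸ hC
    | cons C' l ih =>
      intro C hC hch hall D hD
      rw [List.isChain_cons_cons] at hch
      refine ih C' (hstep C C' hC hch.1 (hall C' (by simp))) hch.2
        (fun D hD => hall D (List.mem_cons_of_mem _ hD)) D ?_
      simpa using hD
  obtain ⟨P, ⟨hhead, hlast, hch, -⟩, hall⟩ := h
  cases P with
  | nil => simp at hhead
  | cons C l =>
    simp only [List.head?_cons, Option.some.injEq] at hhead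
    subst hhead
    have hI := hchain l _ ⟨∅, .refl, Or.inl (by
      rw [Finset.eq_empty_iff_forall_notMem]
      intro u hu
      obtain ⟨j, hj⟩ := mem_opened.1 hu
      simp at hj)⟩ hch hall _ hlast
    have hV : opened Q (fun j => (Q.get j).length) = plts Q := by
      ext u
      rw [mem_opened, mem_plts]
      simp
    have := hreach _ hI
    rw [hV, bd_univ] at this
    exact this (Nat.zero_le _)

/-- The configuration reached by removing bins for the pallets of `X` as long as possible. -/
def clear (Q : List (List ℕ)) (X : Finset ℕ) : Tuple Q :=
  fun j => ((Q.get j).takeWhile (fun t => decide (t ∈ X))).length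

theorem clear_le (X : Finset ℕ) (j : Fin Q.length) : clear Q X j ≤ (Q.get j).length :=
  (List.takeWhile_sublist _).length_le

theorem clear_mono {X Y : Finset ℕ} (h : X ⊆ Y) (j : Fin Q.length) : clear Q X j ≤ clear Q Y j := by
  unfold clear
  generalize Q.get j = q
  induction q with
  | nil => simp
  | cons a q ih =>
    rw [List.takeWhile_cons, List.takeWhile_cons]
    by_cases ha : a ∈ X
    · simpa [ha, h ha] using ih
    · simp [ha]

theorem take_clear (X : Finset ℕ) (j : Fin Q.length) :
    (Q.get j).take (clear Q X j) = (Q.get j).takeWhile (fun t => decide (t ∈ X)) := by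
  unfold clear
  conv_lhs => rw [← List.takeWhile_append_dropWhile (p := fun t => decide (t ∈ X)) (l := Q.get j)]
  rw [List.takeWhile_append_dropWhile]
  exact (List.prefix_iff_eq_take.1 (List.takeWhile_prefix _)).symm

theorem getElem_clear_notMem (X : Finset ℕ) (j : Fin Q.length)
    (h : clear Q X j < (Q.get j).length) : (Q.get j)[clear Q X j] ∉ X := by
  unfold clear at h ⊢
  generalize Q.get j = q at h ⊢
  induction q with
  | nil => simp at h
  | cons a q ih =>
    by_cases ha : a ∈ X
    · simp only [List.takeWhile_cons, ha, decide_true, if_true, List.length_cons] at h ⊢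
      simpa using ih (by simpa using h)
    · simp [ha]

/-- While the configuration changes from `clear Q Y` to `clear Q (insert t Y)`, the open pallets are
`t` and boundary vertices of `Y`: the next bin of a sequence in `clear Q Y` belongs to a pallet
outside `Y`, and it comes after the removed bins of its sequence and before the remaining ones. -/
theorem openPallets_subset {Y : Finset ℕ} {t : ℕ} {C : Tuple Q}
    (h1 : ∀ j, clear Q Y j ≤ C j) (h2 : ∀ j, C j ≤ clear Q (insert t Y) j) :
    openPallets Q C ⊆ insert t (boundary (plts Q) (Before Q) Y) := by
  intro u hu
  obtain ⟨⟨j, hj⟩, l, hl⟩ := mem_openPallets.1 hu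
  rw [Finset.mem_insert]
  by_cases hut : u = t
  · exact Or.inl hut
  right
  have huY : u ∈ Y := by
    have h3 := mem_take_of_le (h2 j) hj
    rw [take_clear] at h3
    have h4 := List.mem_takeWhile_imp h3
    simpa [hut] using h4
  have h5 := mem_drop_of_le (h1 l) hl
  have h6 : clear Q Y l < (Q.get l).length := by
    by_contra h
    rw [List.drop_eq_nil_of_le (by omega)] at h5
    simp at h5
  have h7 := getElem_clear_notMem Y l h6
  rw [List.drop_eq_getElem_cons h6, List.mem_cons] at h5
  refine mem_boundary.2 ⟨huY, _, mem_plts.2 ⟨l, List.getElem_mem h6⟩, h7, Or.inr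
    ⟨l, clear Q Y l + 1, ?_, h5.resolve_left fun h => h7 (h ▸ huY)⟩⟩
  rw [← List.take_append_getElem h6]
  exact List.mem_append_right _ (List.mem_singleton.2 rfl)

/-- From `C` to a larger configuration `D` by steps, staying in the box between them. -/
theorem reflTransGen_step {G : Tuple Q → Prop} (N : ℕ) : ∀ C D : Tuple Q, ∑ j, (D j - C j) = N →
    (∀ j, C j ≤ D j) → (∀ j, D j ≤ (Q.get j).length) →
    (∀ B : Tuple Q, (∀ j, C j ≤ B j) → (∀ j, B j ≤ D j) → G B) →
    Relation.ReflTransGen (fun A B => Step Q A B ∧ G B) C D := by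
  induction N with
  | zero =>
    intro C D h h1 _ _
    have : C = D := by
      funext j
      have := Finset.sum_eq_zero_iff.1 h j (Finset.mem_univ j)
      have := h1 j
      omega
    rw [this]
  | succ N ih =>
    intro C D h h1 h2 hG
    obtain ⟨j, hj⟩ : ∃ j, C j < D j := by
      by_contra hno
      push Not at hno
      have : ∑ j, (D j - C j) = 0 := Finset.sum_eq_zero fun j _ => by have := hno j; omega
      omega
    have hle : ∀ i, Function.update C j (C j + 1) i ≤ D i := by
      intro i
      by_cases hij : i = j
      · subst hij; rw [Function.update_self]; exact hj
      · rw [Function.update_of_ne hij]; exact h1 i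
    have hge : ∀ i, C i ≤ Function.update C j (C j + 1) i := by
      intro i
      by_cases hij : i = j
      · subst hij; rw [Function.update_self]; omega
      · rw [Function.update_of_ne hij]
    refine Relation.ReflTransGen.head (b := Function.update C j (C j + 1))
      ⟨⟨j, hj.trans_le (h2 j), rfl⟩, hG _ hge hle⟩ (ih _ D ?_ hle h2
        fun B hB hB' => hG B (fun i => (hge i).trans (hB i)) hB')
    have h3 := Finset.add_sum_erase Finset.univ (fun i => D i - C i) (Finset.mem_univ j)
    have h4 := Finset.add_sum_erase Finset.univ
      (fun i => D i - Function.update C j (C j + 1) i) (Finset.mem_univ j)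
    have h5 : ∑ i ∈ Finset.univ.erase j, (D i - Function.update C j (C j + 1) i) =
        ∑ i ∈ Finset.univ.erase j, (D i - C i) :=
      Finset.sum_congr rfl fun i hi => by
        rw [Function.update_of_ne (Finset.ne_of_mem_erase hi)]
    simp only [Function.update_self] at h4
    omega

/-- A layout is turned into a processing by clearing its successive vertex sets. -/
theorem processable_of_reach {p : ℕ} (hp : 1 ≤ p)
    (h : Reach (plts Q) (Before Q) (p - 1) ∅ (plts Q)) : Processable Q p := by
  let G : Tuple Q → Prop := fun C => IsConfig Q C ∧ (openPallets Q C).card ≤ p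
  have key : ∀ Z, Reach (plts Q) (Before Q) (p - 1) ∅ Z →
      bd (plts Q) (Before Q) Z ≤ p - 1 ∧
      Relation.ReflTransGen (fun A B => Step Q A B ∧ G B) (clear Q ∅) (clear Q Z) := by
    intro Z hZ
    induction hZ with
    | refl => exact ⟨by simp, .refl⟩
    | @step Y t _ ht htY hb ih =>
      refine ⟨hb, ih.2.trans (reflTransGen_step _ _ _ rfl
        (fun j => clear_mono (Finset.subset_insert _ _) j) (fun j => clear_le _ j) ?_)⟩
      intro B h1 h2
      refine ⟨fun j => (h2 j).trans (clear_le _ j), ?_⟩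
      refine (Finset.card_le_card (openPallets_subset h1 h2)).trans
        ((Finset.card_insert_le _ _).trans ?_)
      have := ih.1
      unfold bd at this
      omega
  have h1 := (key _ h).2
  have h0 : clear Q ∅ = fun _ => 0 := by
    funext j; simp [clear]
  have hV : clear Q (plts Q) = fun j => (Q.get j).length := by
    funext j
    unfold clear
    rw [List.takeWhile_eq_self_iff.2]
    intro x hx
    exact decide_eq_true (mem_plts.2 ⟨j, hx⟩)
  rw [h0, hV] at h1
  have hG0 : G (fun _ => 0) := by
    refine ⟨fun _ => Nat.zero_le _, ?_⟩
    have : openPallets Q (fun _ => 0) = ∅ := by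
      rw [Finset.eq_empty_iff_forall_notMem]
      intro u hu
      obtain ⟨⟨j, hj⟩, -⟩ := mem_openPallets.1 hu
      simp at hj
    rw [this]; simp
  obtain ⟨l, hl, hlast⟩ := List.exists_isChain_cons_of_relationReflTransGen h1
  have hall : ∀ (l : List (Tuple Q)) C, G C → (C :: l).IsChain (fun A B => Step Q A B ∧ G B) →
      ∀ D ∈ C :: l, G D := by
    intro l
    induction l with
    | nil => intro C hC _ D hD; simp at hD; exact hD ▸ hC
    | cons C' l ih =>
      intro C hC hch D hD
      rw [List.isChain_cons_cons] at hch
      rcases List.mem_cons.1 hD with rfl | hD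
      · exact hC
      · exact ih C' hch.1.2 hch.2 D hD
  have hall := hall l _ hG0 hl
  refine ⟨_ :: l, ⟨rfl, ?_, hl.imp fun _ _ h => h.1, fun C hC => (hall C hC).1⟩,
    fun C hC => (hall C hC).2⟩
  rw [List.getLast?_eq_getLast_of_ne_nil (List.cons_ne_nil _ _), hlast]

theorem processable_iff_reach {p : ℕ} (hp : 1 ≤ p) (h2 : ∀ t ∈ plts Q, 2 ≤ Q.flatten.count t) :
    Processable Q p ↔ Reach (plts Q) (Before Q) (p - 1) ∅ (plts Q) :=
  ⟨reach_of_processable h2, processable_of_reach hp⟩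

end Processing

/-! ### Renaming vertices -/

section Rename

variable {V V' : Finset ℕ} {E E' : ℕ → ℕ → Prop} {f : ℕ → ℕ} {w : ℕ}

theorem bd_image (hf : Set.InjOn f V') (hV : V'.image f = V)
    (hE : ∀ u ∈ V', ∀ v ∈ V', (E' u v ↔ E (f u) (f v))) {X : Finset ℕ} (hX : X ⊆ V') :
    bd V E (X.image f) = bd V' E' X := by
  unfold bd
  rw [← Finset.card_image_of_injOn (s := boundary V' E' X) (f := f)
    (hf.mono fun u hu => hX (mem_boundary.1 hu).1)]
  congr 1
  ext y
  rw [mem_boundary, Finset.mem_image, Finset.mem_image]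
  constructor
  · rintro ⟨⟨u, hu, rfl⟩, v, hv, hvX, hvu⟩
    rw [← hV] at hv
    obtain ⟨v, hv', rfl⟩ := Finset.mem_image.1 hv
    exact ⟨u, mem_boundary.2 ⟨hu, v, hv', fun h => hvX (Finset.mem_image_of_mem _ h),
      (hE v hv' u (hX hu)).2 hvu⟩, rfl⟩
  · rintro ⟨u, hu, rfl⟩
    obtain ⟨h1, v, h2, h3, h4⟩ := mem_boundary.1 hu
    refine ⟨⟨u, h1, rfl⟩, f v, hV ▸ Finset.mem_image_of_mem _ h2, ?_, (hE v h2 u (hX h1)).1 h4⟩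
    rintro h
    obtain ⟨v', h5, h6⟩ := Finset.mem_image.1 h
    rw [hf (hX h5) h2 h6] at h5
    exact h3 h5

theorem reach_image_iff (hf : Set.InjOn f V') (hV : V'.image f = V)
    (hE : ∀ u ∈ V', ∀ v ∈ V', (E' u v ↔ E (f u) (f v))) :
    Reach V E w ∅ V ↔ Reach V' E' w ∅ V' := by
  constructor
  · have key : ∀ Z, Reach V E w ∅ Z → ∃ Y ⊆ V', Z = Y.image f ∧ Reach V' E' w ∅ Y := by
      intro Z hZ
      induction hZ with
      | refl => exact ⟨∅, by simp, by simp, .refl⟩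
      | step _ hv hvY hb ih =>
        obtain ⟨Y, hY, rfl, hr⟩ := ih
        rw [← hV] at hv
        obtain ⟨v, hv', rfl⟩ := Finset.mem_image.1 hv
        rw [← Finset.image_insert] at hb ⊢
        have hsub := Finset.insert_subset hv' hY
        rw [bd_image hf hV hE hsub] at hb
        exact ⟨_, hsub, rfl, hr.trans (.single hv' hb)⟩
    intro h
    obtain ⟨Y, hY, h1, h2⟩ := key V h
    rw [← hV] at h1
    have : Y = V' := by
      refine Finset.eq_of_subset_of_card_le hY ?_
      rw [← Finset.card_image_of_injOn hf, h1]
      exact Finset.card_image_le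
    rwa [this] at h2
  · have key : ∀ Z, Reach V' E' w ∅ Z → Reach V E w ∅ (Z.image f) := by
      intro Z hZ
      induction hZ with
      | refl => rw [Finset.image_empty]; exact .refl
      | step h hv hvY hb ih =>
        have hsub := Finset.insert_subset hv (h.subset_univ (Finset.empty_subset _))
        rw [← bd_image hf hV hE hsub] at hb
        rw [Finset.image_insert] at hb ⊢
        exact ih.trans (.single (hV ▸ Finset.mem_image_of_mem _ hv) hb)
    intro h
    have := key V' h
    rwa [hV] at this

end Rename

/-! ### The search -/

/-- The state of the search for a layout of the vertices `0, …, m - 1`. The nodes of the search tree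
are lists of vertices (the most recent vertex first); `F s` is the vertex set found so far at the
node `s`, and `dn s` tells that it is known to be closed. The search is at the node `cur`, where the
vertices below `v` have been dealt with; `run` tells that it goes on. -/
structure Search where
  F : List ℕ → Finset ℕ
  dn : List ℕ → Bool
  cur : List ℕ
  v : ℕ
  run : Bool

namespace Search

variable (m w : ℕ) (E : ℕ → ℕ → Prop)

/-- The vertex `u` has been dealt with at the node `t`: it belongs to the set of `t`, or its branch
is closed and has more boundary vertices than this set. -/
def Branch (F : List ℕ → Finset ℕ) (t : List ℕ) (u : ℕ) : Prop :=
  u ∈ F t ∨ insert u (F t) ⊆ F (u :: t) ∧ ClosedSet (Finset.range m) E w (F (u :: t)) ∧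
    bd (Finset.range m) E (F t) < bd (Finset.range m) E (F (u :: t)) ∧
    Safe (Finset.range m) E w (insert u (F t)) (F (u :: t))

/-- The invariant of the nodes on the path to the current node `s`, where `v` is the next vertex
at `s`: a node at depth `d` has `d` boundary vertices. -/
def Stack (F : List ℕ → Finset ℕ) (dn : List ℕ → Bool) : List ℕ → ℕ → Prop
  | [], v => bd (Finset.range m) E (F []) = 0 ∧ dn [] = false ∧ ∀ u < v, Branch m w E F [] u
  | x :: t, v => (bd (Finset.range m) E (F (x :: t)) = t.length + 1 ∧ dn (x :: t) = false ∧
      ∀ u < v, Branch m w E F (x :: t) u) ∧ x ∉ F t ∧ insert x (F t) ⊆ F (x :: t) ∧ Stack F dn t x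

/-- The invariant of the search. The set of a node `x :: s` is a safe extension of `insert x L` for
an earlier set `L` of the node `s`. -/
structure Inv (st : Search) : Prop where
  letter : ∀ x ∈ st.cur, x < m
  depth : st.cur.length ≤ w
  v_le : st.v ≤ m
  sub : ∀ s, st.F s ⊆ Finset.range m
  branch : ∀ s x, st.F (x :: s) = ∅ ∨ x ∈ st.F (x :: s) ∧ ∃ L ⊆ st.F (x :: s),
    MinOver (Finset.range m) E L (st.F s) ∧
      Safe (Finset.range m) E w (insert x L) (st.F (x :: s))
  fresh : ∀ s x y, st.F (y :: s) = ∅ → st.F (x :: y :: s) = ∅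
  root : Reach (Finset.range m) E w ∅ (st.F [])
  closed : ∀ s, st.dn s = true → ClosedSet (Finset.range m) E w (st.F s)
  stack : st.run = true → Stack m w E st.F st.dn st.cur st.v
  final : st.run = false → ClosedSet (Finset.range m) E w (st.F []) ∧
    bd (Finset.range m) E (st.F []) = 0

/-- The initial state: all sets are empty. -/
def start : Search := ⟨fun _ => ∅, fun _ => false, [], 0, true⟩

/-- Add `v` and the set of the current node to the set of its child at `v`. -/
def refresh (st : Search) : Search :=
  { st with
    F := Function.update st.F (st.v :: st.cur)
      (st.F (st.v :: st.cur) ∪ insert st.v (st.F st.cur))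
    dn := Function.update st.dn (st.v :: st.cur) (st.dn (st.v :: st.cur) &&
      decide (st.F (st.v :: st.cur) ∪ insert st.v (st.F st.cur) = st.F (st.v :: st.cur))) }

/-- Go on to the next vertex at the current node. -/
def advance (st : Search) : Search := { st with v := st.v + 1 }

/-- Enter the child at `v`. -/
def descend (st : Search) : Search := { st with cur := st.v :: st.cur, v := 0 }

/-- Replace the set of the current node and start again with its first vertex. -/
def grow (st : Search) (W : Finset ℕ) : Search :=
  { st with F := Function.update st.F st.cur W, v := 0 }

/-- Mark the current node as closed. -/
def close (st : Search) : Search := { st with dn := Function.update st.dn st.cur true }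

/-- Return to the parent of the current node, where the same child is next again; at the root, the
search ends. -/
def pop (st : Search) : Search :=
  match st.cur with
  | [] => { st with run := false }
  | x :: t => { st with cur := t, v := x }

variable {m w E} {st : Search}

theorem Stack.bd_eq {F : List ℕ → Finset ℕ} {dn : List ℕ → Bool} {s : List ℕ} {v : ℕ}
    (h : Stack m w E F dn s v) : bd (Finset.range m) E (F s) = s.length := by
  cases s with
  | nil => exact h.1
  | cons x t => exact h.1.1

theorem Stack.dn_eq {F : List ℕ → Finset ℕ} {dn : List ℕ → Bool} {s : List ℕ} {v : ℕ}
    (h : Stack m w E F dn s v) : dn s = false := by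
  cases s with
  | nil => exact h.2.1
  | cons x t => exact h.1.2.1

theorem Stack.branch {F : List ℕ → Finset ℕ} {dn : List ℕ → Bool} {s : List ℕ} {v : ℕ}
    (h : Stack m w E F dn s v) : ∀ u < v, Branch m w E F s u := by
  cases s with
  | nil => exact h.2.2
  | cons x t => exact h.1.2.2

theorem Stack.nonempty {F : List ℕ → Finset ℕ} {dn : List ℕ → Bool} {s : List ℕ} {v : ℕ}
    (h : Stack m w E F dn s v) (hs : s ≠ []) : F s ≠ ∅ := by
  cases s with
  | nil => exact absurd rfl hs
  | cons x t =>
    intro h0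
    have := h.2.2.1 (Finset.mem_insert_self x _)
    rw [h0] at this
    simp at this

/-- The invariant of the path refers only to the nodes not deeper than the current node and to the
children of the current node before `v`. -/
theorem Stack.congr {F F' : List ℕ → Finset ℕ} {dn dn' : List ℕ → Bool} {s : List ℕ} {v v' : ℕ}
    (h : Stack m w E F dn s v) (hF : ∀ t, t.length ≤ s.length → F' t = F t)
    (hdn : ∀ t, t.length ≤ s.length → dn' t = dn t)
    (hB : ∀ u < v', Branch m w E F' s u) : Stack m w E F' dn' s v' := by
  induction s generalizing v v' with
  | nil =>
    obtain ⟨h1, h2, -⟩ := h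
    exact ⟨by rw [hF _ le_rfl]; exact h1, by rw [hdn _ le_rfl]; exact h2, hB⟩
  | cons x t ih =>
    obtain ⟨⟨h1, h2, -⟩, h3, h4, h5⟩ := h
    have hl : t.length ≤ (x :: t).length := by simp
    refine ⟨⟨by rw [hF _ le_rfl]; exact h1, by rw [hdn _ le_rfl]; exact h2, hB⟩,
      by rw [hF _ hl]; exact h3, by rw [hF _ hl, hF _ le_rfl]; exact h4,
      ih h5 (fun t' ht' => hF t' (ht'.trans hl)) (fun t' ht' => hdn t' (ht'.trans hl)) ?_⟩
    intro u hu
    have := h5.branch u hu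
    unfold Branch at this ⊢
    rwa [hF _ hl, hF (u :: t) (by simp)]

/-- The path below the current node does not depend on the set of the current node. -/
theorem Stack.congr_parent {F F' : List ℕ → Finset ℕ} {dn dn' : List ℕ → Bool} {x : ℕ}
    {t : List ℕ} (h : Stack m w E F dn t x) (hF : ∀ s, s ≠ x :: t → F' s = F s)
    (hdn : ∀ s, s ≠ x :: t → dn' s = dn s) : Stack m w E F' dn' t x := by
  have hne : ∀ s : List ℕ, s.length ≤ t.length → s ≠ x :: t := by
    rintro s hs rfl
    simp at hs
  refine h.congr (fun s hs => hF s (hne s hs)) (fun s hs => hdn s (hne s hs)) ?_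
  intro u hu
  have := h.branch u hu
  unfold Branch at this ⊢
  rwa [hF t (hne t le_rfl), hF (u :: t) (by simp; omega)]

theorem inv_start : Inv m w E start where
  letter := by simp [start]
  depth := by simp [start]
  v_le := by simp [start]
  sub := by simp [start]
  branch := fun s x => Or.inl rfl
  fresh := fun _ _ _ _ => rfl
  root := .refl
  closed := by simp [start]
  stack := fun _ => ⟨by simp [start], rfl, by simp [start]⟩
  final := by simp [start]

/-- The set of the refreshed child is a safe extension of the current set and `v`. -/
theorem Inv.safe_refresh (h : Inv m w E st) :
    Safe (Finset.range m) E w (insert st.v (st.F st.cur))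
      (st.refresh.F (st.v :: st.cur)) := by
  simp only [refresh, Function.update_self]
  rcases h.branch st.cur st.v with h1 | ⟨h1, L, -, h2, h3⟩
  · rw [h1, Finset.empty_union]; exact .refl _
  · have h4 := h3.grow h2
    have h5 : st.F (st.v :: st.cur) ∪ insert st.v (st.F st.cur) =
        st.F (st.v :: st.cur) ∪ st.F st.cur := by
      rw [Finset.union_insert, Finset.insert_eq_of_mem (Finset.mem_union_left _ h1)]
    rwa [h5]

theorem refresh_F_of_ne {s : List ℕ} (h : s ≠ st.v :: st.cur) : st.refresh.F s = st.F s := by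
  simp [refresh, Function.update_of_ne h]

theorem refresh_F_cur : st.refresh.F st.cur = st.F st.cur :=
  refresh_F_of_ne (fun h => by have := congrArg List.length h; simp at this)

theorem refresh_dn_of_ne {s : List ℕ} (h : s ≠ st.v :: st.cur) : st.refresh.dn s = st.dn s := by
  simp [refresh, Function.update_of_ne h]

theorem Inv.refresh (h : Inv m w E st) (hrun : st.run = true) (hv : st.v < m) :
    Inv m w E st.refresh where
  letter := h.letter
  depth := h.depth
  v_le := h.v_le
  sub := by
    intro s
    by_cases hs : s = st.v :: st.cur
    · subst hs
      simp only [Search.refresh, Function.update_self]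
      exact Finset.union_subset (h.sub _)
        (Finset.insert_subset (Finset.mem_range.2 hv) (h.sub _))
    · rw [refresh_F_of_ne hs]; exact h.sub s
  branch := by
    intro s x
    by_cases hs : x :: s = st.v :: st.cur
    · obtain ⟨rfl, rfl⟩ := List.cons.inj hs
      right
      have h1 := h.safe_refresh
      refine ⟨h1.1.1 (Finset.mem_insert_self _ _), st.F st.cur,
        (Finset.subset_insert _ _).trans h1.1.1, ?_, h1⟩
      rw [refresh_F_cur]; exact .refl _
    · rw [refresh_F_of_ne hs]
      by_cases hs' : s = st.v :: st.cur
      · subst hs'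
        by_cases h0 : st.F (st.v :: st.cur) = ∅
        · exact Or.inl (h.fresh _ _ _ h0)
        · refine (h.branch (st.v :: st.cur) x).imp_right ?_
          rintro ⟨h1, L, h2, h3, h4⟩
          refine ⟨h1, L, h2, h3.trans ?_, h4⟩
          rcases h.branch st.cur st.v with h5 | ⟨h5, L', h6, h7, -⟩
          · exact absurd h5 h0
          · have h8 := h7.grow h6
            simp only [Search.refresh, Function.update_self]
            rwa [Finset.union_insert, Finset.insert_eq_of_mem (Finset.mem_union_left _ h5)]
      · rw [refresh_F_of_ne hs']; exact h.branch s x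
  fresh := by
    intro s x y hy
    have hyc : y :: s ≠ st.v :: st.cur := by
      intro hs
      rw [hs] at hy
      have := h.safe_refresh.1.1 (Finset.mem_insert_self _ _)
      rw [hy] at this
      simp at this
    rw [refresh_F_of_ne hyc] at hy
    have hxc : x :: y :: s ≠ st.v :: st.cur := by
      intro hs
      obtain ⟨-, hs⟩ := List.cons.inj hs
      exact (h.stack hrun).nonempty (by rw [← hs]; simp) (hs ▸ hy)
    rw [refresh_F_of_ne hxc]
    exact h.fresh _ _ _ hy
  root := by
    rw [refresh_F_of_ne (by simp)]; exact h.root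
  closed := by
    intro s hs
    by_cases hsc : s = st.v :: st.cur
    · subst hsc
      simp only [Search.refresh, Function.update_self, Bool.and_eq_true, decide_eq_true_eq] at hs ⊢
      rw [hs.2]; exact h.closed _ hs.1
    · rw [refresh_F_of_ne hsc]
      rw [refresh_dn_of_ne hsc] at hs
      exact h.closed _ hs
  stack := by
    intro _
    have hne : ∀ s : List ℕ, s.length ≤ st.cur.length → s ≠ st.v :: st.cur := by
      rintro s hs rfl
      simp at hs
    refine (h.stack hrun).congr (fun s hs => refresh_F_of_ne (hne s hs))
      (fun s hs => refresh_dn_of_ne (hne s hs)) ?_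
    intro u hu
    have := (h.stack hrun).branch u hu
    have hu' : u < st.v := hu
    unfold Branch at this ⊢
    rwa [refresh_F_cur, refresh_F_of_ne (s := u :: st.cur) (by simp; omega)]
  final := by
    intro hr
    have : st.run = false := hr
    simp [hrun] at this

theorem Inv.advance (h : Inv m w E st) (hrun : st.run = true) (hv : st.v < m)
    (hb : Branch m w E st.F st.cur st.v) : Inv m w E st.advance :=
  { h with
    v_le := hv
    stack := fun _ => (h.stack hrun).congr (fun _ _ => rfl) (fun _ _ => rfl) (by
      intro u hu
      rcases Nat.lt_succ_iff_lt_or_eq.1 hu with hu | rfl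
      · exact (h.stack hrun).branch u hu
      · exact hb) }

/-- A child has at most one boundary vertex more than its parent, and hence exactly one more when it
is entered. -/
theorem Inv.bd_refresh_le (h : Inv m w E st) (hrun : st.run = true) :
    bd (Finset.range m) E (st.refresh.F (st.v :: st.cur)) ≤ st.cur.length + 1 := by
  have h1 := h.safe_refresh
  rw [← (h.stack hrun).bd_eq]
  exact h1.le_add_one (Finset.Subset.refl _) ((Finset.subset_insert _ _).trans h1.1.1)

theorem Inv.advance_refresh (h : Inv m w E st) (hrun : st.run = true) (hv : st.v < m)
    (hd : st.refresh.dn (st.v :: st.cur) = true)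
    (hb : st.cur.length < bd (Finset.range m) E (st.refresh.F (st.v :: st.cur))) :
    Inv m w E st.refresh.advance := by
  refine (h.refresh hrun hv).advance hrun hv (Or.inr ?_)
  change insert st.v (st.refresh.F st.cur) ⊆ st.refresh.F (st.v :: st.cur) ∧ _ ∧
    bd _ _ (st.refresh.F st.cur) < bd _ _ (st.refresh.F (st.v :: st.cur)) ∧
    Safe _ _ _ (insert st.v (st.refresh.F st.cur)) (st.refresh.F (st.v :: st.cur))
  rw [refresh_F_cur]
  refine ⟨h.safe_refresh.1.1, (h.refresh hrun hv).closed _ hd, ?_, h.safe_refresh⟩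
  rwa [(h.stack hrun).bd_eq]

theorem Inv.descend_refresh (h : Inv m w E st) (hrun : st.run = true) (hv : st.v < m)
    (hl : st.cur.length < w) (hvF : st.v ∉ st.F st.cur)
    (hd : st.refresh.dn (st.v :: st.cur) = false)
    (hb : st.cur.length < bd (Finset.range m) E (st.refresh.F (st.v :: st.cur))) :
    Inv m w E st.refresh.descend :=
  { h.refresh hrun hv with
    letter := by
      intro x hx
      rcases List.mem_cons.1 hx with rfl | hx
      · exact hv
      · exact h.letter x hx
    depth := hl
    v_le := Nat.zero_le _
    stack := by
      intro _
      refine ⟨⟨?_, hd, fun u hu => absurd hu (Nat.not_lt_zero u)⟩, ?_, ?_,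
        (h.refresh hrun hv).stack hrun⟩
      · exact le_antisymm (h.bd_refresh_le hrun) hb
      · change st.v ∉ st.refresh.F st.cur
        rwa [refresh_F_cur]
      · change insert st.v (st.refresh.F st.cur) ⊆ st.refresh.F (st.v :: st.cur)
        rw [refresh_F_cur]; exact h.safe_refresh.1.1 }

/-- Replacing the set of the current node by a safe extension. The current node is kept if the
number of boundary vertices is the same. -/
theorem Inv.grow_aux (h : Inv m w E st) (hrun : st.run = true) {W : Finset ℕ}
    (hW : W ⊆ Finset.range m) (hs : Safe (Finset.range m) E w (st.F st.cur) W) :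
    (bd (Finset.range m) E W = st.cur.length → Inv m w E (st.grow W)) ∧
    (bd (Finset.range m) E W < st.cur.length → Inv m w E (st.grow W).pop) := by
  have hne : ∀ s, s ≠ st.cur → (st.grow W).F s = st.F s := fun s hs => by
    simp [Search.grow, Function.update_of_ne hs]
  have heq : (st.grow W).F st.cur = W := by simp [Search.grow]
  have hsub : ∀ s, (st.grow W).F s ⊆ Finset.range m := by
    intro s
    by_cases hsc : s = st.cur
    · rw [hsc, heq]; exact hW
    · rw [hne s hsc]; exact h.sub s
  have hbr : ∀ s x, (st.grow W).F (x :: s) = ∅ ∨ x ∈ (st.grow W).F (x :: s) ∧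
      ∃ L ⊆ (st.grow W).F (x :: s), MinOver (Finset.range m) E L ((st.grow W).F s) ∧
        Safe (Finset.range m) E w (insert x L) ((st.grow W).F (x :: s)) := by
    intro s x
    by_cases hsc : x :: s = st.cur
    · have hs' : s ≠ st.cur := by
        rintro rfl
        have := congrArg List.length hsc
        simp at this
      rw [hsc, heq, hne s hs']
      right
      rcases h.branch s x with h1 | ⟨h1, L, h2, h3, h4⟩
      · exact absurd (hsc ▸ h1) ((h.stack hrun).nonempty (by rw [← hsc]; simp))
      · rw [hsc] at h1 h2 h4
        exact ⟨hs.1.1 h1, L, h2.trans hs.1.1, h3, h4.trans hs⟩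
    · rw [hne _ hsc]
      refine (h.branch s x).imp_right ?_
      rintro ⟨h1, L, h2, h3, h4⟩
      refine ⟨h1, L, h2, ?_, h4⟩
      by_cases hs' : s = st.cur
      · rw [hs', heq]; rw [hs'] at h3; exact h3.trans hs.1
      · rwa [hne s hs']
  have hfresh : ∀ s x y, (st.grow W).F (y :: s) = ∅ → (st.grow W).F (x :: y :: s) = ∅ := by
    intro s x y hy
    have hy' : st.F (y :: s) = ∅ := by
      by_cases hsc : y :: s = st.cur
      · rw [hsc, heq] at hy
        rw [hsc]
        exact Finset.subset_empty.1 (hy ▸ hs.1.1)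
      · rwa [hne _ hsc] at hy
    have hx' := h.fresh s x y hy'
    have hsc : x :: y :: s ≠ st.cur := by
      intro hsc
      exact (h.stack hrun).nonempty (by rw [← hsc]; simp) (hsc ▸ hx')
    rwa [hne _ hsc]
  have hroot : Reach (Finset.range m) E w ∅ ((st.grow W).F []) := by
    by_cases hsc : [] = st.cur
    · have := h.root
      rw [hsc] at this ⊢
      rw [heq]
      exact this.trans hs.2
    · rw [hne _ hsc]; exact h.root
  have hclosed : ∀ s, st.dn s = true → ClosedSet (Finset.range m) E w ((st.grow W).F s) := by
    intro s hd
    have hsc : s ≠ st.cur := by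
      rintro rfl
      rw [(h.stack hrun).dn_eq] at hd
      simp at hd
    rw [hne s hsc]; exact h.closed s hd
  have hstack := h.stack hrun
  constructor
  · intro hb
    refine ⟨h.letter, h.depth, Nat.zero_le _, hsub, hbr, hfresh, hroot, hclosed, fun _ => ?_,
      fun hr => ?_⟩
    · change Stack m w E (st.grow W).F st.dn st.cur 0
      obtain ⟨F, dn, cur, v, run⟩ := st
      cases cur with
      | nil => exact ⟨by rw [heq]; exact hb, hstack.2.1, by simp⟩
      | cons x t =>
        have h4 := hstack.2.2.1
        refine ⟨⟨by rw [heq]; exact hb, hstack.1.2.1, by simp⟩, ?_, ?_, ?_⟩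
        · rw [hne t (by simp)]; exact hstack.2.1
        · rw [hne t (by simp), heq]; exact h4.trans hs.1.1
        · exact hstack.2.2.2.congr_parent hne fun _ _ => rfl
    · have : st.run = false := hr
      simp [hrun] at this
  · intro hb
    obtain ⟨F, dn, cur, v, run⟩ := st
    cases cur with
    | nil => exact absurd hb (Nat.not_lt_zero _)
    | cons x t =>
      refine ⟨fun y hy => h.letter y (List.mem_cons_of_mem _ hy), ?_,
        (h.letter x (by simp)).le, hsub, hbr, hfresh, hroot, hclosed, fun _ => ?_, fun hr => ?_⟩
      · have := h.depth
        simp only [List.length_cons] at this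
        exact (Nat.le_succ _).trans this
      · exact hstack.2.2.2.congr_parent hne fun _ _ => rfl
      · have : run = false := hr
        simp_all

/-- If the refreshed child has no more boundary vertices than the current set, then the current set
is replaced by a set `W` with fewest boundary vertices between the two. -/
theorem Inv.commit (h : Inv m w E st) (hrun : st.run = true) (hv : st.v < m)
    (hl : st.cur.length < w) {W : Finset ℕ} (hY : st.F st.cur ⊆ W)
    (hB : W ⊆ st.refresh.F (st.v :: st.cur))
    (hmin : ∀ U, st.F st.cur ⊆ U → U ⊆ st.refresh.F (st.v :: st.cur) →
      bd (Finset.range m) E W ≤ bd (Finset.range m) E U) :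
    (bd (Finset.range m) E W = st.cur.length → Inv m w E (st.refresh.grow W)) ∧
    (bd (Finset.range m) E W < st.cur.length → Inv m w E (st.refresh.grow W).pop) := by
  have h' := h.refresh hrun hv
  refine h'.grow_aux hrun (hB.trans (h'.sub _)) ?_
  change Safe _ _ _ (st.refresh.F st.cur) _
  rw [refresh_F_cur]
  refine Safe.of_min (Finset.mem_range.2 hv) ?_ h.safe_refresh hY hB hmin
  have h1 := bd_insert_le (V := Finset.range m) (E := E) (st.F st.cur) st.v
  rw [(h.stack hrun).bd_eq] at h1
  omega

theorem Inv.grow_leaf (h : Inv m w E st) (hrun : st.run = true) (hl : st.cur.length = w)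
    {x : ℕ} (hx : x < m) (hb : bd (Finset.range m) E (insert x (st.F st.cur)) ≤ w) :
    (bd (Finset.range m) E (insert x (st.F st.cur)) = st.cur.length →
      Inv m w E (st.grow (insert x (st.F st.cur)))) ∧
    (bd (Finset.range m) E (insert x (st.F st.cur)) < st.cur.length →
      Inv m w E (st.grow (insert x (st.F st.cur))).pop) :=
  h.grow_aux hrun (Finset.insert_subset (Finset.mem_range.2 hx) (h.sub _))
    (.single (Finset.mem_range.2 hx) hb (by rw [(h.stack hrun).bd_eq]; omega))

theorem Inv.close_pop (h : Inv m w E st) (hrun : st.run = true)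
    (hc : ClosedSet (Finset.range m) E w (st.F st.cur)) : Inv m w E st.close.pop := by
  have hclosed : ∀ s, st.close.dn s = true → ClosedSet (Finset.range m) E w (st.F s) := by
    intro s hd
    by_cases hsc : s = st.cur
    · rw [hsc]; exact hc
    · simp only [close, Function.update_of_ne hsc] at hd
      exact h.closed s hd
  have hstack := h.stack hrun
  obtain ⟨F, dn, cur, v, run⟩ := st
  cases cur with
  | nil =>
    exact ⟨h.letter, h.depth, h.v_le, h.sub, h.branch, h.fresh, h.root, hclosed,
      fun hr => by simp [pop, close] at hr, fun _ => ⟨hc, hstack.1⟩⟩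
  | cons x t =>
    refine ⟨fun y hy => h.letter y (List.mem_cons_of_mem _ hy), ?_,
      (h.letter x (by simp)).le, h.sub, h.branch, h.fresh, h.root, hclosed, fun _ => ?_,
      fun hr => ?_⟩
    · have := h.depth
      simp only [List.length_cons] at this
      exact (Nat.le_succ _).trans this
    · refine hstack.2.2.2.congr_parent (fun _ _ => rfl) fun s hs => ?_
      exact Function.update_of_ne hs _ _
    · have : run = false := hr
      simp_all

/-- An inner node may be closed when all of its branches have been dealt with. -/
theorem Inv.close_inner (h : Inv m w E st) (hrun : st.run = true) (hv : st.v = m) :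
    Inv m w E st.close.pop := by
  refine h.close_pop hrun (.of_branches fun u hu huF => ?_)
  rw [Finset.mem_range] at hu
  rcases (h.stack hrun).branch u (by omega) with h1 | ⟨-, h2, h3, h4⟩
  · exact absurd h1 huF
  · exact ⟨_, h4, h2, h3⟩

theorem Inv.close_leaf (h : Inv m w E st) (hrun : st.run = true)
    (hno : ∀ x < m, x ∉ st.F st.cur → w < bd (Finset.range m) E (insert x (st.F st.cur))) :
    Inv m w E st.close.pop :=
  h.close_pop hrun (.of_no_step fun u hu huF => hno u (Finset.mem_range.1 hu) huF)

/-- When the search ends, the set of the root consists of all vertices if and only if these can be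
laid out. -/
theorem Inv.final_iff (h : Inv m w E st) (hrun : st.run = false) :
    st.F [] = Finset.range m ↔ Reach (Finset.range m) E w ∅ (Finset.range m) := by
  constructor
  · intro h1
    have := h.root
    rwa [h1] at this
  · intro h1
    exact ((h.final hrun).1.eq_univ (h.final hrun).2 h1).resolve_right (not_not.2 (h.sub _))

theorem Inv.length_lt (h : Inv m w E st) (hrun : st.run = true) (hm : 0 < m) :
    st.cur.length < m := by
  rw [← (h.stack hrun).bd_eq]
  have := bd_lt_card (V := Finset.range m) (E := E) ⟨0, Finset.mem_range.2 hm⟩ (h.sub st.cur)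
  rwa [Finset.card_range] at this

end Search

/-! ### The number of steps of the search -/

namespace Search

/-- The nodes at depth `j`. -/
def level (m : ℕ) : ℕ → Finset (List ℕ)
  | 0 => {[]}
  | j + 1 => (Finset.range m ×ˢ level m j).image fun p => p.1 :: p.2

theorem mem_level {m j : ℕ} {s : List ℕ} : s ∈ level m j ↔ s.length = j ∧ ∀ x ∈ s, x < m := by
  induction j generalizing s with
  | zero =>
    simp only [level, Finset.mem_singleton, List.length_eq_zero_iff]
    constructor
    · rintro rfl; simp
    · exact fun h => h.1
  | succ j ih =>
    simp only [level, Finset.mem_image, Finset.mem_product, Finset.mem_range, Prod.exists, ih]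
    constructor
    · rintro ⟨x, t, ⟨h1, h2, h3⟩, rfl⟩
      simpa using ⟨h2, h1, h3⟩
    · rintro ⟨h1, h2⟩
      cases s with
      | nil => simp at h1
      | cons x t =>
        simp only [List.length_cons, Nat.add_right_cancel_iff] at h1
        exact ⟨x, t, ⟨h2 x (by simp), h1, fun y hy => h2 y (List.mem_cons_of_mem _ hy)⟩, rfl⟩

theorem card_level_le (m j : ℕ) : (level m j).card ≤ m ^ j := by
  induction j with
  | zero => simp [level]
  | succ j ih =>
    refine Finset.card_image_le.trans ?_
    rw [Finset.card_product, Finset.card_range, pow_succ']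
    exact Nat.mul_le_mul_left _ ih

/-- The nodes that the search can visit; their depth is at most `w` and at most `m`. -/
def nodes (m w : ℕ) : Finset (List ℕ) := (Finset.range (min w m + 1)).biUnion (level m)

theorem mem_nodes {m w : ℕ} {s : List ℕ} :
    s ∈ nodes m w ↔ s.length ≤ min w m ∧ ∀ x ∈ s, x < m := by
  simp only [nodes, Finset.mem_biUnion, Finset.mem_range, mem_level]
  constructor
  · rintro ⟨j, h1, h2, h3⟩; exact ⟨by omega, h3⟩
  · rintro ⟨h1, h2⟩; exact ⟨_, by omega, rfl, h2⟩

section Potential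

variable (m w K L : ℕ)

/-- The budget of a node at depth `j` for one growth of its set; `K` pays for a cheap step and `L`
for an expensive one. -/
def growCost (j : ℕ) : ℕ := if j < w then L + K * (m + 2) else 2 * K

/-- The budget of a node at depth `j` for being closed. -/
def closeCost (j : ℕ) : ℕ := if j < w then K * (m + 2) else 2 * K

/-- The remaining budget of a node. -/
def weight (s : List ℕ) (X : Finset ℕ) (d : Bool) : ℕ :=
  growCost m w K L s.length * (m - X.card) + closeCost m w K s.length * (if d then 0 else 1)

/-- The number of moves that the search can still make without changing any set: it decreases when
the search advances or descends. -/
def path (s : List ℕ) (v : ℕ) : ℕ :=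
  (m - v) + (s.map fun x => m - x).sum + (min w m - s.length) * (m + 1)

/-- The number of moves left, where the nodes at depth `w` have no children. -/
def rank (s : List ℕ) (v : ℕ) : ℕ :=
  if s.length < w then path m w s v + 1 else
    match s with
    | [] => 0
    | x :: t => path m w t x

/-- The potential of a state, which bounds the remaining running time of the search. -/
def potential (st : Search) : ℕ :=
  ∑ s ∈ nodes m w, weight m w K L s (st.F s) (st.dn s) + K * rank m w st.cur st.v

variable {m w K L} {E : ℕ → ℕ → Prop} {st : Search}

theorem sum_weight_update {F F' : List ℕ → Finset ℕ} {dn dn' : List ℕ → Bool} {s : List ℕ}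
    (hs : s ∈ nodes m w) (hF : ∀ t, t ≠ s → F' t = F t) (hdn : ∀ t, t ≠ s → dn' t = dn t) :
    ∑ t ∈ nodes m w, weight m w K L t (F' t) (dn' t) + weight m w K L s (F s) (dn s) =
      ∑ t ∈ nodes m w, weight m w K L t (F t) (dn t) + weight m w K L s (F' s) (dn' s) := by
  rw [← Finset.add_sum_erase _ _ hs, ← Finset.add_sum_erase _ (fun t => weight m w K L t (F t) _) hs]
  have : ∑ t ∈ (nodes m w).erase s, weight m w K L t (F' t) (dn' t) =
      ∑ t ∈ (nodes m w).erase s, weight m w K L t (F t) (dn t) :=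
    Finset.sum_congr rfl fun t ht => by
      rw [hF t (Finset.ne_of_mem_erase ht), hdn t (Finset.ne_of_mem_erase ht)]
  rw [this]
  ring

theorem Inv.cur_mem (h : Inv m w E st) (hrun : st.run = true) (hm : 0 < m) :
    st.cur ∈ nodes m w :=
  mem_nodes.2 ⟨le_min h.depth (h.length_lt hrun hm).le, h.letter⟩

theorem closeCost_le (j : ℕ) : closeCost m w K j ≤ growCost m w K L j := by
  unfold closeCost growCost
  split_ifs <;> omega

theorem card_lt_of_ssubset {X Y : Finset ℕ} (h : X ⊂ Y) (hY : Y ⊆ Finset.range m) :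
    m - Y.card + 1 ≤ m - X.card := by
  have h1 := Finset.card_lt_card h
  have h2 := Finset.card_le_card hY
  rw [Finset.card_range] at h2
  omega

theorem weight_grow {s : List ℕ} {X Y : Finset ℕ} {d : Bool} (h : X ⊂ Y)
    (hY : Y ⊆ Finset.range m) :
    weight m w K L s Y d + growCost m w K L s.length ≤ weight m w K L s X d := by
  have h1 := Nat.mul_le_mul_left (growCost m w K L s.length) (card_lt_of_ssubset h hY)
  unfold weight
  rw [mul_add, mul_one] at h1
  omega

/-- A refreshed child whose set has grown loses its mark; the growth pays for a new one. -/
theorem Inv.potential_refresh (h : Inv m w E st) (hrun : st.run = true) (hm : 0 < m)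
    (hv : st.v < m) (hl : st.cur.length < w) :
    potential m w K L st.refresh ≤ potential m w K L st := by
  have hc : st.v :: st.cur ∈ nodes m w := by
    refine mem_nodes.2 ⟨?_, ?_⟩
    · have := h.length_lt hrun hm
      simp only [List.length_cons, le_min_iff]
      omega
    · intro x hx
      rcases List.mem_cons.1 hx with rfl | hx
      · exact hv
      · exact h.letter x hx
  have h1 := sum_weight_update (K := K) (L := L) hc (fun t ht => refresh_F_of_ne (st := st) ht)
    (fun t ht => refresh_dn_of_ne (st := st) ht)
  have hsub := (h.refresh hrun hv).sub (st.v :: st.cur)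
  have h2 : weight m w K L (st.v :: st.cur) (st.refresh.F (st.v :: st.cur))
      (st.refresh.dn (st.v :: st.cur)) ≤
      weight m w K L (st.v :: st.cur) (st.F (st.v :: st.cur)) (st.dn (st.v :: st.cur)) := by
    by_cases hX : st.refresh.F (st.v :: st.cur) = st.F (st.v :: st.cur)
    · have hd : st.refresh.dn (st.v :: st.cur) = st.dn (st.v :: st.cur) := by
        simp only [Search.refresh, Function.update_self] at hX ⊢
        simp [hX]
      rw [hX, hd]
    · have hss : st.F (st.v :: st.cur) ⊂ st.refresh.F (st.v :: st.cur) := by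
        refine Finset.ssubset_iff_subset_ne.2 ⟨?_, Ne.symm hX⟩
        simp only [Search.refresh, Function.update_self]
        exact Finset.subset_union_left
      have hd : st.refresh.dn (st.v :: st.cur) = false := by
        simp only [Search.refresh, Function.update_self] at hX ⊢
        rw [decide_eq_false hX, Bool.and_false]
      have h3 := weight_grow (w := w) (K := K) (L := L) (s := st.v :: st.cur)
        (d := st.dn (st.v :: st.cur)) hss hsub
      have h4 := closeCost_le (m := m) (w := w) (K := K) (L := L) (st.v :: st.cur).length
      rw [hd]
      unfold weight at h3 ⊢
      simp only [Bool.false_eq_true, if_false, mul_one]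
      omega
  unfold potential
  change _ + K * rank m w st.cur st.v ≤ _
  omega

theorem potential_advance (hv : st.v < m) (hl : st.cur.length < w) :
    potential m w K L st.advance + K ≤ potential m w K L st := by
  have h1 : rank m w st.cur (st.v + 1) + 1 ≤ rank m w st.cur st.v := by
    simp only [rank, if_pos hl, path]
    omega
  have h2 := Nat.mul_le_mul_left K h1
  rw [mul_add, mul_one] at h2
  unfold potential
  change _ + K * rank m w st.cur (st.v + 1) + K ≤ _
  simp only [advance]
  omega

theorem path_cons {x : ℕ} {t : List ℕ} (ht : t.length < min w m) :
    path m w (x :: t) 0 + 1 = path m w t x := by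
  obtain ⟨c, hc⟩ := Nat.exists_eq_add_of_lt ht
  have h1 : min w m - t.length = c + 1 := by omega
  have h2 : min w m - (t.length + 1) = c := by omega
  simp only [path, List.map_cons, List.sum_cons, List.length_cons, h1, h2]
  ring_nf
  omega

theorem rank_descend {v : ℕ} {s : List ℕ} (hl : s.length < w) (hm : s.length < m) :
    rank m w (v :: s) 0 + 1 ≤ rank m w s v := by
  have h1 := path_cons (w := w) (m := m) (x := v) (t := s) (lt_min hl hm)
  simp only [rank, if_pos hl, List.length_cons]
  split_ifs <;> omega

theorem potential_descend (hl : st.cur.length < w) (hm : st.cur.length < m) :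
    potential m w K L st.descend + K ≤ potential m w K L st := by
  have h2 := Nat.mul_le_mul_left K (rank_descend (v := st.v) hl hm)
  rw [mul_add, mul_one] at h2
  unfold potential
  change _ + K * rank m w (st.v :: st.cur) 0 + K ≤ _
  simp only [descend]
  omega

theorem pop_F (st : Search) : st.pop.F = st.F := by
  unfold pop; split <;> rfl

theorem pop_dn (st : Search) : st.pop.dn = st.dn := by
  unfold pop; split <;> rfl

theorem rank_pop (hv : st.v ≤ m) (hs : st.cur.length ≤ min w m) :
    rank m w st.pop.cur st.pop.v ≤
      rank m w st.cur st.v + (if st.cur.length < w then m + 1 else 1) := by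
  obtain ⟨F, dn, cur, v, run⟩ := st
  cases cur with
  | nil => simp [pop]
  | cons x t =>
    simp only [List.length_cons, pop] at hs hv ⊢
    have h1 : t.length < min w m := by omega
    have h2 := path_cons (x := x) h1
    have h3 : t.length < w := by omega
    have h4 : path m w (x :: t) 0 = path m w (x :: t) v + v := by
      simp only [path]; omega
    simp only [rank, if_pos h3, List.length_cons]
    split_ifs <;> omega

theorem rank_zero_le {s : List ℕ} {v : ℕ} (hv : v ≤ m) :
    rank m w s 0 ≤ rank m w s v + (if s.length < w then m else 0) := by
  cases s <;> simp only [rank, path] <;> split_ifs <;> omega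

/-- The growth of the set of the current node pays for its own running time and for the moves that
have to be repeated, whether or not the search leaves the node. -/
theorem Inv.potential_grow (h : Inv m w E st) (hrun : st.run = true) (hm : 0 < m) {W : Finset ℕ}
    (hW : W ⊆ Finset.range m) (hs : st.F st.cur ⊂ W) :
    potential m w K L (st.grow W) + (if st.cur.length < w then L else K) ≤
        potential m w K L st ∧
      potential m w K L (st.grow W).pop + (if st.cur.length < w then L else K) ≤
        potential m w K L st := by
  have hc := h.cur_mem hrun hm
  have h1 := sum_weight_update (K := K) (L := L) (F := st.F) (F' := (st.grow W).F) (dn := st.dn)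
    (dn' := st.dn) hc
    (fun t ht => by simp [grow, Function.update_of_ne ht]) (fun _ _ => rfl)
  have h2 := weight_grow (w := w) (K := K) (L := L) (s := st.cur) (d := st.dn st.cur) hs hW
  have h3 : (st.grow W).F st.cur = W := by simp [grow]
  rw [h3] at h1
  have h4 := rank_zero_le (w := w) (s := st.cur) h.v_le
  have h5 := rank_pop (w := w) (m := m) (st := st.grow W) (Nat.zero_le _) (mem_nodes.1 hc).1
  have e1 : (st.grow W).cur = st.cur := rfl
  have e2 : (st.grow W).v = 0 := rfl
  rw [e1, e2] at h5
  unfold potential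
  rw [pop_F, pop_dn, e1, e2]
  have e3 : (st.grow W).dn = st.dn := rfl
  rw [e3]
  have h6 : growCost m w K L st.cur.length =
      (if st.cur.length < w then L else K) + K * (if st.cur.length < w then m + 2 else 1) := by
    unfold growCost; split_ifs <;> omega
  have h7 : rank m w st.cur 0 ≤
      rank m w st.cur st.v + (if st.cur.length < w then m + 2 else 1) := by
    split_ifs at h4 ⊢ <;> omega
  have h8 : rank m w (st.grow W).pop.cur (st.grow W).pop.v ≤
      rank m w st.cur st.v + (if st.cur.length < w then m + 2 else 1) := by
    split_ifs at h4 h5 ⊢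
    · -- a return to the parent undoes a descent, so that both changes add up to `m + 1` moves
      rename_i hl
      obtain ⟨F, dn, cur, v, run⟩ := st
      cases cur with
      | nil =>
        have h9 : rank m w [] 0 ≤ rank m w [] v + m := h4
        simp only [pop, grow]
        omega
      | cons x t =>
        simp only [grow, pop] at h5 ⊢
        have ht : t.length < min w m := (mem_nodes.1 hc).1
        have h9 := path_cons (x := x) ht
        have h10 : t.length < w := by omega
        have hv : v ≤ m := h.v_le
        have h11 : path m w (x :: t) 0 = path m w (x :: t) v + v := by
          simp only [path]; omega
        simp only [rank, if_pos h10, if_pos hl]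
        omega
    · omega
  have h9 := Nat.mul_le_mul_left K h7
  have h10 := Nat.mul_le_mul_left K h8
  rw [mul_add] at h9 h10
  omega

theorem Inv.potential_close (h : Inv m w E st) (hrun : st.run = true) (hm : 0 < m) :
    potential m w K L st.close.pop + K ≤ potential m w K L st := by
  have hc := h.cur_mem hrun hm
  have h1 := sum_weight_update (K := K) (L := L) (F := st.F) (F' := st.F) (dn := st.dn)
    (dn' := st.close.dn) hc (fun _ _ => rfl)
    (fun t ht => by simp [close, Function.update_of_ne ht])
  have h3 : st.close.dn st.cur = true := by simp [close]
  rw [h3] at h1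
  have h2 : weight m w K L st.cur (st.F st.cur) (st.dn st.cur) =
      weight m w K L st.cur (st.F st.cur) true + closeCost m w K st.cur.length := by
    rw [(h.stack hrun).dn_eq]
    simp [weight]
  have h5 := rank_pop (w := w) (m := m) (st := st.close) h.v_le (mem_nodes.1 hc).1
  have e1 : st.close.cur = st.cur := rfl
  have e2 : st.close.v = st.v := rfl
  rw [e1, e2] at h5
  unfold potential
  rw [pop_F, pop_dn]
  have e3 : st.close.F = st.F := rfl
  rw [e3]
  have h6 : closeCost m w K st.cur.length =
      K + K * (if st.cur.length < w then m + 1 else 1) := by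
    unfold closeCost; split_ifs <;> ring
  have h9 := Nat.mul_le_mul_left K h5
  rw [mul_add] at h9
  omega

theorem sum_pow_le {m n : ℕ} (h : 2 ≤ m ∨ m = 1 ∧ n ≤ 2) :
    ∑ j ∈ Finset.range n, m ^ (j + 1) ≤ 2 * m ^ n := by
  rcases h with h | ⟨rfl, h⟩
  · induction n with
    | zero => simp
    | succ n ih =>
      rw [Finset.sum_range_succ]
      have : 2 * m ^ n ≤ m ^ (n + 1) := by
        rw [pow_succ']; exact Nat.mul_le_mul_right _ h
      omega
  · simpa using h

/-- Level `j` has at most `m ^ j` nodes. The weight of an inner node is of the order `m ^ 4`, that of a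
leaf at depth `w` only of the order `m ^ 3`, so that both kinds contribute `O(m ^ (w + 3))`. -/
theorem potential_start_le (hm : 0 < m) {a b : ℕ} :
    potential m w (a * m ^ 2) (b * m ^ 3) start ≤ (20 * a + 4 * b) * m ^ (w + 3) := by
  have hm1 : 1 ≤ m := hm
  have hpow : ∀ i j : ℕ, i ≤ j → m ^ i ≤ m ^ j := fun i j => Nat.pow_le_pow_right hm
  set A := 6 * a + 2 * b with hA
  -- the weight of an inner node and of a leaf
  have hinner : ∀ s : List ℕ, s.length < w →
      weight m w (a * m ^ 2) (b * m ^ 3) s ∅ false ≤ A * m ^ 4 := by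
    intro s hs
    simp only [weight, growCost, closeCost, if_pos hs, Finset.card_empty, Nat.sub_zero,
      Bool.false_eq_true, if_false, mul_one]
    have h1 : a * m ^ 2 * (m + 2) ≤ a * m ^ 2 * (3 * m) := Nat.mul_le_mul_left _ (by omega)
    have h2 : a * m ^ 2 * (3 * m) = 3 * a * m ^ 3 := by ring
    have h3 : (b * m ^ 3 + a * m ^ 2 * (m + 2)) * m ≤ (b * m ^ 3 + 3 * a * m ^ 3) * m :=
      Nat.mul_le_mul_right _ (by omega)
    have h4 : (b * m ^ 3 + 3 * a * m ^ 3) * m = (b + 3 * a) * m ^ 4 := by ring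
    have h5 : 3 * a * m ^ 3 ≤ 3 * a * m ^ 4 := Nat.mul_le_mul_left _ (hpow 3 4 (by omega))
    have h6 : A * m ^ 4 = (b + 3 * a) * m ^ 4 + 3 * a * m ^ 4 + b * m ^ 4 := by rw [hA]; ring
    omega
  have hleaf : ∀ s : List ℕ, s.length = w →
      weight m w (a * m ^ 2) (b * m ^ 3) s ∅ false ≤ 4 * a * m ^ 3 := by
    intro s hs
    have hs' : ¬ s.length < w := by omega
    simp only [weight, growCost, closeCost, if_neg hs', Finset.card_empty, Nat.sub_zero,
      Bool.false_eq_true, if_false, mul_one]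
    have h1 : 2 * (a * m ^ 2) ≤ 2 * a * m ^ 3 := by
      rw [← mul_assoc]; exact Nat.mul_le_mul_left _ (hpow 2 3 (by omega))
    have h2 : 2 * (a * m ^ 2) * m = 2 * a * m ^ 3 := by ring
    have h3 : 4 * a * m ^ 3 = 2 * a * m ^ 3 + 2 * a * m ^ 3 := by ring
    omega
  have hlevel : ∀ j ∈ Finset.range (min w m + 1),
      ∑ s ∈ level m j, weight m w (a * m ^ 2) (b * m ^ 3) s ∅ false ≤
        (if j < w then m ^ (j + 1) * (A * m ^ 3) else 0) +
          if j = w then 4 * a * m ^ (w + 3) else 0 := by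
    intro j hj
    rw [Finset.mem_range] at hj
    rcases Nat.lt_or_ge j w with h | h
    · rw [if_pos h, if_neg (by omega)]
      refine (Finset.sum_le_card_nsmul _ _ (A * m ^ 4) fun s hs =>
        hinner s (by rw [(mem_level.1 hs).1]; exact h)).trans ?_
      rw [smul_eq_mul]
      refine (Nat.mul_le_mul_right _ (card_level_le m j)).trans (le_of_eq ?_)
      ring
    · have hjw : j = w := by omega
      rw [if_neg (by omega), if_pos hjw]
      refine (Finset.sum_le_card_nsmul _ _ (4 * a * m ^ 3) fun s hs =>
        hleaf s (by rw [(mem_level.1 hs).1]; exact hjw)).trans ?_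
      rw [smul_eq_mul]
      refine (Nat.mul_le_mul_right _ (card_level_le m j)).trans (le_of_eq ?_)
      rw [hjw]; ring
  have hsum : ∑ s ∈ nodes m w, weight m w (a * m ^ 2) (b * m ^ 3) s ∅ false ≤
      2 * A * m ^ (w + 3) + 4 * a * m ^ (w + 3) := by
    have h0 : ∑ s ∈ nodes m w, weight m w (a * m ^ 2) (b * m ^ 3) s ∅ false =
        ∑ j ∈ Finset.range (min w m + 1), ∑ s ∈ level m j,
          weight m w (a * m ^ 2) (b * m ^ 3) s ∅ false := by
      unfold nodes
      refine Finset.sum_biUnion ?_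
      intro i _ j _ hij
      rw [Function.onFun, Finset.disjoint_left]
      intro s h1 h2
      exact hij ((mem_level.1 h1).1.symm.trans (mem_level.1 h2).1)
    rw [h0]
    refine (Finset.sum_le_sum hlevel).trans ?_
    rw [Finset.sum_add_distrib]
    refine add_le_add ?_ ?_
    · rw [← Finset.sum_filter, ← Finset.sum_mul]
      have h1 : (Finset.range (min w m + 1)).filter (fun j => j < w) =
          Finset.range (min w (m + 1)) := by
        ext j; simp only [Finset.mem_filter, Finset.mem_range]; omega
      rw [h1]
      have h2 : ∑ j ∈ Finset.range (min w (m + 1)), m ^ (j + 1) ≤ 2 * m ^ w :=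
        (sum_pow_le (by omega)).trans
          (Nat.mul_le_mul_left _ (hpow _ _ (by omega)))
      refine (Nat.mul_le_mul_right _ h2).trans (le_of_eq ?_)
      ring
    · rw [Finset.sum_ite_eq']
      split_ifs <;> simp
  have hrank : a * m ^ 2 * rank m w [] 0 ≤ 4 * a * m ^ (w + 3) := by
    simp only [rank, path, List.length_nil, List.map_nil, List.sum_nil, Nat.sub_zero, add_zero]
    split_ifs with hw
    · have h1 : min w m * (m + 1) ≤ m * (m + 1) := Nat.mul_le_mul_right _ (by omega)
      have h2 : m + min w m * (m + 1) + 1 ≤ 4 * m ^ 2 := by nlinarith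
      refine (Nat.mul_le_mul_left _ h2).trans ?_
      have h3 : a * m ^ 2 * (4 * m ^ 2) = 4 * a * m ^ 4 := by ring
      rw [h3]
      exact Nat.mul_le_mul_left _ (hpow _ _ (by omega))
    · simp
  have h1 : (20 * a + 4 * b) * m ^ (w + 3) =
      2 * A * m ^ (w + 3) + 4 * a * m ^ (w + 3) + 4 * a * m ^ (w + 3) := by rw [hA]; ring
  rw [h1]
  exact add_le_add hsum hrank

end Potential

end Search

/-! ### Reasoning about programs -/

@[simp] theorem Store.setReg_reg (s : Store) (x v y : ℕ) :
    (s.setReg x v).reg y = if y = x then v else s.reg y := by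
  simp [Store.setReg, Function.update_apply]

@[simp] theorem Store.setReg_arr (s : Store) (x v : ℕ) : (s.setReg x v).arr = s.arr := rfl

@[simp] theorem Store.setArr_reg (s : Store) (a i v : ℕ) : (s.setArr a i v).reg = s.reg := rfl

@[simp] theorem Store.setArr_arr (s : Store) (a i v b : ℕ) :
    (s.setArr a i v).arr b = if b = a then Function.update (s.arr a) i v else s.arr b := by
  simp only [Store.setArr, Function.update_apply]

@[simp] theorem Test.holds_lt {s : Store} {x y : ℕ} :
    (Test.lt x y).Holds s ↔ s.reg x < s.reg y := Iff.rfl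

@[simp] theorem Test.holds_eq {s : Store} {x y : ℕ} :
    (Test.eq x y).Holds s ↔ s.reg x = s.reg y := Iff.rfl

infixr:60 " ;; " => Prog.seq

/-- `P`, started in `s`, halts, and its running time and final store satisfy `Q`. -/
def Runs (P : Prog) (s : Store) (Q : ℕ → Store → Prop) : Prop := ∃ t s', Exec P s t s' ∧ Q t s'

namespace Prog

/-- The registers that the program can write. -/
def wr : Prog → ℕ → Bool
  | .skip, _ => false
  | .const x _, r => Nat.beq x r
  | .copy x _, r => Nat.beq x r
  | .add x _ _, r => Nat.beq x r
  | .sub x _ _, r => Nat.beq x r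
  | .load x _ _, r => Nat.beq x r
  | .store _ _ _, _ => false
  | .seq P R, r => P.wr r || R.wr r
  | .cond _ P R, r => P.wr r || R.wr r
  | .loop _ P, r => P.wr r

/-- The arrays that the program can write. -/
def wa : Prog → ℕ → Bool
  | .store a _ _, b => Nat.beq a b
  | .seq P R, b => P.wa b || R.wa b
  | .cond _ P R, b => P.wa b || R.wa b
  | .loop _ P, b => P.wa b
  | _, _ => false

end Prog

/-- The stores agree on all registers and arrays that the program cannot write. -/
structure Same (P : Prog) (s s' : Store) : Prop where
  reg : ∀ r, P.wr r = false → s'.reg r = s.reg r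
  arr : ∀ a, P.wa a = false → s'.arr a = s.arr a

theorem Same.refl (P : Prog) (s : Store) : Same P s s := ⟨fun _ _ => rfl, fun _ _ => rfl⟩

theorem Same.trans {P : Prog} {s s' s'' : Store} (h : Same P s s') (h' : Same P s' s'') :
    Same P s s'' :=
  ⟨fun r hr => (h'.reg r hr).trans (h.reg r hr), fun a ha => (h'.arr a ha).trans (h.arr a ha)⟩

theorem same_setReg {P : Prog} {s : Store} {x v : ℕ} (h : ∀ r, P.wr r = false → r ≠ x) :
    Same P s (s.setReg x v) :=
  ⟨fun r hr => by rw [Store.setReg_reg, if_neg (h r hr)], fun _ _ => rfl⟩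

theorem ne_of_beq_eq_false {x r : ℕ} (h : Nat.beq x r = false) : r ≠ x := by
  rintro rfl
  simp at h

theorem Exec.same {P : Prog} {s s' : Store} {t : ℕ} (h : Exec P s t s') : Same P s s' := by
  induction h with
  | skip => exact .refl _ _
  | const | copy | add | sub | load => exact same_setReg fun _ hr => ne_of_beq_eq_false hr
  | store s a y x =>
    refine ⟨fun _ _ => rfl, fun b hb => ?_⟩
    rw [Store.setArr_arr, if_neg (ne_of_beq_eq_false hb)]
  | seq _ _ ih ih' =>
    refine ⟨fun r hr => ?_, fun a ha => ?_⟩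
    · simp only [Prog.wr, Bool.or_eq_false_iff] at hr
      rw [ih'.reg r hr.2, ih.reg r hr.1]
    · simp only [Prog.wa, Bool.or_eq_false_iff] at ha
      rw [ih'.arr a ha.2, ih.arr a ha.1]
  | cond_true _ _ ih =>
    refine ⟨fun r hr => ?_, fun a ha => ?_⟩
    · simp only [Prog.wr, Bool.or_eq_false_iff] at hr
      exact ih.reg r hr.1
    · simp only [Prog.wa, Bool.or_eq_false_iff] at ha
      exact ih.arr a ha.1
  | cond_false _ _ ih =>
    refine ⟨fun r hr => ?_, fun a ha => ?_⟩
    · simp only [Prog.wr, Bool.or_eq_false_iff] at hr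
      exact ih.reg r hr.2
    · simp only [Prog.wa, Bool.or_eq_false_iff] at ha
      exact ih.arr a ha.2
  | loop_done => exact .refl _ _
  | loop_step _ _ _ ih ih' =>
    exact Same.trans ⟨fun r hr => ih.reg r hr, fun a ha => ih.arr a ha⟩ ih'

namespace Runs

variable {P R : Prog} {s : Store} {Q Q' : ℕ → Store → Prop}

/-- The rule of consequence; what the program cannot write is unchanged. -/
theorem mono (h : Runs P s Q) (hQ : ∀ t s', Q t s' → Same P s s' → Q' t s') : Runs P s Q' := by
  obtain ⟨t, s', h1, h2⟩ := h
  exact ⟨t, s', h1, hQ t s' h2 h1.same⟩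

@[simp] theorem skip_iff : Runs .skip s Q ↔ Q 1 s :=
  ⟨fun ⟨_, _, h, hq⟩ => by cases h; exact hq, fun h => ⟨_, _, .skip s, h⟩⟩

@[simp] theorem const_iff {x c : ℕ} : Runs (.const x c) s Q ↔ Q 1 (s.setReg x c) :=
  ⟨fun ⟨_, _, h, hq⟩ => by cases h; exact hq, fun h => ⟨_, _, .const s x c, h⟩⟩

@[simp] theorem copy_iff {x y : ℕ} : Runs (.copy x y) s Q ↔ Q 1 (s.setReg x (s.reg y)) :=
  ⟨fun ⟨_, _, h, hq⟩ => by cases h; exact hq, fun h => ⟨_, _, .copy s x y, h⟩⟩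

@[simp] theorem add_iff {x y z : ℕ} : Runs (.add x y z) s Q ↔ Q 1 (s.setReg x (s.reg y + s.reg z)) :=
  ⟨fun ⟨_, _, h, hq⟩ => by cases h; exact hq, fun h => ⟨_, _, .add s x y z, h⟩⟩

@[simp] theorem sub_iff {x y z : ℕ} : Runs (.sub x y z) s Q ↔ Q 1 (s.setReg x (s.reg y - s.reg z)) :=
  ⟨fun ⟨_, _, h, hq⟩ => by cases h; exact hq, fun h => ⟨_, _, .sub s x y z, h⟩⟩

@[simp] theorem load_iff {x a y : ℕ} :
    Runs (.load x a y) s Q ↔ Q 1 (s.setReg x (s.arr a (s.reg y))) :=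
  ⟨fun ⟨_, _, h, hq⟩ => by cases h; exact hq, fun h => ⟨_, _, .load s x a y, h⟩⟩

@[simp] theorem store_iff {a y x : ℕ} :
    Runs (.store a y x) s Q ↔ Q 1 (s.setArr a (s.reg y) (s.reg x)) :=
  ⟨fun ⟨_, _, h, hq⟩ => by cases h; exact hq, fun h => ⟨_, _, .store s a y x, h⟩⟩

@[simp] theorem seq_iff :
    Runs (P ;; R) s Q ↔ Runs P s fun t s' => Runs R s' fun t' s'' => Q (t + t') s'' := by
  constructor
  · rintro ⟨_, _, h, hq⟩
    cases h with
    | seq h1 h2 => exact ⟨_, _, h1, _, _, h2, hq⟩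
  · rintro ⟨_, _, h1, _, _, h2, hq⟩
    exact ⟨_, _, .seq h1 h2, hq⟩

@[simp] theorem cond_iff {b : Test} :
    Runs (.cond b P R) s Q ↔ (b.Holds s → Runs P s fun t => Q (t + 1)) ∧
      (¬ b.Holds s → Runs R s fun t => Q (t + 1)) := by
  constructor
  · rintro ⟨_, _, h, hq⟩
    cases h with
    | cond_true hb h => exact ⟨fun _ => ⟨_, _, h, hq⟩, fun h' => absurd hb h'⟩
    | cond_false hb h => exact ⟨fun h' => absurd h' hb, fun _ => ⟨_, _, h, hq⟩⟩
  · rintro ⟨h1, h2⟩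
    by_cases hb : b.Holds s
    · obtain ⟨_, _, h, hq⟩ := h1 hb
      exact ⟨_, _, .cond_true hb h, hq⟩
    · obtain ⟨_, _, h, hq⟩ := h2 hb
      exact ⟨_, _, .cond_false hb h, hq⟩

theorem seq (h : Runs P s Q') (hR : ∀ t s', Q' t s' → Same P s s' →
    Runs R s' fun t' s'' => Q (t + t') s'') : Runs (P ;; R) s Q :=
  seq_iff.2 (h.mono hR)

/-- The rule for loops: the invariant `I τ` includes a budget `τ` for the remaining running
time. -/
theorem loop {b : Test} {I : ℕ → Store → Prop} {τ : ℕ} (h0 : I τ s)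
    (hstep : ∀ τ s1, I τ s1 → Same P s s1 → b.Holds s1 →
      Runs P s1 fun t s2 => ∃ τ', I τ' s2 ∧ t + τ' + 1 ≤ τ) :
    Runs (.loop b P) s fun t s' => ¬ b.Holds s' ∧ ∃ τ', I τ' s' ∧ t + τ' ≤ τ + 1 := by
  suffices H : ∀ n τ s1, τ ≤ n → I τ s1 → Same P s s1 →
      Runs (.loop b P) s1 fun t s' => ¬ b.Holds s' ∧ ∃ τ', I τ' s' ∧ t + τ' ≤ τ + 1 from
    H τ τ s le_rfl h0 (.refl _ _)
  intro n
  induction n with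
  | zero =>
    intro τ s1 hτ hI hs
    by_cases hb : b.Holds s1
    · obtain ⟨t, s2, -, τ', -, h⟩ := hstep τ s1 hI hs hb
      omega
    · exact ⟨1, s1, .loop_done hb, hb, τ, hI, by omega⟩
  | succ n ih =>
    intro τ s1 hτ hI hs
    by_cases hb : b.Holds s1
    · obtain ⟨t, s2, h1, τ', h2, h3⟩ := hstep τ s1 hI hs hb
      obtain ⟨t', s3, h4, h5, τ'', h6, h7⟩ := ih τ' s2 (by omega) h2 (hs.trans h1.same)
      exact ⟨_, s3, .loop_step hb h1 h4, h5, τ'', h6, by omega⟩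
    · exact ⟨1, s1, .loop_done hb, hb, τ, hI, by omega⟩

end Runs

/-- The register that holds the constant `1`. -/
notation "rOne" => 1

/-- The loop `for i < n do P`, which starts with the current value of `i`. -/
def Prog.forLoop (i n : ℕ) (P : Prog) : Prog := .loop (.lt i n) (P ;; .add i i rOne)

/-- The rule for counting loops. -/
theorem Runs.forLoop {P : Prog} {s : Store} {i n N C : ℕ} (J : ℕ → Store → Prop)
    (hw : (Nat.beq i n || Nat.beq i rOne || P.wr i || P.wr n || P.wr rOne) = false)
    (hone : s.reg rOne = 1) (hn : s.reg n = N) (hi : s.reg i ≤ N) (hJ : J (s.reg i) s)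
    (hstep : ∀ j s1, j < N → s1.reg i = j → Same (.forLoop i n P) s s1 → J j s1 →
      Runs P s1 fun t s2 => t ≤ C ∧ J (j + 1) (s2.setReg i (j + 1))) :
    Runs (.forLoop i n P) s fun t s' =>
      t ≤ (N - s.reg i) * (C + 2) + 1 ∧ s'.reg i = N ∧ J N s' := by
  simp only [Bool.or_eq_false_iff] at hw
  obtain ⟨⟨⟨⟨h1, h2⟩, h3⟩, h4⟩, h5⟩ := hw
  have h1' := ne_of_beq_eq_false h1
  have h2' := ne_of_beq_eq_false h2
  have hn' : (P ;; Prog.add i i rOne).wr n = false := by simp [Prog.wr, h4, h1]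
  have hone' : (P ;; Prog.add i i rOne).wr rOne = false := by simp only [Prog.wr, h5, h2]; rfl
  refine (Runs.loop (I := fun τ s1 => s1.reg i ≤ N ∧ J (s1.reg i) s1 ∧
    τ = (N - s1.reg i) * (C + 2)) ⟨hi, hJ, rfl⟩ ?_).mono ?_
  · rintro τ s1 ⟨hi1, hJ1, rfl⟩ hs hb
    have hb' : s1.reg i < N := by
      have : s1.reg i < s1.reg n := hb
      rwa [hs.reg n hn', hn] at this
    refine Runs.seq (hstep _ s1 hb' rfl ⟨hs.reg, hs.arr⟩ hJ1) fun t s2 ⟨ht, hJ2⟩ hs2 => ?_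
    rw [Runs.add_iff, hs2.reg i h3, hs2.reg rOne h5, hs.reg rOne hone', hone]
    refine ⟨(N - (s1.reg i + 1)) * (C + 2), ⟨?_, ?_, ?_⟩, ?_⟩
    · rw [Store.setReg_reg, if_pos rfl]; exact hb'
    · rwa [Store.setReg_reg, if_pos rfl]
    · rw [Store.setReg_reg, if_pos rfl]
    · obtain ⟨c, hc⟩ := Nat.exists_eq_add_of_lt hb'
      have e1 : N - s1.reg i = c + 1 := by omega
      have e2 : N - (s1.reg i + 1) = c := by omega
      rw [e1, e2, add_mul]
      omega
  · rintro t s' ⟨hb, τ', ⟨hi', hJ', rfl⟩, ht⟩ hs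
    have hb' : ¬ s'.reg i < N := by
      have h : ¬ s'.reg i < s'.reg n := hb
      rwa [hs.reg n hn', hn] at h
    have e : s'.reg i = N := by omega
    rw [e] at hJ' ht
    exact ⟨by omega, e, hJ'⟩

/-- The rule for counting loops whose body has a running time that depends on the counter. -/
theorem Runs.forLoop_sum {P : Prog} {s : Store} {i n N : ℕ} (C : ℕ → ℕ) (J : ℕ → Store → Prop)
    (hw : (Nat.beq i n || Nat.beq i rOne || P.wr i || P.wr n || P.wr rOne) = false)
    (hone : s.reg rOne = 1) (hn : s.reg n = N) (hi : s.reg i = 0) (hJ : J 0 s)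
    (hstep : ∀ j s1, j < N → s1.reg i = j → Same (.forLoop i n P) s s1 → J j s1 →
      Runs P s1 fun t s2 => t ≤ C j ∧ J (j + 1) (s2.setReg i (j + 1))) :
    Runs (.forLoop i n P) s fun t s' =>
      t ≤ ∑ j ∈ Finset.range N, (C j + 2) + 1 ∧ J N s' := by
  simp only [Bool.or_eq_false_iff] at hw
  obtain ⟨⟨⟨⟨h1, h2⟩, h3⟩, h4⟩, h5⟩ := hw
  have hn' : (P ;; Prog.add i i rOne).wr n = false := by simp [Prog.wr, h4, h1]
  have hone' : (P ;; Prog.add i i rOne).wr rOne = false := by simp only [Prog.wr, h5, h2]; rfl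
  refine (Runs.loop (I := fun τ s1 => s1.reg i ≤ N ∧ J (s1.reg i) s1 ∧
    τ = ∑ j ∈ Finset.Ico (s1.reg i) N, (C j + 2)) ⟨by omega, by rwa [hi], rfl⟩ ?_).mono ?_
  · rintro τ s1 ⟨hi1, hJ1, rfl⟩ hs hb
    have hb' : s1.reg i < N := by
      have : s1.reg i < s1.reg n := hb
      rwa [hs.reg n hn', hn] at this
    refine Runs.seq (hstep _ s1 hb' rfl ⟨hs.reg, hs.arr⟩ hJ1) fun t s2 ⟨ht, hJ2⟩ hs2 => ?_
    rw [Runs.add_iff, hs2.reg i h3, hs2.reg rOne h5, hs.reg rOne hone', hone]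
    refine ⟨_, ⟨?_, ?_, rfl⟩, ?_⟩
    · rw [Store.setReg_reg, if_pos rfl]; exact hb'
    · rwa [Store.setReg_reg, if_pos rfl]
    · rw [Store.setReg_reg, if_pos rfl, Finset.sum_eq_sum_Ico_succ_bot hb']
      omega
  · rintro t s' ⟨hb, τ', ⟨hi', hJ', rfl⟩, ht⟩ hs
    have hb' : ¬ s'.reg i < N := by
      have h : ¬ s'.reg i < s'.reg n := hb
      rwa [hs.reg n hn', hn] at h
    have e : s'.reg i = N := by omega
    rw [e] at hJ'
    rw [hi, ← Finset.range_eq_Ico] at ht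
    exact ⟨by omega, hJ'⟩

/-- The indicator of a proposition. -/
noncomputable def ind (p : Prop) : ℕ := by classical exact if p then 1 else 0

theorem ind_true {p : Prop} (h : p) : ind p = 1 := by simp [ind, h]

theorem ind_false {p : Prop} (h : ¬ p) : ind p = 0 := by simp [ind, h]

theorem ind_eq_one {p : Prop} : ind p = 1 ↔ p := by
  by_cases h : p <;> simp [ind, h]

theorem ind_eq_zero {p : Prop} : ind p = 0 ↔ ¬ p := by
  by_cases h : p <;> simp [ind, h]

theorem ind_congr {p q : Prop} (h : p ↔ q) : ind p = ind q := by rw [propext h]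

/-! ### Registers and arrays -/

/-- The register for the answer. -/
notation "rOut" => 0
/-- The register for the constant `0`. -/
notation "rZero" => 2
/-- The register for the number `m` of vertices. -/
notation "rM" => 3
/-- The register for the bound `w` on the number of boundary vertices. -/
notation "rW" => 4
/-- The register for the depth of the current node. -/
notation "rDep" => 5
/-- The register for the address of the set of the current node. -/
notation "rCb" => 6
/-- The register for the distance between the addresses of consecutive children of the current node. -/
notation "rPw" => 7
/-- The register for the current vertex. -/
notation "rV" => 8
/-- The register for the address of the set of the child at the current vertex. -/
notation "rCid" => 9
/-- The register that tells whether the search goes on. -/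
notation "rRun" => 10
/-- The register for the address of the set whose boundary is examined. -/
notation "rBase" => 11
/-- The register for a number of boundary vertices. -/
notation "rBd" => 12
notation "rI" => 20
notation "rJ" => 21
notation "rX" => 22
notation "rY" => 23
notation "rF" => 24
notation "rA" => 25
notation "rB" => 26
notation "rRow" => 27
notation "rT" => 28
notation "rNew" => 29

/-- The array of the input words. -/
notation "aIn" => 0
/-- The array of the numbers of the pallets. -/
notation "aNum" => 1
/-- The array of the arcs. -/
notation "aAdj" => 2
/-- The array of the sets of the nodes. -/
notation "aSet" => 5
/-- The array of the marks of the closed nodes. -/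
notation "aDone" => 6
/-- The array of the boundary of a set. -/
notation "aBd" => 10
/-- The array of the numbers of in-neighbours outside a set. -/
notation "aCnt" => 11

/-- The constants and the arcs, which are the same during the whole search: the cell `v * m + u` of
the arc array tells whether `E v u`. -/
structure Ctx (m w : ℕ) (E : ℕ → ℕ → Prop) (s : Store) : Prop where
  one : s.reg rOne = 1
  zero : s.reg rZero = 0
  m_eq : s.reg rM = m
  w_eq : s.reg rW = w
  adj : ∀ u < m, ∀ v < m, s.arr aAdj (v * m + u) = ind (E v u)

/-- The cells of `f` from `b` on hold the characteristic function of `X`. -/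
def HasSet (m : ℕ) (f : ℕ → ℕ) (b : ℕ) (X : Finset ℕ) : Prop := ∀ u < m, f (b + u) = ind (u ∈ X)

section Counting

variable {m w : ℕ} {E : ℕ → ℕ → Prop}

theorem Ctx.same {P : Prog} {s s' : Store} (h : Ctx m w E s) (hs : Same P s s')
    (hw : (P.wr rOne || P.wr rZero || P.wr rM || P.wr rW || P.wa aAdj) = false) :
    Ctx m w E s' := by
  simp only [Bool.or_eq_false_iff] at hw
  obtain ⟨⟨⟨⟨h1, h2⟩, h3⟩, h4⟩, h5⟩ := hw
  exact ⟨by rw [hs.reg _ h1, h.one], by rw [hs.reg _ h2, h.zero], by rw [hs.reg _ h3, h.m_eq],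
    by rw [hs.reg _ h4, h.w_eq], by rw [hs.arr _ h5]; exact h.adj⟩

theorem Ctx.setReg {s : Store} (h : Ctx m w E s) {x v : ℕ} (hx : rW < x) :
    Ctx m w E (s.setReg x v) :=
  ⟨by simp [h.one]; omega, by simp [h.zero]; omega, by simp [h.m_eq]; omega,
    by simp [h.w_eq]; omega, h.adj⟩

theorem Ctx.setArr {s : Store} (h : Ctx m w E s) {a i v : ℕ} (ha : aAdj < a) :
    Ctx m w E (s.setArr a i v) :=
  ⟨h.one, h.zero, h.m_eq, h.w_eq, by
    rw [Store.setArr_arr, if_neg (by omega)]; exact h.adj⟩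

/-! ### The number of boundary vertices of a set -/

@[simp] theorem ind_lt_ind {p q : Prop} : ind p < ind q ↔ ¬ p ∧ q := by
  by_cases hp : p <;> by_cases hq : q <;> simp [ind, hp, hq]

open Classical in
theorem card_filter_eq_sum_ind (m : ℕ) (p : ℕ → Prop) :
    ((Finset.range m).filter p).card = ∑ u ∈ Finset.range m, ind (p u) := by
  rw [Finset.card_filter]
  exact Finset.sum_congr rfl fun u _ => by unfold ind; congr

theorem bd_eq_sum {X : Finset ℕ} (hX : X ⊆ Finset.range m) :
    bd (Finset.range m) E X = ∑ u ∈ Finset.range m, ind (u ∈ boundary (Finset.range m) E X) := by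
  classical
  rw [← card_filter_eq_sum_ind]
  unfold bd
  congr 1
  ext u
  simp only [Finset.mem_filter]
  exact ⟨fun h => ⟨hX (mem_boundary.1 h).1, h⟩, fun h => h.2⟩

/-- The number of in-neighbours of `u` outside `X`. -/
noncomputable def outCount (m : ℕ) (E : ℕ → ℕ → Prop) (X : Finset ℕ) (u : ℕ) : ℕ :=
  ∑ v ∈ Finset.range m, ind (v ∉ X ∧ E v u)

theorem outCount_pos {X : Finset ℕ} {u : ℕ} :
    0 < outCount m E X u ↔ ∃ v < m, v ∉ X ∧ E v u := by
  unfold outCount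
  rw [Finset.sum_pos_iff]
  simp only [Finset.mem_range, Nat.pos_iff_ne_zero, ne_eq, ind_eq_zero, not_not]

theorem mem_boundary_iff {X : Finset ℕ} {u : ℕ} :
    u ∈ boundary (Finset.range m) E X ↔ u ∈ X ∧ 0 < outCount m E X u := by
  rw [mem_boundary, outCount_pos]
  simp only [Finset.mem_range]

theorem outCount_insert {X : Finset ℕ} {u x : ℕ} (hx : x < m) (hxX : x ∉ X) :
    outCount m E X u = outCount m E (insert x X) u + ind (E x u) := by
  unfold outCount
  rw [← Finset.add_sum_erase _ _ (Finset.mem_range.2 hx),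
    ← Finset.add_sum_erase _ (fun v => ind (v ∉ insert x X ∧ E v u)) (Finset.mem_range.2 hx)]
  rw [Finset.sum_congr rfl (g := fun v => ind (v ∉ insert x X ∧ E v u)) fun v hv => ind_congr (by
    rw [Finset.mem_insert, not_or]; simp [Finset.ne_of_mem_erase hv])]
  rw [ind_congr (show (x ∉ X ∧ E x u) ↔ E x u by simp [hxX]),
    ind_false (p := x ∉ insert x X ∧ E x u) (by simp)]
  omega

theorem mem_boundary_insert_iff {X : Finset ℕ} {u x : ℕ} (hx : x < m) (hxX : x ∉ X) :
    u ∈ boundary (Finset.range m) E (insert x X) ↔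
      u ∈ insert x X ∧ ind (E x u) < outCount m E X u := by
  rw [mem_boundary_iff, outCount_insert hx hxX]
  simp

theorem update_prefix {f g : ℕ → ℕ} {j v : ℕ} (h : ∀ u < j, f u = g u) (hv : v = g j) :
    ∀ u ≤ j, Function.update f j v u = g u := by
  intro u hu
  rcases eq_or_ne u j with rfl | huj
  · rw [Function.update_self, hv]
  · rw [Function.update_of_ne huj, h u (by omega)]

namespace Prog

/-- Sets `rF` to the number of in-neighbours of the vertex `rI` outside the set at `rBase`. -/
def countOut : Prog :=
  .const rF 0 ;; .const rJ 0 ;; .copy rA rI ;;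
  .forLoop rJ rM
    (.add rX rBase rJ ;; .load rX aSet rX ;; .load rY aAdj rA ;; .add rA rA rM ;;
      .cond (.lt rX rY) (.add rF rF rOne) .skip)

/-- Writes the boundary of the set at `rBase` to `aBd` and its size to `rBd`. -/
def countBoundary : Prog :=
  .const rBd 0 ;; .const rI 0 ;;
  .forLoop rI rM
    (.const rF 0 ;; .add rX rBase rI ;; .load rX aSet rX ;;
      .cond (.eq rX rOne) (countOut ;; .cond (.lt rZero rF) (.const rF 1) .skip) .skip ;;
      .store aBd rI rF ;; .add rBd rBd rF)

end Prog

theorem countOut_runs {s : Store} (hc : Ctx m w E s) {X : Finset ℕ} {u : ℕ}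
    (hu : s.reg rI = u) (hum : u < m) (hX : HasSet m (s.arr aSet) (s.reg rBase) X) :
    Runs .countOut s fun t s' => t ≤ m * 8 + 4 ∧ s'.reg rF = outCount m E X u := by
  unfold Prog.countOut
  simp only [Runs.seq_iff, Runs.const_iff, Runs.copy_iff]
  refine (Runs.forLoop (N := m) (C := 6) (fun j s1 => s1.reg rA = j * m + u ∧
    s1.reg rF = ∑ v ∈ Finset.range j, ind (v ∉ X ∧ E v u)) rfl ?_ ?_ ?_ ?_ ?_).mono ?_
  · simp [hc.one]
  · simp [hc.m_eq]
  · simp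
  · simp [hu]
  · intro j s1 hj hj1 hs ⟨h1, h2⟩
    have e1 : s1.reg rBase = s.reg rBase := by rw [hs.reg rBase rfl]; simp
    have e2 : s1.arr aSet = s.arr aSet := by rw [hs.arr aSet rfl]; simp
    have e3 : s1.arr aAdj = s.arr aAdj := by rw [hs.arr aAdj rfl]; simp
    have e4 : s1.reg rM = m := by rw [hs.reg rM rfl]; simp [hc.m_eq]
    have e5 : s1.reg rOne = 1 := by rw [hs.reg rOne rfl]; simp [hc.one]
    have e6 : j * m + u + m = (j + 1) * m + u := by ring
    simp [e1, e2, e3, e4, e5, e6, h1, h2, hj1, hX j hj, hc.adj u hum j hj, Finset.sum_range_succ]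
    constructor
    · intro h3 h4; exact (ind_true ⟨h3, h4⟩).symm
    · intro h3
      rw [← not_lt, ind_lt_ind] at h3
      exact ind_false h3
  · rintro t s' ⟨ht, -, -, h⟩ -
    simp at ht
    exact ⟨by omega, h⟩

theorem countBoundary_runs {s : Store} (hc : Ctx m w E s) {X : Finset ℕ}
    (hXm : X ⊆ Finset.range m) (hX : HasSet m (s.arr aSet) (s.reg rBase) X) :
    Runs .countBoundary s fun t s' => t ≤ m * (m * 8 + 15) + 3 ∧
      s'.reg rBd = bd (Finset.range m) E X ∧
      ∀ u < m, s'.arr aBd u = ind (u ∈ boundary (Finset.range m) E X) := by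
  unfold Prog.countBoundary
  simp only [Runs.seq_iff, Runs.const_iff]
  refine (Runs.forLoop (N := m) (C := m * 8 + 13) (fun j s1 =>
    s1.reg rBd = ∑ u ∈ Finset.range j, ind (u ∈ boundary (Finset.range m) E X) ∧
    ∀ u < j, s1.arr aBd u = ind (u ∈ boundary (Finset.range m) E X)) rfl ?_ ?_ ?_ ?_ ?_).mono ?_
  · simp [hc.one]
  · simp [hc.m_eq]
  · simp
  · simp
  · intro j s1 hj hj1 hs ⟨h1, h2⟩
    have hc1 : Ctx m w E s1 := ((hc.setReg (by omega)).setReg (by omega)).same hs rfl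
    have e1 : s1.reg rBase = s.reg rBase := by rw [hs.reg rBase rfl]; simp
    have e2 : s1.arr aSet = s.arr aSet := by rw [hs.arr aSet rfl]; simp
    simp [e1, e2, hj1, hX j hj, hc1.one, ind_eq_one, Finset.sum_range_succ]
    constructor
    · intro hjX
      refine (countOut_runs (u := j) (X := X) (((hc1.setReg (by omega)).setReg
        (by omega)).setReg (by omega)) (by simp [hj1]) hj (by simp [e1, e2, hX])).mono ?_
      rintro t s2 ⟨ht, h3⟩ hs2
      have e3 : s2.reg rI = j := by rw [hs2.reg rI rfl]; simp [hj1]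
      have e4 : s2.reg rBd = s1.reg rBd := by rw [hs2.reg rBd rfl]; simp
      have e5 : s2.arr aBd = s1.arr aBd := by rw [hs2.arr aBd rfl]; simp
      have e6 : s2.reg rZero = 0 := by rw [hs2.reg rZero rfl]; simp [hc1.zero]
      simp [e3, e4, e5, e6, h3, h1]
      have hb : j ∈ boundary (Finset.range m) E X ↔ 0 < outCount m E X j := by
        rw [mem_boundary_iff]; exact and_iff_right hjX
      constructor
      · intro h4
        have h5 := (ind_true (hb.2 h4)).symm
        exact ⟨by omega, h5, update_prefix h2 h5⟩
      · intro h4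
        have h5 : outCount m E X j = ind (j ∈ boundary (Finset.range m) E X) := by
          rw [h4, ind_false]; rw [hb]; omega
        exact ⟨by omega, h5, update_prefix h2 h5⟩
    · intro hjX
      have h5 : 0 = ind (j ∈ boundary (Finset.range m) E X) :=
        (ind_false fun h => hjX (mem_boundary.1 h).1).symm
      rw [← h5]
      exact ⟨h1, update_prefix h2 h5⟩
  · rintro t s' ⟨ht, -, h1, h2⟩ -
    simp [add_assoc] at ht
    exact ⟨by omega, by rw [h1, bd_eq_sum hXm], h2⟩

/-! ### Extending the set of a child -/

namespace Prog

/-- Adds the vertex `rV` and the set at `rCb` to the set at `rCid`, whose mark is removed if it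
changes. -/
def extendChild : Prog :=
  .const rF 0 ;; .const rI 0 ;;
  .forLoop rI rM
    (.add rX rCid rI ;; .load rA aSet rX ;;
      .cond (.lt rA rOne)
        (.add rY rCb rI ;; .load rY aSet rY ;;
          .cond (.eq rI rV) (.const rY 1) .skip ;;
          .cond (.eq rY rOne) (.store aSet rX rOne ;; .const rF 1) .skip)
        .skip) ;;
  .cond (.eq rF rOne) (.store aDone rCid rZero) .skip

end Prog

theorem extendChild_runs {s : Store} (hc : Ctx m w E s) {X Y : Finset ℕ}
    (hX : HasSet m (s.arr aSet) (s.reg rCid) X) (hY : HasSet m (s.arr aSet) (s.reg rCb) Y)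
    (hYm : Y ⊆ Finset.range m) (hv : s.reg rV < m)
    (hdisj : ∀ u < m, ∀ u' < m, s.reg rCb + u ≠ s.reg rCid + u') :
    Runs .extendChild s fun t s' => t ≤ m * 12 + 6 ∧
      HasSet m (s'.arr aSet) (s.reg rCid) (X ∪ insert (s.reg rV) Y) ∧
      (∀ a, (∀ u < m, a ≠ s.reg rCid + u) → s'.arr aSet a = s.arr aSet a) ∧
      s'.arr aDone = if X ∪ insert (s.reg rV) Y = X then s.arr aDone else
        Function.update (s.arr aDone) (s.reg rCid) 0 := by
  unfold Prog.extendChild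
  simp only [Runs.seq_iff, Runs.const_iff]
  refine (Runs.forLoop (N := m) (C := 10) (fun j s1 =>
    (∀ u < m, s1.arr aSet (s.reg rCid + u) = ind (u ∈ X ∨ u < j ∧ u ∈ insert (s.reg rV) Y)) ∧
    (∀ a, (∀ u < m, a ≠ s.reg rCid + u) → s1.arr aSet a = s.arr aSet a) ∧
    s1.reg rF = ind (∃ u, u < j ∧ u ∉ X ∧ u ∈ insert (s.reg rV) Y)) rfl ?_ ?_ ?_ ?_ ?_).mono ?_
  · simp [hc.one]
  · simp [hc.m_eq]
  · simp
  · simp [ind_false]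
    exact hX
  · intro j s1 hj hj1 hs ⟨h1, h2, h3⟩
    have hc1 : Ctx m w E s1 := ((hc.setReg (by omega)).setReg (by omega)).same hs rfl
    have e1 : s1.reg rCid = s.reg rCid := by rw [hs.reg rCid rfl]; simp
    have e2 : s1.reg rCb = s.reg rCb := by rw [hs.reg rCb rfl]; simp
    have e3 : s1.reg rV = s.reg rV := by rw [hs.reg rV rfl]; simp
    have e4 : s1.arr aSet (s.reg rCb + j) = ind (j ∈ Y) := by
      rw [h2 _ fun u hu => hdisj j hj u hu]; exact hY j hj
    have e5 : s1.arr aSet (s.reg rCid + j) = ind (j ∈ X) := by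
      rw [h1 j hj]; exact ind_congr (by simp)
    have hsame : (j ∈ X ∨ j ∉ insert (s.reg rV) Y) →
        (∀ u < m, s1.arr aSet (s.reg rCid + u) =
          ind (u ∈ X ∨ u < j + 1 ∧ u ∈ insert (s.reg rV) Y)) ∧
        s1.reg rF = ind (∃ u, u < j + 1 ∧ u ∉ X ∧ u ∈ insert (s.reg rV) Y) := by
      intro h
      refine ⟨fun u hu => ?_, ?_⟩
      · rw [h1 u hu]
        refine ind_congr ?_
        rcases eq_or_ne u j with rfl | huj
        · tauto
        · have : u < j ↔ u < j + 1 := by omega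
          rw [this]
      · rw [h3]
        refine ind_congr ⟨fun ⟨u, h4, h5⟩ => ⟨u, by omega, h5⟩, fun ⟨u, h4, h5⟩ => ?_⟩
        rcases eq_or_ne u j with rfl | huj
        · tauto
        · exact ⟨u, by omega, h5⟩
    have hdiff : j ∉ X → j ∈ insert (s.reg rV) Y →
        (∀ u < m, Function.update (s1.arr aSet) (s.reg rCid + j) 1 (s.reg rCid + u) =
          ind (u ∈ X ∨ u < j + 1 ∧ u ∈ insert (s.reg rV) Y)) ∧
        (∀ a, (∀ u < m, a ≠ s.reg rCid + u) →
          Function.update (s1.arr aSet) (s.reg rCid + j) 1 a = s.arr aSet a) ∧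
        1 = ind (∃ u, u < j + 1 ∧ u ∉ X ∧ u ∈ insert (s.reg rV) Y) := by
      intro hjX hjY
      refine ⟨fun u hu => ?_, fun a ha => ?_, (ind_true ⟨j, by omega, hjX, hjY⟩).symm⟩
      · rcases eq_or_ne u j with rfl | huj
        · rw [Function.update_self, ind_true]
          exact Or.inr ⟨by omega, hjY⟩
        · rw [Function.update_of_ne (by omega), h1 u hu]
          have : u < j ↔ u < j + 1 := by omega
          rw [this]
      · rw [Function.update_of_ne (ha j hj), h2 a ha]
    simp [-Finset.mem_insert, -Order.lt_add_one_iff, -ne_eq, e1, e2, e3, e4, e5, hj1, hc1.one,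
      ind_eq_zero, ind_eq_one, Nat.one_le_iff_ne_zero]
    refine ⟨fun hjX => ⟨fun hjv => ?_, fun hjv => ⟨fun hjY => ?_, fun hjY => ?_⟩⟩, fun hjX => ?_⟩
    · exact hdiff hjX (by rw [hjv]; exact Finset.mem_insert_self _ _)
    · exact hdiff hjX (Finset.mem_insert_of_mem hjY)
    · have := hsame (Or.inr (by rw [Finset.mem_insert]; tauto))
      exact ⟨this.1, h2, this.2⟩
    · have := hsame (Or.inl (by rwa [ne_eq, ind_eq_zero, not_not] at hjX))
      exact ⟨this.1, h2, this.2⟩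
  · rintro t s' ⟨ht, -, h1, h2, h3⟩ hs
    have e1 : s'.reg rCid = s.reg rCid := by rw [hs.reg rCid rfl]; simp
    have e2 : s'.arr aDone = s.arr aDone := by rw [hs.arr aDone rfl]; simp
    have hc1 : Ctx m w E s' := ((hc.setReg (by omega)).setReg (by omega)).same hs rfl
    have h4 : HasSet m (s'.arr aSet) (s.reg rCid) (X ∪ insert (s.reg rV) Y) := by
      intro u hu
      rw [h1 u hu, Finset.mem_union]
      exact ind_congr (by simp [hu])
    have h5 : (∃ u, u < m ∧ u ∉ X ∧ u ∈ insert (s.reg rV) Y) ↔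
        ¬ X ∪ insert (s.reg rV) Y = X := by
      rw [Finset.union_eq_left, Finset.not_subset]
      refine exists_congr fun u => ⟨fun h => ⟨h.2.2, h.2.1⟩, fun h => ⟨?_, h.2, h.1⟩⟩
      rcases Finset.mem_insert.1 h.1 with rfl | h
      · exact hv
      · exact Finset.mem_range.1 (hYm h)
    rw [h5] at h3
    simp at ht
    simp [h3, ind_eq_one, hc1.one, hc1.zero, e1, e2, -Finset.union_eq_left, -Finset.mem_insert,
      -Finset.union_insert, -ne_eq]
    refine ⟨fun h => ⟨by omega, h4, h2, fun h' => absurd h' h⟩,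
      fun h => ⟨by omega, h4, h2, fun h' => absurd h h'⟩⟩

/-! ### Adding a vertex at a leaf -/

namespace Prog

/-- Sets `rBd` to the number of boundary vertices of the set at `rBase` together with the vertex
`rI`, where `aCnt` holds the numbers of in-neighbours outside the set and `rRow = rI * m`. -/
def countInsert : Prog :=
  .const rBd 0 ;; .const rJ 0 ;;
  .forLoop rJ rM
    (.add rY rBase rJ ;; .load rY aSet rY ;;
      .cond (.eq rJ rI) (.const rY 1) .skip ;;
      .add rB rRow rJ ;; .load rB aAdj rB ;; .load rX aCnt rJ ;;
      .cond (.eq rY rOne) (.cond (.lt rB rX) (.add rBd rBd rOne) .skip) .skip)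

/-- Searches for a vertex `x` outside the set at `rBase` such that the set with `x` has at most `rW`
boundary vertices. Sets `rT` to `x + 1` and `rNew` to the number of these boundary vertices, and
`rT` to `0` if there is no such vertex. -/
def findVertex : Prog :=
  .const rI 0 ;;
  .forLoop rI rM (countOut ;; .store aCnt rI rF) ;;
  .const rT 0 ;; .const rNew 0 ;; .const rRow 0 ;; .const rI 0 ;;
  .forLoop rI rM
    (.add rX rBase rI ;; .load rX aSet rX ;;
      .cond (.lt rX rOne)
        (countInsert ;;
          .cond (.lt rW rBd) .skip (.add rT rI rOne ;; .copy rNew rBd))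
        .skip ;;
      .add rRow rRow rM)

end Prog

theorem countInsert_runs {s : Store} (hc : Ctx m w E s) {X : Finset ℕ} {x : ℕ}
    (hx : s.reg rI = x) (hxm : x < m) (hXm : X ⊆ Finset.range m) (hxX : x ∉ X)
    (hX : HasSet m (s.arr aSet) (s.reg rBase) X) (hrow : s.reg rRow = x * m)
    (hcnt : ∀ u < m, s.arr aCnt u = outCount m E X u) :
    Runs .countInsert s fun t s' => t ≤ m * 14 + 3 ∧
      s'.reg rBd = bd (Finset.range m) E (insert x X) := by
  unfold Prog.countInsert
  simp only [Runs.seq_iff, Runs.const_iff]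
  refine (Runs.forLoop (N := m) (C := 12) (fun j s1 =>
    s1.reg rBd = ∑ u ∈ Finset.range j, ind (u ∈ boundary (Finset.range m) E (insert x X)))
    rfl ?_ ?_ ?_ ?_ ?_).mono ?_
  · simp [hc.one]
  · simp [hc.m_eq]
  · simp
  · simp
  · intro j s1 hj hj1 hs h1
    have hc1 : Ctx m w E s1 := ((hc.setReg (by omega)).setReg (by omega)).same hs rfl
    have e1 : s1.reg rBase = s.reg rBase := by rw [hs.reg rBase rfl]; simp
    have e2 : s1.arr aSet = s.arr aSet := by rw [hs.arr aSet rfl]; simp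
    have e3 : s1.arr aCnt = s.arr aCnt := by rw [hs.arr aCnt rfl]; simp
    have e4 : s1.reg rI = x := by rw [hs.reg rI rfl]; simp [hx]
    have e5 : s1.reg rRow = x * m := by rw [hs.reg rRow rfl]; simp [hrow]
    have hb := mem_boundary_insert_iff (E := E) (u := j) hxm hxX
    rw [Finset.mem_insert] at hb
    simp [e1, e2, e3, e4, e5, hj1, hX j hj, hcnt j hj, hc1.adj j hj x hxm, hc1.one, h1,
      Finset.sum_range_succ, ind_eq_one]
    rw [ind_congr hb]
    refine ⟨fun h => ⟨fun h2 => (ind_true ⟨Or.inl h, h2⟩).symm, fun h2 => ind_false fun h3 => ?_⟩,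
      fun h => ⟨fun h4 => ⟨fun h2 => (ind_true ⟨Or.inr h4, h2⟩).symm,
        fun h2 => ind_false fun h3 => ?_⟩, fun h4 => ind_false fun h3 => ?_⟩⟩
    · omega
    · omega
    · tauto
  · rintro t s' ⟨ht, -, h1⟩ -
    simp at ht
    exact ⟨by omega, by
      rw [h1, bd_eq_sum (Finset.insert_subset (Finset.mem_range.2 hxm) hXm)]⟩

theorem findVertex_runs {s : Store} (hc : Ctx m w E s) {X : Finset ℕ}
    (hXm : X ⊆ Finset.range m) (hX : HasSet m (s.arr aSet) (s.reg rBase) X) :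
    Runs .findVertex s fun t s' => t ≤ m * (m * 8 + 7) + m * (m * 14 + 14) + 7 ∧
      (s'.reg rT = 0 ∧ (∀ x < m, x ∉ X → w < bd (Finset.range m) E (insert x X)) ∨
        ∃ x < m, x ∉ X ∧ bd (Finset.range m) E (insert x X) ≤ w ∧ s'.reg rT = x + 1 ∧
          s'.reg rNew = bd (Finset.range m) E (insert x X)) := by
  unfold Prog.findVertex
  rw [Runs.seq_iff, Runs.const_iff]
  refine Runs.seq (Runs.forLoop (N := m) (C := m * 8 + 5) (fun j s1 =>
    ∀ u < j, s1.arr aCnt u = outCount m E X u) rfl ?_ ?_ ?_ ?_ ?_) ?_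
  · simp [hc.one]
  · simp [hc.m_eq]
  · simp
  · simp
  · intro j s1 hj hj1 hs h1
    have hc1 : Ctx m w E s1 := (hc.setReg (by omega)).same hs rfl
    have e1 : s1.reg rBase = s.reg rBase := by rw [hs.reg rBase rfl]; simp
    have e2 : s1.arr aSet = s.arr aSet := by rw [hs.arr aSet rfl]; simp
    refine Runs.seq (countOut_runs hc1 hj1 hj (by rw [e1, e2]; exact hX)) ?_
    rintro t s2 ⟨ht, h2⟩ hs2
    have e3 : s2.reg rI = j := by rw [hs2.reg rI rfl, hj1]
    have e4 : s2.arr aCnt = s1.arr aCnt := hs2.arr aCnt rfl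
    simp [e3, e4, h2]
    exact ⟨by omega, update_prefix h1 rfl⟩
  · rintro t0 s0 ⟨ht0, -, h0⟩ hs0
    have hc0 : Ctx m w E s0 := (hc.setReg (by omega)).same hs0 rfl
    have e1 : s0.reg rBase = s.reg rBase := by rw [hs0.reg rBase rfl]; simp
    have e2 : s0.arr aSet = s.arr aSet := by rw [hs0.arr aSet rfl]; simp
    simp only [Runs.seq_iff, Runs.const_iff]
    refine (Runs.forLoop (N := m) (C := m * 14 + 12) (fun j s1 => s1.reg rRow = j * m ∧
      (s1.reg rT = 0 ∧ (∀ x < j, x ∉ X → w < bd (Finset.range m) E (insert x X)) ∨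
        ∃ x < m, x ∉ X ∧ bd (Finset.range m) E (insert x X) ≤ w ∧ s1.reg rT = x + 1 ∧
          s1.reg rNew = bd (Finset.range m) E (insert x X))) rfl ?_ ?_ ?_ ?_ ?_).mono ?_
    · simp [hc0.one]
    · simp [hc0.m_eq]
    · simp
    · simp
    · intro j s1 hj hj1 hs ⟨h1, h2⟩
      have hc1 : Ctx m w E s1 := ((((hc0.setReg (by omega)).setReg (by omega)).setReg
        (by omega)).setReg (by omega)).same hs rfl
      have f1 : s1.reg rBase = s.reg rBase := by rw [hs.reg rBase rfl]; simp [e1]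
      have f2 : s1.arr aSet = s.arr aSet := by rw [hs.arr aSet rfl]; simp [e2]
      have f3 : s1.arr aCnt = s0.arr aCnt := by rw [hs.arr aCnt rfl]; simp
      have f4 : j * m + m = (j + 1) * m := by ring
      have f5 : s1.reg rM = m := hc1.m_eq
      rw [Runs.seq_iff, Runs.add_iff, Runs.seq_iff, Runs.load_iff, Runs.seq_iff, Runs.cond_iff]
      simp [-Runs.seq_iff, -Runs.cond_iff, -Order.lt_add_one_iff, f1, f2, hj1, hX j hj, hc1.one,
        ind_eq_zero, h1, f5, f4]
      constructor
      · intro hjX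
        refine Runs.seq (countInsert_runs (x := j) (X := X) ((hc1.setReg (by omega)).setReg
          (by omega)) (by simp [hj1]) hj hXm hjX (by simpa [f1, f2] using hX) (by simp [h1])
          (by simpa [f3] using h0)) ?_
        rintro t s2 ⟨ht, h3⟩ hs2
        have g1 : s2.reg rW = w := by rw [hs2.reg rW rfl]; simp [hc1.w_eq]
        have g2 : s2.reg rRow = j * m := by rw [hs2.reg rRow rfl]; simp [h1]
        have g3 : s2.reg rM = m := by rw [hs2.reg rM rfl]; simp [f5]
        have g4 : s2.reg rI = j := by rw [hs2.reg rI rfl]; simp [hj1]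
        have g5 : s2.reg rOne = 1 := by rw [hs2.reg rOne rfl]; simp [hc1.one]
        have g6 : s2.reg rT = s1.reg rT := by rw [hs2.reg rT rfl]; simp
        have g7 : s2.reg rNew = s1.reg rNew := by rw [hs2.reg rNew rfl]; simp
        simp [-Order.lt_add_one_iff, g1, g2, g3, g4, g5, g6, g7, h3, f4]
        refine ⟨fun h4 => ⟨by omega, ?_⟩, fun h4 => ⟨by omega, hj, hjX, h4⟩⟩
        refine h2.imp_left fun h2 => ⟨h2.1, fun x hx hxX => ?_⟩
        rcases Nat.lt_succ_iff_lt_or_eq.1 hx with hx | rfl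
        · exact h2.2 x hx hxX
        · exact h4
      · intro hjX
        refine h2.imp_left fun h2 => ⟨h2.1, fun x hx hxX => ?_⟩
        rcases Nat.lt_succ_iff_lt_or_eq.1 hx with hx | rfl
        · exact h2.2 x hx hxX
        · exact absurd hjX hxX
    · rintro t s' ⟨ht, -, -, h1⟩ -
      simp [add_assoc] at ht ht0
      exact ⟨by omega, h1⟩

end Counting

/-! ### Matchings and augmenting paths -/

section Matching

/-- The array `mr` describes a matching of the left vertices `l < k` with `T l` into the right
vertices `x < m` with `R x` along arcs `E l x`: `mr x = l + 1` if `x` is matched to `l`, and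
`mr x = 0` if `x` is free. -/
structure Matching (m : ℕ) (E : ℕ → ℕ → Prop) (T R : ℕ → Prop) (k : ℕ) (mr : ℕ → ℕ) : Prop where
  valid : ∀ x < m, ∀ l, mr x = l + 1 → T l ∧ l < k ∧ R x ∧ E l x
  inj : ∀ x < m, ∀ y < m, mr x = mr y → mr x ≠ 0 → x = y
  cover : ∀ l < k, T l → ∃ x < m, mr x = l + 1

/-- The state of a breadth-first search for an augmenting path from the left vertex `r`. The queue
has `tail` entries; the entry `i` is the left vertex `ql i`, which for `i ≠ 0` is matched to the right
vertex `qx i`, reached from the entry `qp i`. If a free right vertex has been found, `fx - 1` is such a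
vertex, reached from the entry `fq`; otherwise `fx = 0`. The right vertex `x` has been
considered for the entry `i` if `Sc i x`. -/
structure Bfs (m : ℕ) (E : ℕ → ℕ → Prop) (R : ℕ → Prop) (mr : ℕ → ℕ) (r : ℕ)
    (ql qx qp vis : ℕ → ℕ) (tail fx fq : ℕ) (Sc : ℕ → ℕ → Prop) : Prop where
  zero : ql 0 = r
  pos : 0 < tail
  node : ∀ i, 0 < i → i < tail →
    qx i < m ∧ R (qx i) ∧ mr (qx i) = ql i + 1 ∧ qp i < i ∧ E (ql (qp i)) (qx i)
  inj : ∀ i, 0 < i → i < tail → ∀ i', 0 < i' → i' < tail → qx i = qx i' → i = i'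
  vis_qx : ∀ i, 0 < i → i < tail → vis (qx i) = 1
  of_vis : ∀ x < m, vis x = 1 → (mr x = 0 ∧ fx ≠ 0) ∨ ∃ i, 0 < i ∧ i < tail ∧ qx i = x
  scan : ∀ i x, Sc i x → i < tail → x < m → R x → E (ql i) x → vis x = 1
  found : fx ≠ 0 → ∃ x < m, fx = x + 1 ∧ R x ∧ mr x = 0 ∧ fq < tail ∧ E (ql fq) x

variable {m : ℕ} {E : ℕ → ℕ → Prop} {T R : ℕ → Prop} {k r : ℕ} {mr ql qx qp vis : ℕ → ℕ}
  {tail fx fq : ℕ} {Sc Sc' : ℕ → ℕ → Prop}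

theorem Bfs.start (hql : ql 0 = r) (hvis : ∀ x < m, vis x = 0) :
    Bfs m E R mr r ql qx qp vis 1 0 0 (fun _ _ => False) where
  zero := hql
  pos := Nat.one_pos
  node := fun i h1 h2 => by omega
  inj := fun i h1 h2 => by omega
  vis_qx := fun i h1 h2 => by omega
  of_vis := fun x hx h => by rw [hvis x hx] at h; omega
  scan := fun _ _ h => h.elim
  found := fun h => absurd rfl h

/-- Nothing changes when the considered vertices are no neighbours or have been visited before. -/
theorem Bfs.scanned (h : Bfs m E R mr r ql qx qp vis tail fx fq Sc)
    (hSc : ∀ i x, Sc' i x → i < tail → x < m → R x → E (ql i) x → Sc i x ∨ vis x = 1) :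
    Bfs m E R mr r ql qx qp vis tail fx fq Sc' :=
  { h with
    scan := fun i x h1 h2 h3 h4 h5 => (hSc i x h1 h2 h3 h4 h5).elim
      (fun h6 => h.scan i x h6 h2 h3 h4 h5) id }

/-- A free right vertex has been found. -/
theorem Bfs.free (h : Bfs m E R mr r ql qx qp vis tail fx fq Sc) {x q : ℕ} (hx : x < m)
    (hR : R x) (hq : q < tail) (hE : E (ql q) x) (hmr : mr x = 0)
    (hSc : ∀ i y, Sc' i y → Sc i y ∨ y = x) :
    Bfs m E R mr r ql qx qp (Function.update vis x 1) tail (x + 1) q Sc' where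
  zero := h.zero
  pos := h.pos
  node := h.node
  inj := h.inj
  vis_qx := fun i h1 h2 => by
    rw [Function.update_apply]; split_ifs
    · rfl
    · exact h.vis_qx i h1 h2
  of_vis := fun y hy h1 => by
    rw [Function.update_apply] at h1
    split_ifs at h1 with h2
    · exact Or.inl ⟨by rw [h2, hmr], by omega⟩
    · exact (h.of_vis y hy h1).imp_left fun h3 => ⟨h3.1, by omega⟩
  scan := fun i y h1 h2 h3 h4 h5 => by
    rw [Function.update_apply]; split_ifs with h6
    · rfl
    · exact h.scan i y ((hSc i y h1).resolve_right h6) h2 h3 h4 h5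
  found := fun _ => ⟨x, hx, rfl, hR, hmr, hq, hE⟩

/-- The partner of a right vertex that has not been visited before enters the queue. -/
theorem Bfs.enqueue (h : Bfs m E R mr r ql qx qp vis tail fx fq Sc) {x q l : ℕ} (hx : x < m)
    (hR : R x) (hq : q < tail) (hE : E (ql q) x) (hmr : mr x = l + 1) (hvis : vis x ≠ 1)
    (hlt : ∀ i y, Sc' i y → i < tail) (hSc : ∀ i y, Sc' i y → Sc i y ∨ y = x) :
    Bfs m E R mr r (Function.update ql tail l) (Function.update qx tail x)
      (Function.update qp tail q) (Function.update vis x 1) (tail + 1) fx fq Sc' where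
  zero := by rw [Function.update_of_ne (by have := h.pos; omega), h.zero]
  pos := Nat.succ_pos _
  node := fun i h1 h2 => by
    rcases Nat.lt_succ_iff_lt_or_eq.1 h2 with h2 | rfl
    · obtain ⟨h3, h4, h5, h6, h7⟩ := h.node i h1 h2
      have h8 : i ≠ tail := by omega
      simp only [Function.update_of_ne h8]
      exact ⟨h3, h4, h5, h6, by rwa [Function.update_of_ne (by omega)]⟩
    · simp only [Function.update_self]
      exact ⟨hx, hR, hmr, hq, by rwa [Function.update_of_ne (by omega)]⟩
  inj := fun i h1 h2 i' h1' h2' h3 => by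
    have key : ∀ i, 0 < i → i < tail → qx i ≠ x := fun i h1 h2 h4 =>
      hvis (h4 ▸ h.vis_qx i h1 h2)
    rcases Nat.lt_succ_iff_lt_or_eq.1 h2 with h2 | rfl <;>
      rcases Nat.lt_succ_iff_lt_or_eq.1 h2' with h2' | rfl
    · rw [Function.update_of_ne (by omega), Function.update_of_ne (by omega)] at h3
      exact h.inj i h1 h2 i' h1' h2' h3
    · rw [Function.update_of_ne (by omega), Function.update_self] at h3
      exact absurd h3 (key i h1 h2)
    · rw [Function.update_self, Function.update_of_ne (by omega)] at h3
      exact absurd h3.symm (key i' h1' h2')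
    · rfl
  vis_qx := fun i h1 h2 => by
    rw [Function.update_apply vis]; split_ifs with h3
    · rfl
    · rcases Nat.lt_succ_iff_lt_or_eq.1 h2 with h2 | rfl
      · rw [Function.update_of_ne (by omega)]
        exact h.vis_qx i h1 h2
      · rw [Function.update_self] at h3
        exact absurd rfl h3
  of_vis := fun y hy h1 => by
    rw [Function.update_apply] at h1
    split_ifs at h1 with h2
    · exact Or.inr ⟨tail, h.pos, by omega, by rw [Function.update_self, h2]⟩
    · refine (h.of_vis y hy h1).imp_right ?_
      rintro ⟨i, h3, h4, h5⟩
      exact ⟨i, h3, by omega, by rw [Function.update_of_ne (by omega), h5]⟩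
  scan := fun i y h1 h2 h3 h4 h5 => by
    rw [Function.update_apply]; split_ifs with h6
    · rfl
    · have h7 := hlt i y h1
      rw [Function.update_of_ne (by omega)] at h5
      exact h.scan i y ((hSc i y h1).resolve_right h6) h7 h3 h4 h5
  found := fun h1 => by
    obtain ⟨y, h2, h3, h4, h5, h6, h7⟩ := h.found h1
    exact ⟨y, h2, h3, h4, h5, by omega, by rwa [Function.update_of_ne (by omega)]⟩

/-- The queue holds distinct right vertices, apart from its first entry. -/
theorem Bfs.tail_le (h : Bfs m E R mr r ql qx qp vis tail fx fq Sc) : tail ≤ m + 1 := by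
  have h1 : ((Finset.Ico 1 tail).image qx).card = (Finset.Ico 1 tail).card := by
    apply Finset.card_image_of_injOn
    intro i hi i' hi' hii
    simp only [Finset.coe_Ico, Set.mem_Ico] at hi hi'
    exact h.inj i hi.1 hi.2 i' hi'.1 hi'.2 hii
  have h2 : ((Finset.Ico 1 tail).image qx) ⊆ Finset.range m := by
    intro x hx
    obtain ⟨i, hi, rfl⟩ := Finset.mem_image.1 hx
    rw [Finset.mem_Ico] at hi
    exact Finset.mem_range.2 (h.node i hi.1 hi.2).1
  have h3 := Finset.card_le_card h2
  rw [h1, Nat.card_Ico, Finset.card_range] at h3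
  omega

theorem Bfs.left (h : Bfs m E R mr r ql qx qp vis tail fx fq Sc) (hM : Matching m E T R r mr)
    (hr : T r) {i : ℕ} (hi : i < tail) : T (ql i) := by
  rcases Nat.eq_zero_or_pos i with rfl | h0
  · rw [h.zero]; exact hr
  · obtain ⟨h1, -, h2, -⟩ := h.node i h0 hi
    exact (hM.valid _ h1 _ h2).1

/-- A search that has found no free vertex shows that the left vertices in the queue outnumber
their neighbours. -/
theorem Bfs.bd_sdiff_lt (h : Bfs m E R mr r ql qx qp vis tail 0 fq Sc)
    (hM : Matching m E T R r mr) (hSc : ∀ i < tail, ∀ x, Sc i x) {B : Finset ℕ}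
    (hBm : B ⊆ Finset.range m) (hr : T r) (hT : ∀ l, T l → l ∈ B)
    (hR : ∀ x, R x ↔ x ∈ B ∧ x ∉ boundary (Finset.range m) E B) (hrefl : ∀ v, E v v) :
    bd (Finset.range m) E (B \ (Finset.range tail).image ql) < bd (Finset.range m) E B := by
  refine FifoStackUp.bd_sdiff_lt (N := (Finset.Ico 1 tail).image qx) hrefl ?_ ?_ ?_
  · intro l hl
    obtain ⟨i, hi, rfl⟩ := Finset.mem_image.1 hl
    exact hT _ (h.left hM hr (Finset.mem_range.1 hi))
  · intro l hl x hxB hxb hE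
    obtain ⟨i, hi, rfl⟩ := Finset.mem_image.1 hl
    rw [Finset.mem_range] at hi
    have hx := Finset.mem_range.1 (hBm hxB)
    rcases h.of_vis x hx (h.scan i x (hSc i hi x) hi hx ((hR x).2 ⟨hxB, hxb⟩) hE) with h1 | h1
    · exact absurd rfl h1.2
    · obtain ⟨i', h2, h3, rfl⟩ := h1
      exact Finset.mem_image_of_mem _ (Finset.mem_Ico.2 ⟨h2, h3⟩)
  · have h1 : ((Finset.range tail).image ql).card = tail := by
      rw [Finset.card_image_of_injOn, Finset.card_range]
      have key : ∀ i, 0 < i → i < tail → ql i < r := fun i h1 h2 =>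
        (hM.valid _ (h.node i h1 h2).1 _ (h.node i h1 h2).2.2.1).2.1
      intro i hi i' hi' hii
      simp only [Finset.coe_range, Set.mem_Iio] at hi hi'
      rcases Nat.eq_zero_or_pos i with rfl | h0 <;> rcases Nat.eq_zero_or_pos i' with rfl | h0'
      · rfl
      · have := key i' h0' hi'
        rw [← hii, h.zero] at this
        omega
      · have := key i h0 hi
        rw [hii, h.zero] at this
        omega
      · obtain ⟨h1, -, h2, -⟩ := h.node i h0 hi
        obtain ⟨h3, -, h4, -⟩ := h.node i' h0' hi'
        exact h.inj i h0 hi i' h0' hi' (hM.inj _ h1 _ h3 (by rw [h2, h4, hii]) (by omega))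
    have h2 : ((Finset.Ico 1 tail).image qx).card ≤ tail - 1 := by
      have := Finset.card_image_le (s := Finset.Ico 1 tail) (f := qx)
      rwa [Nat.card_Ico] at this
    have := h.pos
    omega

/-- The state of the augmentation: the right vertex `x` is about to be matched to the entry `q` of
the queue. Apart from `x`, the array `mr` describes a matching of the left vertices below `r`. -/
structure Flip (m : ℕ) (E : ℕ → ℕ → Prop) (T R : ℕ → Prop) (r : ℕ) (ql qx : ℕ → ℕ) (mr : ℕ → ℕ)
    (x q : ℕ) : Prop where
  valid : ∀ y < m, y ≠ x → ∀ l, mr y = l + 1 → T l ∧ l < r ∧ R y ∧ E l y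
  inj : ∀ y < m, y ≠ x → ∀ y' < m, y' ≠ x → mr y = mr y' → mr y ≠ 0 → y = y'
  cover : ∀ l < r, T l → ∃ y < m, y ≠ x ∧ mr y = l + 1
  lt : x < m
  right : R x
  arc : E (ql q) x
  anc : ∀ i, 0 < i → i ≤ q → qx i ≠ x ∧ mr (qx i) = ql i + 1

theorem Bfs.flip (h : Bfs m E R mr r ql qx qp vis tail fx fq Sc) (hM : Matching m E T R r mr)
    (hfx : fx ≠ 0) : fq < tail ∧ Flip m E T R r ql qx mr (fx - 1) fq := by
  obtain ⟨x, h1, rfl, h2, h3, h4, h5⟩ := h.found hfx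
  rw [Nat.add_sub_cancel]
  refine ⟨h4, fun y hy _ => hM.valid y hy, fun y hy _ y' hy' _ => hM.inj y hy y' hy', ?_, h1, h2, h5, ?_⟩
  · intro l hl hT
    obtain ⟨y, hy, h6⟩ := hM.cover l hl hT
    exact ⟨y, hy, fun h7 => by rw [h7, h3] at h6; omega, h6⟩
  · intro i hi hi'
    obtain ⟨-, -, h6, -⟩ := h.node i hi (by omega)
    exact ⟨fun h7 => by rw [h7, h3] at h6; omega, h6⟩

/-- Matching `x` to the entry `q` sets the former partner of `q` free, which is matched to the
predecessor of `q` next. -/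
theorem Flip.step {mr' : ℕ → ℕ} {x q : ℕ} (hF : Flip m E T R r ql qx mr' x q)
    (h : Bfs m E R mr r ql qx qp vis tail fx fq Sc) (hq : 0 < q) (hqt : q < tail) :
    Flip m E T R r ql qx (Function.update mr' x (ql q + 1)) (qx q) (qp q) := by
  obtain ⟨h1, h2, -, h3, h4⟩ := h.node q hq hqt
  obtain ⟨h5, h6⟩ := hF.anc q hq le_rfl
  have h7 := hF.valid _ h1 h5 _ h6
  refine ⟨?_, ?_, ?_, h1, h2, h4, ?_⟩
  · intro y hy hyq l hl
    rw [Function.update_apply] at hl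
    split_ifs at hl with hyx
    · have : ql q = l := by omega
      subst this
      exact ⟨h7.1, h7.2.1, hyx ▸ hF.right, hyx ▸ hF.arc⟩
    · exact hF.valid y hy hyx l hl
  · have key : ∀ y < m, y ≠ qx q → y ≠ x → ql q + 1 ≠ mr' y := fun y hy hyq hyx he =>
      hyq (hF.inj y hy hyx _ h1 h5 (by rw [h6, he]) (by omega))
    intro y hy hyq y' hy' hyq' he h0
    rw [Function.update_apply] at he h0
    rw [Function.update_apply] at he
    split_ifs at he h0 with ha hb hb
    · rw [ha, hb]
    · exact absurd he (key y' hy' hyq' hb)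
    · exact absurd he.symm (key y hy hyq ha)
    · exact hF.inj y hy ha y' hy' hb he h0
  · intro l hl hT
    obtain ⟨y, hy, hyx, he⟩ := hF.cover l hl hT
    by_cases hyq : y = qx q
    · subst hyq
      exact ⟨x, hF.lt, h5.symm, by rw [Function.update_self]; omega⟩
    · exact ⟨y, hy, hyq, by rw [Function.update_of_ne hyx, he]⟩
  · intro i hi hiq
    obtain ⟨h8, h9⟩ := hF.anc i hi (by omega)
    refine ⟨fun he => ?_, by rw [Function.update_of_ne h8, h9]⟩
    have := h.inj i hi (by omega) q hq hqt he
    omega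

/-- The entry `0` is the left vertex that was not matched before, so the augmentation ends there. -/
theorem Flip.finish {mr' : ℕ → ℕ} {x : ℕ} (hF : Flip m E T R r ql qx mr' x 0) (h0 : ql 0 = r)
    (hr : T r) : Matching m E T R (r + 1) (Function.update mr' x (r + 1)) := by
  have harc := hF.arc
  rw [h0] at harc
  refine ⟨?_, ?_, ?_⟩
  · intro y hy l hl
    rw [Function.update_apply] at hl
    split_ifs at hl with hyx
    · have : r = l := by omega
      subst this
      exact ⟨hr, by omega, hyx ▸ hF.right, hyx ▸ harc⟩
    · obtain ⟨h1, h2, h3⟩ := hF.valid y hy hyx l hl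
      exact ⟨h1, by omega, h3⟩
  · have key : ∀ y < m, y ≠ x → r + 1 ≠ mr' y := fun y hy hyx he => by
      have := (hF.valid y hy hyx r he.symm).2.1
      omega
    intro y hy y' hy' he hne
    rw [Function.update_apply] at he hne
    rw [Function.update_apply] at he
    split_ifs at he hne with ha hb hb
    · rw [ha, hb]
    · exact absurd he (key y' hy' hb)
    · exact absurd he.symm (key y hy ha)
    · exact hF.inj y hy ha y' hy' hb he hne
  · intro l hl hT
    rcases Nat.lt_succ_iff_lt_or_eq.1 hl with hl | rfl
    · obtain ⟨y, hy, hyx, he⟩ := hF.cover l hl hT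
      exact ⟨y, hy, by rw [Function.update_of_ne hyx, he]⟩
    · exact ⟨x, hF.lt, by rw [Function.update_self]⟩

theorem Matching.succ (h : Matching m E T R k mr) (hk : ¬ T k) : Matching m E T R (k + 1) mr := by
  refine ⟨fun x hx l hl => ?_, h.inj, fun l hl hT => ?_⟩
  · obtain ⟨h1, h2, h3⟩ := h.valid x hx l hl
    exact ⟨h1, by omega, h3⟩
  · rcases Nat.lt_succ_iff_lt_or_eq.1 hl with hl | rfl
    · exact h.cover l hl hT
    · exact absurd hT hk

theorem Matching.minOver {Y B : Finset ℕ} (h : Matching m E T R m mr) (hYB : Y ⊆ B)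
    (hBm : B ⊆ Finset.range m) (hT : ∀ l, T l ↔ l ∈ B ∧ l ∉ Y)
    (hR : ∀ x, R x ↔ x ∈ B ∧ x ∉ boundary (Finset.range m) E B) :
    MinOver (Finset.range m) E Y B := by
  have h1 : ∀ l, ∃ x, T l → x < m ∧ mr x = l + 1 := by
    intro l
    by_cases hl : T l
    · obtain ⟨x, hx, he⟩ := h.cover l (Finset.mem_range.1 (hBm ((hT l).1 hl).1)) hl
      exact ⟨x, fun _ => ⟨hx, he⟩⟩
    · exact ⟨0, fun h => absurd h hl⟩
  choose f hf using h1
  refine MinOver.of_matching hBm hYB f ?_ ?_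
  · intro l hl hlY
    obtain ⟨h2, h3⟩ := hf l ((hT l).2 ⟨hl, hlY⟩)
    obtain ⟨-, -, h4, h5⟩ := h.valid _ h2 _ h3
    exact ⟨((hR _).1 h4).1, ((hR _).1 h4).2, h5⟩
  · intro l hl hlY l' hl' hlY' he
    have h2 := (hf l ((hT l).2 ⟨hl, hlY⟩)).2
    have h3 := (hf l' ((hT l').2 ⟨hl', hlY'⟩)).2
    rw [he, h3] at h2
    omega

end Matching

/-! ### Computing a set with fewest boundary vertices -/

/-- The register for the left vertex that is to be matched. -/
notation "rRoot" => 30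
/-- The register for the length of the queue. -/
notation "rTail" => 31
/-- The register for the queue entry under consideration. -/
notation "rHead" => 32
/-- The register for the free right vertex found, increased by one. -/
notation "rFx" => 33
/-- The register for the queue entry from which the free vertex was reached. -/
notation "rFq" => 34
notation "rL" => 35
/-- The register that tells whether some left vertex could not be matched. -/
notation "rFail" => 36

/-- The array of the partners of the right vertices, increased by one. -/
notation "aMatch" => 12
/-- The array of the marks of the visited right vertices. -/
notation "aVis" => 13
/-- The array of the left vertices in the queue. -/
notation "aQl" => 14
/-- The array of the right vertices through which the queue entries were reached. -/
notation "aQx" => 15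
/-- The array of the predecessors of the queue entries. -/
notation "aQp" => 16
/-- The array of the addresses of the rows of the arc array. -/
notation "aRow" => 17
/-- The array of the marks of the vertices to be removed. -/
notation "aRem" => 18

namespace Prog

/-- Considers the right vertex `rI` for the queue entry `rHead`, whose row in the arc array starts
at `rRow`. -/
def scanVertex : Prog :=
  .add rA rRow rI ;; .load rA aAdj rA ;; .add rX rCid rI ;; .load rX aSet rX ;;
  .load rY aBd rI ;; .load rF aVis rI ;; .load rL aMatch rI ;;
  .cond (.eq rA rOne)
    (.cond (.eq rX rOne)
      (.cond (.eq rY rZero)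
        (.cond (.eq rF rOne) .skip
          (.store aVis rI rOne ;;
            .cond (.eq rL rZero)
              (.add rFx rI rOne ;; .copy rFq rHead)
              (.sub rL rL rOne ;; .store aQl rTail rL ;; .store aQx rTail rI ;;
                .store aQp rTail rHead ;; .add rTail rTail rOne)))
        .skip)
      .skip)
    .skip

/-- Processes the queue of the breadth-first search. -/
def searchLoop : Prog :=
  .loop (.lt rHead rTail)
    (.load rL aQl rHead ;; .load rRow aRow rL ;; .const rI 0 ;;
      .forLoop rI rM scanVertex ;; .add rHead rHead rOne)

/-- Breadth-first search for an augmenting path from the left vertex `rRoot`. -/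
def searchPath : Prog :=
  .const rI 0 ;; .forLoop rI rM (.store aVis rI rZero) ;;
  .const rTail 1 ;; .const rHead 0 ;; .const rFx 0 ;; .const rFq 0 ;; .store aQl rHead rRoot ;;
  searchLoop

/-- Augments the matching along the path found by the search. -/
def flipPath : Prog :=
  .sub rX rFx rOne ;; .copy rJ rFq ;; .const rT 1 ;;
  .loop (.eq rT rOne)
    (.load rL aQl rJ ;; .add rL rL rOne ;; .store aMatch rX rL ;;
      .cond (.eq rJ rZero) (.const rT 0) (.load rX aQx rJ ;; .load rJ aQp rJ))

/-- Prepares the search for augmenting paths. -/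
def initMatch : Prog :=
  .const rRow 0 ;; .const rI 0 ;;
  .forLoop rI rM
    (.store aMatch rI rZero ;; .store aRem rI rZero ;; .store aRow rI rRow ;; .add rRow rRow rM)

/-- Marks the left vertices in the queue. -/
def markQueue : Prog :=
  .const rI 0 ;; .forLoop rI rTail (.load rL aQl rI ;; .store aRem rL rOne)

/-- Matches the left vertex `rRoot`, or else marks a set of left vertices whose removal decreases
the number of boundary vertices. -/
def matchVertex : Prog :=
  .cond (.eq rFail rZero)
    (.add rX rCid rRoot ;; .load rX aSet rX ;; .add rY rCb rRoot ;; .load rY aSet rY ;;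
      .cond (.lt rY rX)
        (searchPath ;;
          .cond (.eq rFx rZero) (.const rFail 1 ;; markQueue) flipPath)
        .skip)
    .skip

/-- Writes the set at `rCid` without the marked vertices to the set at `rCb`. -/
def copyUnmarked : Prog :=
  .const rI 0 ;;
  .forLoop rI rM
    (.add rX rCid rI ;; .load rX aSet rX ;; .load rY aRem rI ;; .sub rX rX rY ;;
      .add rA rCb rI ;; .store aSet rA rX)

/-- Replaces the set at `rCb` by a set with fewest boundary vertices between it and the set at
`rCid`, whose boundary has been computed. The number of boundary vertices decreases by at most
one. -/
def minimize : Prog :=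
  initMatch ;; .const rFail 0 ;; .const rRoot 0 ;; .forLoop rRoot rM matchVertex ;;
  copyUnmarked ;; .sub rBd rBd rFail

end Prog

section

variable {m w : ℕ} {E : ℕ → ℕ → Prop}

/-- The right vertices of the matching problem for the set `B`. -/
def Right (m : ℕ) (E : ℕ → ℕ → Prop) (B : Finset ℕ) (x : ℕ) : Prop :=
  x ∈ B ∧ x ∉ boundary (Finset.range m) E B

/-- The queue entries before `q` have been considered, and for the entry `q` the vertices before
`x`. -/
def Scanned (q x i y : ℕ) : Prop := i < q ∨ i = q ∧ y < x

/-- The breadth-first search that is described by the store. -/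
def BfsAt (m : ℕ) (E : ℕ → ℕ → Prop) (B : Finset ℕ) (r : ℕ) (s : Store) (q x : ℕ) : Prop :=
  Bfs m E (Right m E B) (s.arr aMatch) r (s.arr aQl) (s.arr aQx) (s.arr aQp) (s.arr aVis)
    (s.reg rTail) (s.reg rFx) (s.reg rFq) (Scanned q x)

/-- What the search for augmenting paths uses: the sets `B` and `Y`, the boundary of `B`, and the
rows of the arc array. -/
structure MatchCtx (m w : ℕ) (E : ℕ → ℕ → Prop) (B Y : Finset ℕ) (s : Store) : Prop
    extends Ctx m w E s where
  setB : HasSet m (s.arr aSet) (s.reg rCid) B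
  setY : HasSet m (s.arr aSet) (s.reg rCb) Y
  bdB : ∀ u < m, s.arr aBd u = ind (u ∈ boundary (Finset.range m) E B)
  row : ∀ u < m, s.arr aRow u = u * m

variable {B Y : Finset ℕ} {r : ℕ}

theorem MatchCtx.same {P : Prog} {s s' : Store} (h : MatchCtx m w E B Y s) (hs : Same P s s')
    (hw : (P.wr rOne || P.wr rZero || P.wr rM || P.wr rW || P.wa aAdj) = false)
    (hw' : (P.wr rCid || P.wr rCb || P.wa aSet || P.wa aBd || P.wa aRow) = false) :
    MatchCtx m w E B Y s' := by
  simp only [Bool.or_eq_false_iff] at hw'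
  obtain ⟨⟨⟨⟨h1, h2⟩, h3⟩, h4⟩, h5⟩ := hw'
  exact { h.toCtx.same hs hw with
    setB := by rw [hs.reg _ h1, hs.arr _ h3]; exact h.setB
    setY := by rw [hs.reg _ h2, hs.arr _ h3]; exact h.setY
    bdB := by rw [hs.arr _ h4]; exact h.bdB
    row := by rw [hs.arr _ h5]; exact h.row }

theorem MatchCtx.setReg {s : Store} (h : MatchCtx m w E B Y s) {x v : ℕ} (hx : rBd ≤ x) :
    MatchCtx m w E B Y (s.setReg x v) :=
  { h.toCtx.setReg (x := x) (v := v) (by omega) with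
    setB := by rw [Store.setReg_reg, if_neg (by omega)]; exact h.setB
    setY := by rw [Store.setReg_reg, if_neg (by omega)]; exact h.setY
    bdB := h.bdB
    row := h.row }

theorem MatchCtx.setArr {s : Store} (h : MatchCtx m w E B Y s) {a i v : ℕ} (ha : aBd < a)
    (ha' : a ≠ aRow) : MatchCtx m w E B Y (s.setArr a i v) :=
  { h.toCtx.setArr (a := a) (i := i) (v := v) (by omega) with
    setB := by rw [Store.setArr_arr, if_neg (by omega)]; exact h.setB
    setY := by rw [Store.setArr_arr, if_neg (by omega)]; exact h.setY
    bdB := by rw [Store.setArr_arr, if_neg (by omega)]; exact h.bdB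
    row := by rw [Store.setArr_arr, if_neg (Ne.symm ha')]; exact h.row }

theorem scanVertex_runs {s : Store} (hc : MatchCtx m w E B Y s) {x : ℕ} (hx : s.reg rI = x)
    (hxm : x < m) (hq : s.reg rHead < s.reg rTail) (hl : s.arr aQl (s.reg rHead) < m)
    (hrow : s.reg rRow = s.arr aQl (s.reg rHead) * m) (h : BfsAt m E B r s (s.reg rHead) x) :
    Runs .scanVertex s fun t s' => t ≤ 20 ∧ BfsAt m E B r s' (s.reg rHead) (x + 1) ∧
      s.reg rTail ≤ s'.reg rTail ∧
      s'.arr aQl (s.reg rHead) = s.arr aQl (s.reg rHead) := by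
  have hscan : ¬ (E (s.arr aQl (s.reg rHead)) x ∧ Right m E B x ∧ s.arr aVis x ≠ 1) →
      BfsAt m E B r s (s.reg rHead) (x + 1) := by
    intro hno
    refine Bfs.scanned h fun i y h1 h2 h3 h4 h5 => ?_
    unfold Scanned at h1 ⊢
    by_cases hi : i = s.reg rHead ∧ y = x
    · obtain ⟨rfl, rfl⟩ := hi
      right
      by_contra h6
      exact hno ⟨h5, h4, h6⟩
    · left; omega
  have hSc : ∀ i y, Scanned (s.reg rHead) (x + 1) i y → Scanned (s.reg rHead) x i y ∨ y = x := by
    unfold Scanned; intro i y h1; omega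
  have hlt : ∀ i y, Scanned (s.reg rHead) (x + 1) i y → i < s.reg rTail := by
    unfold Scanned; intro i y h1; omega
  unfold Prog.scanVertex
  simp [-Order.lt_add_one_iff, hx, hrow, hc.adj x hxm _ hl, hc.setB x hxm, hc.bdB x hxm, hc.one,
    hc.zero, ind_eq_one, ind_eq_zero]
  refine ⟨fun hE => ⟨fun hB => ⟨fun hb => ⟨fun hv => ?_, fun hv => ⟨fun hm => ?_, fun hm => ?_⟩⟩,
    fun hb => ?_⟩, fun hB => ?_⟩, fun hE => ?_⟩
  · exact hscan fun hno => hno.2.2 hv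
  · exact Bfs.free h hxm ⟨hB, hb⟩ hq hE hm hSc
  · have := Bfs.enqueue h hxm ⟨hB, hb⟩ hq hE (l := s.arr aMatch x - 1) (by omega) hv hlt hSc
    exact ⟨by simpa [BfsAt] using this, by rw [Function.update_of_ne (by omega)]⟩
  · exact hscan fun hno => hno.2.1.2 hb
  · exact hscan fun hno => hB hno.2.1.1
  · exact hscan fun hno => hE hno.1

theorem searchLoop_runs {s : Store} (hc : MatchCtx m w E B Y s) {T : ℕ → Prop}
    (hTr : T r) (hT : ∀ l, T l → l < m)
    (hM : Matching m E T (Right m E B) r (s.arr aMatch)) (hh : s.reg rHead = 0)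
    (hb : BfsAt m E B r s 0 0) :
    Runs .searchLoop s fun t s' => t ≤ (m + 1) * (m * 22 + 6) + 1 ∧
      BfsAt m E B r s' (s'.reg rTail) 0 := by
  unfold Prog.searchLoop
  refine (Runs.loop (I := fun τ s1 => BfsAt m E B r s1 (s1.reg rHead) 0 ∧
    s1.reg rHead ≤ s1.reg rTail ∧ τ = (m + 1 - s1.reg rHead) * (m * 22 + 6)) ⟨by rwa [hh],
      by omega, rfl⟩ ?_).mono ?_
  · rintro τ s1 ⟨h1, -, rfl⟩ hs hlt
    rw [Test.holds_lt] at hlt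
    have hc1 : MatchCtx m w E B Y s1 := hc.same hs rfl rfl
    have e1 : s1.arr aMatch = s.arr aMatch := hs.arr aMatch rfl
    have hM1 : Matching m E T (Right m E B) r (s1.arr aMatch) := by rwa [e1]
    have hl := hT _ (Bfs.left h1 hM1 hTr hlt)
    simp only [Runs.seq_iff, Runs.const_iff, Runs.load_iff]
    refine (Runs.forLoop (N := m) (C := 20) (fun x s2 => BfsAt m E B r s2 (s1.reg rHead) x ∧
      s1.reg rHead < s2.reg rTail ∧
      s2.arr aQl (s1.reg rHead) = s1.arr aQl (s1.reg rHead)) rfl ?_ ?_ ?_ ?_ ?_).mono ?_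
    · simp [hc1.one]
    · simp [hc1.m_eq]
    · simp
    · simp [BfsAt] at h1 ⊢
      exact ⟨h1, hlt⟩
    · intro x s2 hx hx2 hs2 ⟨h2, h3, h4⟩
      have hc2 : MatchCtx m w E B Y s2 := (((hc1.setReg (by omega)).setReg (by omega)).setReg
        (by omega)).same hs2 rfl rfl
      have e2 : s2.reg rHead = s1.reg rHead := by rw [hs2.reg rHead rfl]; simp
      have e3 : s2.reg rRow = s1.arr aQl (s1.reg rHead) * m := by
        rw [hs2.reg rRow rfl]; simp [hc1.row _ hl]
      refine (scanVertex_runs hc2 hx2 hx (by rwa [e2]) (by rwa [e2, h4]) (by rw [e2, h4, e3])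
        (by rwa [e2])).mono ?_
      rintro t s3 ⟨ht, h5, h6, h7⟩ -
      rw [e2] at h5 h7
      exact ⟨ht, by simpa [BfsAt] using h5, by simp; omega, by simp [h7, h4]⟩
    · rintro t s2 ⟨ht, -, h2, h3, h4⟩ hs2
      have e2 : s2.reg rHead = s1.reg rHead := by rw [hs2.reg rHead rfl]; simp
      have e3 : s2.reg rOne = 1 := by rw [hs2.reg rOne rfl]; simp [hc1.one]
      simp at ht
      have h5 := Bfs.tail_le h1
      obtain ⟨c, hc⟩ := Nat.exists_eq_add_of_lt (show s1.reg rHead < m + 1 by omega)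
      have e4 : m + 1 - s1.reg rHead = c + 1 := by omega
      have e5 : m + 1 - (s1.reg rHead + 1) = c := by omega
      rw [Runs.add_iff, e2, e3]
      refine ⟨(m + 1 - (s1.reg rHead + 1)) * (m * 22 + 6), ⟨?_, ?_, by simp⟩, ?_⟩
      · unfold BfsAt
        simp
        refine Bfs.scanned h2 fun i y hi _ hy _ _ => Or.inl ?_
        unfold Scanned at hi ⊢
        omega
      · simp; omega
      · rw [e4, e5, add_mul]
        omega
  · rintro t s' ⟨hlt, τ', ⟨h1, h2, -⟩, ht⟩ -
    rw [Test.holds_lt] at hlt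
    have e1 : s'.reg rHead = s'.reg rTail := by omega
    rw [e1] at h1
    rw [hh, Nat.sub_zero] at ht
    exact ⟨by omega, h1⟩

theorem searchPath_runs {s : Store} (hc : MatchCtx m w E B Y s) {T : ℕ → Prop}
    (hr : s.reg rRoot = r) (hTr : T r) (hT : ∀ l, T l → l < m)
    (hM : Matching m E T (Right m E B) r (s.arr aMatch)) :
    Runs .searchPath s fun t s' => t ≤ (m + 1) * (m * 22 + 6) + m * 3 + 8 ∧
      BfsAt m E B r s' (s'.reg rTail) 0 := by
  unfold Prog.searchPath
  rw [Runs.seq_iff, Runs.const_iff]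
  refine Runs.seq (Runs.forLoop (N := m) (C := 1) (fun j s1 =>
    ∀ u < j, s1.arr aVis u = 0) rfl ?_ ?_ ?_ ?_ ?_) ?_
  · simp [hc.one]
  · simp [hc.m_eq]
  · simp
  · simp
  · intro j s1 hj hj1 hs h1
    have e1 : s1.reg rZero = 0 := by rw [hs.reg rZero rfl]; simp [hc.zero]
    simp [e1, hj1]
    exact update_prefix h1 rfl
  rintro t0 s0 ⟨ht0, -, h0⟩ hs0
  have hc0 : MatchCtx m w E B Y s0 := (hc.setReg (by omega)).same hs0 rfl rfl
  have e1 : s0.reg rRoot = r := by rw [hs0.reg rRoot rfl]; simp [hr]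
  have e2 : s0.arr aMatch = s.arr aMatch := by rw [hs0.arr aMatch rfl]; simp
  simp at ht0
  simp only [Runs.seq_iff, Runs.const_iff, Runs.store_iff]
  refine (searchLoop_runs (T := T) (r := r) (((((hc0.setReg (by omega)).setReg (by omega)).setReg
    (by omega)).setReg (by omega)).setArr (by omega) (by omega)) hTr hT (by simpa [e2] using hM)
    (by simp) ?_).mono ?_
  · unfold BfsAt
    simp
    refine (Bfs.start ?_ h0).scanned ?_
    · rw [Function.update_self, e1]
    · intro i y h1
      unfold Scanned at h1
      omega
  · rintro t s' ⟨ht, h⟩ -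
    exact ⟨by omega, h⟩

theorem flipPath_runs {s : Store} (hc : MatchCtx m w E B Y s) {T : ℕ → Prop} (hTr : T r)
    (hM : Matching m E T (Right m E B) r (s.arr aMatch)) {q x : ℕ} (hb : BfsAt m E B r s q x)
    (hfx : s.reg rFx ≠ 0) :
    Runs .flipPath s fun t s' => t ≤ (m + 1) * 7 + 4 ∧
      Matching m E T (Right m E B) (r + 1) (s'.arr aMatch) := by
  obtain ⟨hfq, hflip⟩ := Bfs.flip hb hM hfx
  have htail := Bfs.tail_le hb
  unfold Prog.flipPath
  simp only [Runs.seq_iff, Runs.sub_iff, Runs.copy_iff, Runs.const_iff]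
  refine (Runs.loop (τ := (s.reg rFq + 1) * 7) (I := fun τ s1 =>
    (s1.reg rT = 1 ∧ s1.reg rJ < s.reg rTail ∧
      Flip m E T (Right m E B) r (s.arr aQl) (s.arr aQx) (s1.arr aMatch) (s1.reg rX) (s1.reg rJ) ∧
      τ = (s1.reg rJ + 1) * 7) ∨
    (s1.reg rT = 0 ∧ Matching m E T (Right m E B) (r + 1) (s1.arr aMatch) ∧ τ = 0)) ?_ ?_).mono ?_
  · left
    simp [hc.one, hfq, hflip]
  · rintro τ s1 h1 hs hb1
    have hc1 : MatchCtx m w E B Y s1 := (((hc.setReg (by omega)).setReg (by omega)).setReg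
      (by omega)).same hs rfl rfl
    rw [Test.holds_eq, hc1.one] at hb1
    obtain ⟨-, h2, h3, rfl⟩ := h1.resolve_right (by omega)
    have e1 : s1.arr aQl = s.arr aQl := by rw [hs.arr aQl rfl]; simp
    have e2 : s1.arr aQx = s.arr aQx := by rw [hs.arr aQx rfl]; simp
    have e3 : s1.arr aQp = s.arr aQp := by rw [hs.arr aQp rfl]; simp
    simp [e1, e2, e3, hc1.one, hc1.zero]
    constructor
    · intro h4
      rw [h4] at h3 ⊢
      have h5 := Bfs.zero hb
      rw [h5]
      exact ⟨h3.finish h5 hTr, by omega⟩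
    · intro h4
      have h5 := h3.step hb (Nat.pos_of_ne_zero h4) h2
      have h6 := (Bfs.node hb (s1.reg rJ) (Nat.pos_of_ne_zero h4) h2).2.2.2.1
      exact ⟨_, Or.inl ⟨hb1, by omega, h5, rfl⟩, by omega⟩
  · rintro t s' ⟨hb1, τ', h1, ht⟩ hs
    have hc1 : MatchCtx m w E B Y s' := (((hc.setReg (by omega)).setReg (by omega)).setReg
      (by omega)).same hs rfl rfl
    rw [Test.holds_eq, hc1.one] at hb1
    obtain ⟨-, h2, rfl⟩ := h1.resolve_left fun h => hb1 h.1
    exact ⟨by omega, h2⟩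

end

/-! ### Finding the set by matchings -/

section

variable {m w : ℕ} {E : ℕ → ℕ → Prop} {B Y : Finset ℕ}

/-- The left vertices of the matching problem. -/
def Left (B Y : Finset ℕ) (l : ℕ) : Prop := l ∈ B ∧ l ∉ Y

theorem initMatch_runs {s : Store} (hc : Ctx m w E s) (hB : HasSet m (s.arr aSet) (s.reg rCid) B)
    (hY : HasSet m (s.arr aSet) (s.reg rCb) Y)
    (hbd : ∀ u < m, s.arr aBd u = ind (u ∈ boundary (Finset.range m) E B)) :
    Runs .initMatch s fun t s' => t ≤ m * 6 + 3 ∧ MatchCtx m w E B Y s' ∧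
      ∀ u < m, s'.arr aMatch u = 0 ∧ s'.arr aRem u = 0 := by
  unfold Prog.initMatch
  simp only [Runs.seq_iff, Runs.const_iff]
  refine (Runs.forLoop (N := m) (C := 4) (fun j s1 => s1.reg rRow = j * m ∧
    (∀ u < j, s1.arr aMatch u = 0) ∧ (∀ u < j, s1.arr aRem u = 0) ∧
      ∀ u < j, s1.arr aRow u = u * m) rfl ?_ ?_ ?_ ?_ ?_).mono ?_
  · simp [hc.one]
  · simp [hc.m_eq]
  · simp
  · simp
  · intro j s1 hj hj1 hs ⟨h1, h2, h3, h4⟩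
    have hc1 : Ctx m w E s1 := ((hc.setReg (by omega)).setReg (by omega)).same hs rfl
    have e1 : j * m + m = (j + 1) * m := by ring
    simp [hj1, hc1.zero, hc1.m_eq, h1, e1]
    exact ⟨update_prefix h2 rfl, update_prefix h3 rfl,
      update_prefix (g := fun u => u * m) h4 rfl⟩
  · rintro t s' ⟨ht, -, -, h1, h2, h3⟩ hs
    have hc1 : Ctx m w E s' := ((hc.setReg (by omega)).setReg (by omega)).same hs rfl
    have e1 : s'.reg rCid = s.reg rCid := by rw [hs.reg rCid rfl]; simp
    have e2 : s'.reg rCb = s.reg rCb := by rw [hs.reg rCb rfl]; simp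
    have e3 : s'.arr aSet = s.arr aSet := by rw [hs.arr aSet rfl]; simp
    have e4 : s'.arr aBd = s.arr aBd := by rw [hs.arr aBd rfl]; simp
    simp at ht
    exact ⟨by omega, { hc1 with
      setB := by rwa [e1, e3]
      setY := by rwa [e2, e3]
      bdB := by rwa [e4]
      row := h3 }, fun u hu => ⟨h1 u hu, h2 u hu⟩⟩

theorem markQueue_runs {s : Store} (hc : MatchCtx m w E B Y s)
    (hrem : ∀ u < m, s.arr aRem u = 0) :
    Runs .markQueue s fun t s' => t ≤ s.reg rTail * 4 + 2 ∧
      ∀ u < m, s'.arr aRem u = ind (u ∈ (Finset.range (s.reg rTail)).image (s.arr aQl)) := by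
  unfold Prog.markQueue
  simp only [Runs.seq_iff, Runs.const_iff]
  refine (Runs.forLoop (N := s.reg rTail) (C := 2) (fun j s1 => ∀ u < m,
    s1.arr aRem u = ind (u ∈ (Finset.range j).image (s.arr aQl))) rfl ?_ ?_ ?_ ?_ ?_).mono ?_
  · simp [hc.one]
  · simp
  · simp
  · simpa [ind_false] using hrem
  · intro j s1 hj hj1 hs h1
    have hc1 : MatchCtx m w E B Y s1 := (hc.setReg (by omega)).same hs rfl rfl
    have e1 : s1.arr aQl = s.arr aQl := by rw [hs.arr aQl rfl]; simp
    simp [hj1, e1, hc1.one, -Finset.mem_image, Finset.range_add_one, Finset.image_insert]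
    intro u hu
    rw [Function.update_apply, h1 u hu]
    split_ifs with h2
    · exact (ind_true (Or.inl h2)).symm
    · exact ind_congr (by simp [h2])
  · rintro t s' ⟨ht, -, h⟩ -
    simp at ht
    exact ⟨by omega, h⟩

/-- The invariant of the search for a matching: all left vertices below `k` are matched, or a set
has been found whose removal decreases the number of boundary vertices. -/
def MatchInv (m : ℕ) (E : ℕ → ℕ → Prop) (B Y : Finset ℕ) (k : ℕ) (s : Store) : Prop :=
  s.reg rFail = 0 ∧ Matching m E (Left B Y) (Right m E B) k (s.arr aMatch) ∧
      (∀ u < m, s.arr aRem u = 0) ∨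
    s.reg rFail = 1 ∧ ∃ S ⊆ B, (∀ l ∈ S, l ∉ Y) ∧
      bd (Finset.range m) E (B \ S) < bd (Finset.range m) E B ∧ ∀ u < m, s.arr aRem u = ind (u ∈ S)

theorem matchVertex_runs {s : Store} (hc : MatchCtx m w E B Y s) (hBm : B ⊆ Finset.range m)
    (hrefl : ∀ v, E v v) {k : ℕ} (hk : s.reg rRoot = k) (hkm : k < m)
    (h : MatchInv m E B Y k s) :
    Runs .matchVertex s fun t s' => t ≤ (m + 1) * (m * 22 + 13) + m * 7 + 27 ∧
      MatchInv m E B Y (k + 1) s' := by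
  unfold Prog.matchVertex
  rw [Runs.cond_iff]
  constructor
  swap
  · intro h0
    rw [Test.holds_eq, hc.zero] at h0
    rw [Runs.skip_iff]
    exact ⟨by omega, Or.inr (h.resolve_left fun h1 => h0 h1.1)⟩
  intro h0
  rw [Test.holds_eq, hc.zero] at h0
  obtain ⟨-, hM, hrem⟩ := h.resolve_right (by omega)
  have hT : ∀ l, Left B Y l → l < m := fun l hl => Finset.mem_range.1 (hBm hl.1)
  simp [-Runs.seq_iff, -Runs.cond_iff]
  rw [Runs.seq_iff, Runs.add_iff, Runs.seq_iff, Runs.load_iff, Runs.seq_iff, Runs.add_iff,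
    Runs.seq_iff, Runs.load_iff, Runs.cond_iff]
  simp [-Runs.seq_iff, -Runs.cond_iff, hk, hc.setB k hkm, hc.setY k hkm]
  constructor
  · intro hkY hkB
    have hTk : Left B Y k := ⟨hkB, hkY⟩
    refine Runs.seq (searchPath_runs (r := k) (T := Left B Y) ((((hc.setReg (by omega)).setReg
      (by omega)).setReg (by omega)).setReg (by omega)) (by simp [hk]) hTk hT (by simpa using hM)) ?_
    rintro t s1 ⟨ht, hb⟩ hs
    have hc1 : MatchCtx m w E B Y s1 := ((((hc.setReg (by omega)).setReg (by omega)).setReg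
      (by omega)).setReg (by omega)).same hs rfl rfl
    have e1 : s1.arr aMatch = s.arr aMatch := by rw [hs.arr aMatch rfl]; simp
    have e2 : s1.arr aRem = s.arr aRem := by rw [hs.arr aRem rfl]; simp
    have e3 : s1.reg rFail = 0 := by rw [hs.reg rFail rfl]; simp [h0]
    have hM1 : Matching m E (Left B Y) (Right m E B) k (s1.arr aMatch) := by rwa [e1]
    have htail := Bfs.tail_le hb
    have hring : (m + 1) * (m * 22 + 13) = (m + 1) * (m * 22 + 6) + (m * 7 + 7) := by ring
    rw [Runs.cond_iff, Test.holds_eq, hc1.zero]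
    constructor
    · intro hfx
      rw [Runs.seq_iff, Runs.const_iff]
      refine (markQueue_runs (hc1.setReg (by omega)) (by simpa [e2] using hrem)).mono ?_
      rintro t' s2 ⟨ht', h2⟩ hs2
      have e4 : s2.reg rFail = 1 := by rw [hs2.reg rFail rfl]; simp
      simp at ht' h2
      refine ⟨by omega, Or.inr ⟨e4, (Finset.range (s1.reg rTail)).image (s1.arr aQl), ?_, ?_, ?_, ?_⟩⟩
      · intro l hl
        obtain ⟨i, hi, rfl⟩ := Finset.mem_image.1 hl
        exact (Bfs.left hb hM1 hTk (Finset.mem_range.1 hi)).1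
      · intro l hl
        obtain ⟨i, hi, rfl⟩ := Finset.mem_image.1 hl
        exact (Bfs.left hb hM1 hTk (Finset.mem_range.1 hi)).2
      · unfold BfsAt at hb
        rw [hfx] at hb
        exact Bfs.bd_sdiff_lt (Sc := fun i _ => i < s1.reg rTail)
          (hb.scanned fun i x hi _ _ _ _ => Or.inl (Or.inl hi)) hM1 (fun i hi _ => hi) hBm hTk
          (fun l hl => hl.1) (fun x => Iff.rfl) hrefl
      · intro u hu
        rw [h2 u hu]
        exact ind_congr (by simp)
    · intro hfx
      refine (flipPath_runs hc1 hTk hM1 hb hfx).mono ?_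
      rintro t' s2 ⟨ht', h2⟩ hs2
      have e4 : s2.reg rFail = 0 := by rw [hs2.reg rFail rfl, e3]
      have e5 : s2.arr aRem = s.arr aRem := by rw [hs2.arr aRem rfl, e2]
      exact ⟨by omega, Or.inl ⟨e4, h2, by rwa [e5]⟩⟩
  · intro hno
    have h1 : ¬ Left B Y k := fun h1 => hno h1.2 h1.1
    exact Or.inl ⟨by simpa using h0, by simpa using hM.succ h1, by simpa using hrem⟩

theorem copyUnmarked_runs {s : Store} (hc : MatchCtx m w E B Y s) {S : Finset ℕ}
    (hS : ∀ u < m, s.arr aRem u = ind (u ∈ S))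
    (hdisj : ∀ u < m, ∀ u' < m, s.reg rCb + u ≠ s.reg rCid + u') :
    Runs .copyUnmarked s fun t s' => t ≤ m * 8 + 2 ∧
      HasSet m (s'.arr aSet) (s.reg rCb) (B \ S) ∧
      ∀ a, (∀ u < m, a ≠ s.reg rCb + u) → s'.arr aSet a = s.arr aSet a := by
  unfold Prog.copyUnmarked
  simp only [Runs.seq_iff, Runs.const_iff]
  refine (Runs.forLoop (N := m) (C := 6) (fun j s1 =>
    (∀ u < j, s1.arr aSet (s.reg rCb + u) = ind (u ∈ B \ S)) ∧
    ∀ a, (∀ u < m, a ≠ s.reg rCb + u) → s1.arr aSet a = s.arr aSet a) rfl ?_ ?_ ?_ ?_ ?_).mono ?_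
  · simp [hc.one]
  · simp [hc.m_eq]
  · simp
  · simp
  · intro j s1 hj hj1 hs ⟨h1, h2⟩
    have e1 : s1.reg rCid = s.reg rCid := by rw [hs.reg rCid rfl]; simp
    have e2 : s1.reg rCb = s.reg rCb := by rw [hs.reg rCb rfl]; simp
    have e3 : s1.arr aRem = s.arr aRem := by rw [hs.arr aRem rfl]; simp
    have e4 : s1.arr aSet (s.reg rCid + j) = ind (j ∈ B) := by
      rw [h2 _ fun u hu => (hdisj u hu j hj).symm]; exact hc.setB j hj
    simp [-Order.lt_add_one_iff, -ne_eq, e1, e2, e3, e4, hj1, hS j hj]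
    refine ⟨fun u hu => ?_, fun a ha => ?_⟩
    · rcases Nat.lt_succ_iff_lt_or_eq.1 hu with hu | rfl
      · rw [Function.update_of_ne (by omega), h1 u hu]
        exact ind_congr Finset.mem_sdiff
      · rw [Function.update_self]
        by_cases h3 : u ∈ B <;> by_cases h4 : u ∈ S <;> simp [ind, h3, h4]
    · rw [Function.update_of_ne (ha j hj), h2 a ha]
  · rintro t s' ⟨ht, -, h1, h2⟩ -
    simp at ht
    exact ⟨by omega, h1, h2⟩

/-- The set written to `rCb` has fewest boundary vertices between `Y` and `B`. Because of the
hypothesis `hle` it is enough to decrease the number of boundary vertices once: the first left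
vertex that cannot be matched decides. -/
theorem minimize_runs {s : Store} (hc : Ctx m w E s) (hB : HasSet m (s.arr aSet) (s.reg rCid) B)
    (hY : HasSet m (s.arr aSet) (s.reg rCb) Y)
    (hbd : ∀ u < m, s.arr aBd u = ind (u ∈ boundary (Finset.range m) E B))
    (hnum : s.reg rBd = bd (Finset.range m) E B)
    (hBm : B ⊆ Finset.range m) (hYB : Y ⊆ B) (hrefl : ∀ v, E v v)
    (hle : ∀ U, Y ⊆ U → U ⊆ B → bd (Finset.range m) E B ≤ bd (Finset.range m) E U + 1)
    (hdisj : ∀ u < m, ∀ u' < m, s.reg rCb + u ≠ s.reg rCid + u') :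
    Runs .minimize s fun t s' =>
      t ≤ m * ((m + 1) * (m * 22 + 13) + m * 7 + 29) + m * 14 + 9 ∧
      ∃ W, Y ⊆ W ∧ W ⊆ B ∧
        (∀ U, Y ⊆ U → U ⊆ B → bd (Finset.range m) E W ≤ bd (Finset.range m) E U) ∧
        (W = B ∨ bd (Finset.range m) E W < bd (Finset.range m) E B) ∧
        s'.reg rBd = bd (Finset.range m) E W ∧ HasSet m (s'.arr aSet) (s.reg rCb) W ∧
        ∀ a, (∀ u < m, a ≠ s.reg rCb + u) → s'.arr aSet a = s.arr aSet a := by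
  unfold Prog.minimize
  refine Runs.seq (initMatch_runs hc hB hY hbd) ?_
  rintro t1 s1 ⟨ht1, hc1, h1⟩ hs1
  rw [Runs.seq_iff, Runs.const_iff, Runs.seq_iff, Runs.const_iff]
  refine Runs.seq (Runs.forLoop (N := m) (C := (m + 1) * (m * 22 + 13) + m * 7 + 27)
    (fun k s2 => MatchInv m E B Y k s2) rfl ?_ ?_ ?_ ?_ ?_) ?_
  · simp [hc1.one]
  · simp [hc1.m_eq]
  · simp
  · left
    simp
    refine ⟨⟨fun x hx l hl => ?_, fun x hx y _ _ h0 => ?_, fun l hl => ?_⟩, fun u hu => (h1 u hu).2⟩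
    · rw [(h1 x hx).1] at hl; omega
    · exact absurd (h1 x hx).1 h0
    · omega
  · intro k s2 hk hk2 hs2 h2
    have hc2 : MatchCtx m w E B Y s2 := ((hc1.setReg (by omega)).setReg (by omega)).same hs2 rfl rfl
    refine (matchVertex_runs hc2 hBm hrefl hk2 hk h2).mono ?_
    rintro t s3 ⟨ht, h3⟩ -
    exact ⟨ht, by simpa [MatchInv] using h3⟩
  · rintro t2 s2 ⟨ht2, -, h2⟩ hs2
    have hc2 : MatchCtx m w E B Y s2 := ((hc1.setReg (by omega)).setReg (by omega)).same hs2 rfl rfl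
    have e1 : s2.reg rCb = s.reg rCb := by rw [hs2.reg rCb rfl]; simp [hs1.reg rCb rfl]
    have e2 : s2.reg rCid = s.reg rCid := by rw [hs2.reg rCid rfl]; simp [hs1.reg rCid rfl]
    have e3 : s2.reg rBd = s.reg rBd := by rw [hs2.reg rBd rfl]; simp [hs1.reg rBd rfl]
    have e4 : s2.arr aSet = s.arr aSet := by rw [hs2.arr aSet rfl]; simp [hs1.arr aSet rfl]
    obtain ⟨S, hSB, hSY, hS, hmin, hfail, hne⟩ : ∃ S ⊆ B, (∀ l ∈ S, l ∉ Y) ∧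
        (∀ u < m, s2.arr aRem u = ind (u ∈ S)) ∧
        (∀ U, Y ⊆ U → U ⊆ B → bd (Finset.range m) E (B \ S) ≤ bd (Finset.range m) E U) ∧
        bd (Finset.range m) E B - s2.reg rFail = bd (Finset.range m) E (B \ S) ∧
        (B \ S = B ∨ bd (Finset.range m) E (B \ S) < bd (Finset.range m) E B) := by
      rcases h2 with ⟨h3, h4, h5⟩ | ⟨h3, S, h4, h5, h6, h7⟩
      · refine ⟨∅, by simp, by simp, fun u hu => by rw [h5 u hu, ind_false (by simp)], ?_, ?_,
          Or.inl Finset.sdiff_empty⟩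
        · rw [Finset.sdiff_empty]
          exact (h4.minOver hYB hBm (fun _ => Iff.rfl) (fun _ => Iff.rfl)).2
        · rw [Finset.sdiff_empty, h3, Nat.sub_zero]
      · refine ⟨S, h4, h5, h7, fun U hU hU' => ?_, ?_, Or.inr h6⟩
        · have := hle U hU hU'
          omega
        · have := hle (B \ S) (fun y hy => Finset.mem_sdiff.2 ⟨hYB hy, fun h => h5 y h hy⟩)
            Finset.sdiff_subset
          omega
    refine Runs.seq (copyUnmarked_runs hc2 hS (by rwa [e1, e2])) ?_
    rintro t3 s3 ⟨ht3, h3, h4⟩ hs3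
    rw [e1] at h3 h4
    rw [e4] at h4
    have e5 : s3.reg rBd = bd (Finset.range m) E B := by rw [hs3.reg rBd rfl, e3, hnum]
    have e6 : s3.reg rFail = s2.reg rFail := hs3.reg rFail rfl
    rw [Runs.sub_iff]
    simp [add_assoc] at ht2
    simp only [add_assoc] at ht2 ⊢
    refine ⟨by omega, B \ S, fun y hy => Finset.mem_sdiff.2 ⟨hYB hy, fun h => hSY y h hy⟩,
      Finset.sdiff_subset, hmin, hne, ?_, h3, h4⟩
    simp [e5, e6, hfail]

end

/-! ### Addresses of the nodes of the search tree -/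

/-- The address of the set of a node: `m` times the number with the digits `x + 1`, for the letters
`x` of the node, in base `m + 1`. -/
def code (m : ℕ) : List ℕ → ℕ
  | [] => 0
  | x :: t => code m t + (x + 1) * (m * (m + 1) ^ t.length)

section Code

variable {m : ℕ}

theorem exists_code_eq (s : List ℕ) (hs : ∀ x ∈ s, x < m) : ∃ c, code m s = m * c ∧
    c < (m + 1) ^ s.length ∧ ∀ j, s.length = j + 1 → (m + 1) ^ j ≤ c := by
  induction s with
  | nil => exact ⟨0, by simp [code], by simp, fun j hj => by simp at hj⟩
  | cons x t ih =>
    obtain ⟨c, h1, h2, -⟩ := ih fun y hy => hs y (List.mem_cons_of_mem _ hy)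
    refine ⟨c + (x + 1) * (m + 1) ^ t.length, by rw [code, h1]; ring, ?_, ?_⟩
    · have h3 : (x + 1) * (m + 1) ^ t.length ≤ m * (m + 1) ^ t.length :=
        Nat.mul_le_mul_right _ (hs x (by simp))
      have h4 : (m + 1) ^ (t.length + 1) = m * (m + 1) ^ t.length + (m + 1) ^ t.length := by ring
      rw [List.length_cons, h4]
      omega
    · intro j hj
      simp only [List.length_cons, Nat.add_right_cancel_iff] at hj
      rw [← hj]
      have : (m + 1) ^ t.length ≤ (x + 1) * (m + 1) ^ t.length := Nat.le_mul_of_pos_left _ (by omega)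
      omega

theorem code_length_le (hm : 0 < m) {s t : List ℕ} (hs : ∀ x ∈ s, x < m) (ht : ∀ x ∈ t, x < m)
    (h : code m s = code m t) : s.length ≤ t.length := by
  by_contra hlt
  obtain ⟨c, h1, -, h2⟩ := exists_code_eq s hs
  obtain ⟨d, h3, h4, -⟩ := exists_code_eq t ht
  have h5 : c = d := Nat.eq_of_mul_eq_mul_left hm (by omega)
  have h6 := h2 (s.length - 1) (by omega)
  have h7 : (m + 1) ^ t.length ≤ (m + 1) ^ (s.length - 1) :=
    Nat.pow_le_pow_right (by omega) (by omega)
  omega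

theorem code_injective (hm : 0 < m) {s t : List ℕ} (hs : ∀ x ∈ s, x < m) (ht : ∀ x ∈ t, x < m)
    (h : code m s = code m t) : s = t := by
  induction s generalizing t with
  | nil =>
    have := code_length_le hm ht hs h.symm
    exact (List.length_eq_zero_iff.1 (Nat.le_zero.1 this)).symm
  | cons x s ih =>
    cases t with
    | nil => exact absurd (code_length_le hm hs ht h) (by simp)
    | cons y t =>
      have hlen : s.length = t.length := by
        have h1 := code_length_le hm hs ht h
        have h2 := code_length_le hm ht hs h.symm
        simp only [List.length_cons] at h1 h2
        omega
      have hs' : ∀ z ∈ s, z < m := fun z hz => hs z (List.mem_cons_of_mem _ hz)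
      have ht' : ∀ z ∈ t, z < m := fun z hz => ht z (List.mem_cons_of_mem _ hz)
      obtain ⟨c, h1, h2, -⟩ := exists_code_eq s hs'
      obtain ⟨d, h3, h4, -⟩ := exists_code_eq t ht'
      have h5 : c + (m + 1) ^ s.length * (x + 1) = d + (m + 1) ^ s.length * (y + 1) := by
        refine Nat.eq_of_mul_eq_mul_left hm ?_
        rw [code, code, h1, h3, ← hlen] at h
        linarith
      rw [← hlen] at h4
      have h6 : c = d := by
        have := congrArg (· % (m + 1) ^ s.length) h5
        simpa [Nat.mod_eq_of_lt h2, Nat.mod_eq_of_lt h4] using this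
      have h7 : x = y := by
        have h8 : (m + 1) ^ s.length * (x + 1) = (m + 1) ^ s.length * (y + 1) := by omega
        have := Nat.eq_of_mul_eq_mul_left (by positivity) h8
        omega
      rw [h7, ih hs' ht' (by rw [h1, h3, h6])]

theorem code_add_ne (hm : 0 < m) {s t : List ℕ} (hs : ∀ x ∈ s, x < m) (ht : ∀ x ∈ t, x < m)
    (hst : s ≠ t) {u u' : ℕ} (hu : u < m) (hu' : u' < m) : code m s + u ≠ code m t + u' := by
  intro h
  obtain ⟨c, h1, -⟩ := exists_code_eq s hs
  obtain ⟨d, h2, -⟩ := exists_code_eq t ht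
  rw [h1, h2] at h
  have h3 : c = d := by
    have := congrArg (· / m) h
    simpa [Nat.mul_add_div hm, Nat.div_eq_of_lt hu, Nat.div_eq_of_lt hu'] using this
  exact hst (code_injective hm hs ht (by rw [h1, h2, h3]))

end Code

/-! ### The search as a program -/

/-- The stack of the addresses of the ancestors of the current node. -/
notation "aStackBase" => 7
/-- The stack of the letters that lead from the ancestors to the current node. -/
notation "aStackV" => 8
/-- The stack of the address increments of the ancestors. -/
notation "aStackPw" => 9

namespace Prog

/-- Returns to the parent of the current node, or ends the search at the root. -/
def popNode : Prog :=
  .cond (.eq rDep rZero) (.const rRun 0)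
    (.sub rDep rDep rOne ;; .copy rCid rCb ;; .load rCb aStackBase rDep ;;
      .load rV aStackV rDep ;; .load rPw aStackPw rDep)

/-- Goes on to the next vertex. -/
def nextVertex : Prog := .add rV rV rOne ;; .add rCid rCid rPw

/-- Goes back to the first vertex. -/
def firstVertex : Prog := .const rV 0 ;; .add rCid rCb rPw

/-- Enters the child at the current vertex. -/
def pushNode : Prog :=
  .store aStackBase rDep rCb ;; .store aStackV rDep rV ;; .store aStackPw rDep rPw ;;
  .add rDep rDep rOne ;; .copy rCb rCid ;; .copy rX rPw ;; .const rI 0 ;;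
  .forLoop rI rM (.add rPw rPw rX) ;; firstVertex

/-- Marks the current node as closed and leaves it. -/
def closeNode : Prog := .store aDone rCb rOne ;; popNode

/-- A step of the search at a leaf. -/
def leafStep : Prog :=
  .copy rBase rCb ;; findVertex ;;
  .cond (.eq rT rZero) closeNode
    (.sub rT rT rOne ;; .add rX rCb rT ;; .store aSet rX rOne ;; firstVertex ;;
      .cond (.lt rNew rDep) popNode .skip)

/-- A step of the search at an inner node, for a vertex outside its set. -/
def branchStep : Prog :=
  extendChild ;; .copy rBase rCid ;; countBoundary ;;
  .cond (.lt rDep rBd)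
    (.load rX aDone rCid ;; .cond (.eq rX rOne) nextVertex pushNode)
    (minimize ;; firstVertex ;; .cond (.lt rBd rDep) popNode .skip)

/-- A step of the search at an inner node. -/
def innerStep : Prog :=
  .cond (.eq rV rM) closeNode
    (.add rX rCb rV ;; .load rX aSet rX ;; .cond (.eq rX rOne) nextVertex branchStep)

/-- The search. -/
def search : Prog := .loop (.eq rRun rOne) (.cond (.eq rDep rW) leafStep innerStep)

end Prog

section

variable {m w : ℕ} {E : ℕ → ℕ → Prop}

/-- The arrays `sa` and `da` hold the sets and the marks of the nodes. -/
structure Table (m : ℕ) (F : List ℕ → Finset ℕ) (dn : List ℕ → Bool) (sa da : ℕ → ℕ) : Prop where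
  set : ∀ s, (∀ x ∈ s, x < m) → HasSet m sa (code m s) (F s)
  mark : ∀ s, (∀ x ∈ s, x < m) → da (code m s) = ind (dn s = true)

/-- The stack arrays hold the address, the letter and the address increment for every proper
ancestor of a node. -/
def Path (m : ℕ) (b v p : ℕ → ℕ) : List ℕ → Prop
  | [] => True
  | x :: t => b t.length = code m t ∧ v t.length = x ∧ p t.length = m * (m + 1) ^ t.length ∧
      Path m b v p t

/-- The registers and the stack represent the current node and the vertex `v`. -/
structure Nav (m : ℕ) (cur : List ℕ) (v : ℕ) (s : Store) : Prop where
  dep : s.reg rDep = cur.length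
  base : s.reg rCb = code m cur
  pw : s.reg rPw = m * (m + 1) ^ cur.length
  vertex : s.reg rV = v
  child : s.reg rCid = code m (v :: cur)
  path : Path m (s.arr aStackBase) (s.arr aStackV) (s.arr aStackPw) cur

/-- The store represents the state of the search. -/
structure Rep (m w : ℕ) (E : ℕ → ℕ → Prop) (st : Search) (s : Store) : Prop
    extends Ctx m w E s, Nav m st.cur st.v s where
  table : Table m st.F st.dn (s.arr aSet) (s.arr aDone)
  run : s.reg rRun = ind (st.run = true)

variable {st : Search} {s : Store}

theorem Table.update_set {F : List ℕ → Finset ℕ} {dn : List ℕ → Bool} {sa sa' da : ℕ → ℕ}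
    (h : Table m F dn sa da) (hm : 0 < m) {t : List ℕ} (ht : ∀ x ∈ t, x < m) {W : Finset ℕ}
    (hW : HasSet m sa' (code m t) W)
    (hne : ∀ a, (∀ u < m, a ≠ code m t + u) → sa' a = sa a) :
    Table m (Function.update F t W) dn sa' da where
  set := fun s hs u hu => by
    rcases eq_or_ne s t with rfl | hst
    · rw [Function.update_self]; exact hW u hu
    · rw [Function.update_of_ne hst, hne _ fun u' hu' => code_add_ne hm hs ht hst hu hu']
      exact h.set s hs u hu
  mark := h.mark

theorem Table.update_mark {F : List ℕ → Finset ℕ} {dn : List ℕ → Bool} {sa da : ℕ → ℕ}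
    (h : Table m F dn sa da) (hm : 0 < m) {t : List ℕ} (ht : ∀ x ∈ t, x < m) {d : Bool} {c : ℕ}
    (hc : c = ind (d = true)) :
    Table m F (Function.update dn t d) sa (Function.update da (code m t) c) where
  set := h.set
  mark := fun s hs => by
    rcases eq_or_ne s t with rfl | hst
    · rw [Function.update_self, Function.update_self, hc]
    · rw [Function.update_of_ne hst, Function.update_of_ne fun h => hst (code_injective hm hs ht h)]
      exact h.mark s hs

theorem Path.congr {b v p b' v' p' : ℕ → ℕ} {s : List ℕ} (h : Path m b v p s)
    (hb : ∀ i < s.length, b' i = b i) (hv : ∀ i < s.length, v' i = v i)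
    (hp : ∀ i < s.length, p' i = p i) : Path m b' v' p' s := by
  induction s with
  | nil => trivial
  | cons x t ih =>
    obtain ⟨h1, h2, h3, h4⟩ := h
    have hl : ∀ i, i < t.length → i < (x :: t).length := fun i hi => by simp; omega
    exact ⟨by rw [hb _ (by simp), h1], by rw [hv _ (by simp), h2], by rw [hp _ (by simp), h3],
      ih h4 (fun i hi => hb i (hl i hi)) (fun i hi => hv i (hl i hi)) fun i hi => hp i (hl i hi)⟩

theorem Nav.same {P : Prog} {s s' : Store} {cur : List ℕ} {v : ℕ} (h : Nav m cur v s)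
    (hs : Same P s s')
    (hw : (P.wr rDep || P.wr rCb || P.wr rPw || P.wr rV || P.wr rCid) = false)
    (hw' : (P.wa aStackBase || P.wa aStackV || P.wa aStackPw) = false) : Nav m cur v s' := by
  simp only [Bool.or_eq_false_iff] at hw hw'
  obtain ⟨⟨⟨⟨h1, h2⟩, h3⟩, h4⟩, h5⟩ := hw
  obtain ⟨⟨h6, h7⟩, h8⟩ := hw'
  exact ⟨by rw [hs.reg _ h1, h.dep], by rw [hs.reg _ h2, h.base], by rw [hs.reg _ h3, h.pw],
    by rw [hs.reg _ h4, h.vertex], by rw [hs.reg _ h5, h.child],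
    by rw [hs.arr _ h6, hs.arr _ h7, hs.arr _ h8]; exact h.path⟩

theorem popNode_runs (h : Rep m w E st s) :
    Runs .popNode s fun t s' => t ≤ 6 ∧ Rep m w E st.pop s' := by
  unfold Prog.popNode
  obtain ⟨F, dn, cur, v, run⟩ := st
  have h1 := h.dep
  have h2 := h.base
  have h3 := h.path
  cases cur with
  | nil =>
    simp at h1
    simp [h1, h.zero]
    exact { (h.toCtx.setReg (x := rRun) (v := 0) (by omega)) with
      dep := by simp [Search.pop, h1]
      base := by simp [Search.pop, h.base]
      pw := by simp [Search.pop, h.pw]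
      vertex := by simp [Search.pop, h.vertex]
      child := by simp [Search.pop, h.child]
      path := trivial
      table := h.table
      run := by simp [Search.pop, ind_false] }
  | cons x t =>
    obtain ⟨h4, h5, h6, h7⟩ := h3
    simp at h1 h2
    simp [h1, h2, h.zero, h.one, h4, h5, h6]
    exact { (((((h.toCtx.setReg (x := rDep) (v := t.length) (by omega)).setReg (x := rCid)
        (v := code m (x :: t)) (by omega)).setReg (x := rCb) (v := code m t) (by omega)).setReg
        (x := rV) (v := x) (by omega)).setReg (x := rPw) (v := m * (m + 1) ^ t.length)
        (by omega)) with
      dep := by simp [Search.pop]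
      base := by simp [Search.pop]
      pw := by simp [Search.pop]
      vertex := by simp [Search.pop]
      child := by simp [Search.pop]
      path := h7
      table := h.table
      run := by simp [Search.pop, h.run] }

theorem nextVertex_runs (h : Rep m w E st s) :
    Runs .nextVertex s fun t s' => t ≤ 2 ∧ Rep m w E st.advance s' := by
  unfold Prog.nextVertex
  simp
  exact { ((h.toCtx.setReg (x := rV) (v := _) (by omega)).setReg (x := rCid) (v := _)
      (by omega)) with
    dep := by simp [Search.advance, h.dep]
    base := by simp [Search.advance, h.base]
    pw := by simp [Search.advance, h.pw]
    vertex := by simp [Search.advance, h.vertex, h.one]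
    child := by simp [Search.advance, h.child, h.pw, code]; ring
    path := h.path
    table := h.table
    run := by simp [Search.advance, h.run] }

/-- Going back to the first vertex after a change of the set of the current node. -/
theorem firstVertex_runs {cur : List ℕ} (hc : Ctx m w E s)
    (hdep : s.reg rDep = cur.length) (hbase : s.reg rCb = code m cur)
    (hpw : s.reg rPw = m * (m + 1) ^ cur.length)
    (hpath : Path m (s.arr aStackBase) (s.arr aStackV) (s.arr aStackPw) cur)
    {F : List ℕ → Finset ℕ} {dn : List ℕ → Bool}
    (ht : Table m F dn (s.arr aSet) (s.arr aDone)) {run : Bool}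
    (hrun : s.reg rRun = ind (run = true)) :
    Runs .firstVertex s fun t s' => t ≤ 2 ∧ Rep m w E ⟨F, dn, cur, 0, run⟩ s' := by
  unfold Prog.firstVertex
  simp
  exact { ((hc.setReg (x := rV) (v := 0) (by omega)).setReg (x := rCid) (v := _) (by omega)) with
    dep := by simp [hdep]
    base := by simp [hbase]
    pw := by simp [hpw]
    vertex := by simp
    child := by simp [hbase, hpw, code]
    path := hpath
    table := ht
    run := by simp [hrun] }

theorem pushNode_runs (h : Rep m w E st s) :
    Runs .pushNode s fun t s' => t ≤ m * 3 + 10 ∧ Rep m w E st.descend s' := by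
  unfold Prog.pushNode
  simp only [Runs.seq_iff, Runs.store_iff, Runs.add_iff, Runs.copy_iff, Runs.const_iff]
  have hdep := h.dep
  have hpath : Path m (Function.update (s.arr aStackBase) st.cur.length (code m st.cur))
      (Function.update (s.arr aStackV) st.cur.length st.v)
      (Function.update (s.arr aStackPw) st.cur.length (m * (m + 1) ^ st.cur.length))
      (st.v :: st.cur) := by
    refine ⟨by simp, by simp, by simp, h.path.congr ?_ ?_ ?_⟩ <;>
      exact fun i hi => Function.update_of_ne (by omega) _ _
  refine (Runs.forLoop (N := m) (C := 1) (fun j s1 =>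
    s1.reg rPw = (j + 1) * (m * (m + 1) ^ st.cur.length)) rfl ?_ ?_ ?_ ?_ ?_).mono ?_
  · simp [h.one]
  · simp [h.m_eq]
  · simp
  · simp [h.pw]
  · intro j s1 hj hj1 hs h1
    have e1 : s1.reg rX = m * (m + 1) ^ st.cur.length := by rw [hs.reg rX rfl]; simp [h.pw]
    simp [h1, e1]
    ring
  · rintro t s1 ⟨ht, -, h1⟩ hs
    simp at ht
    have hc1 : Ctx m w E s1 := (((((((h.toCtx.setArr (by omega)).setArr (by omega)).setArr
      (by omega)).setReg (by omega)).setReg (by omega)).setReg (by omega)).setReg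
      (by omega)).same hs rfl
    have e1 : s1.reg rDep = (st.v :: st.cur).length := by
      rw [hs.reg rDep rfl]; simp [hdep, h.one]
    have e2 : s1.reg rCb = code m (st.v :: st.cur) := by
      rw [hs.reg rCb rfl]; simp [h.child]
    have e3 : s1.reg rPw = m * (m + 1) ^ (st.v :: st.cur).length := by
      rw [h1, List.length_cons]; ring
    have e4 : s1.reg rRun = ind (st.run = true) := by rw [hs.reg rRun rfl]; simp [h.run]
    refine (firstVertex_runs (F := st.F) (dn := st.dn) hc1 e1 e2 e3 ?_ ?_ e4).mono ?_
    · rw [hs.arr aStackBase rfl, hs.arr aStackV rfl, hs.arr aStackPw rfl]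
      simp [hdep, h.base, h.vertex, h.pw]
      exact hpath
    · rw [hs.arr aSet rfl, hs.arr aDone rfl]
      simp
      exact h.table
    · rintro t' s2 ⟨ht', h2⟩ -
      exact ⟨by omega, h2⟩

theorem closeNode_runs (h : Rep m w E st s) (hm : 0 < m) (hcur : ∀ x ∈ st.cur, x < m) :
    Runs .closeNode s fun t s' => t ≤ 7 ∧ Rep m w E st.close.pop s' := by
  unfold Prog.closeNode
  rw [Runs.seq_iff, Runs.store_iff, h.base, h.one]
  refine (popNode_runs (m := m) (w := w) (E := E) (st := st.close) ?_).mono ?_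
  · exact { (h.toCtx.setArr (by omega)) with
      dep := h.dep
      base := h.base
      pw := h.pw
      vertex := h.vertex
      child := h.child
      path := by simpa [Search.close] using h.path
      table := by
        simp [Search.close]
        exact h.table.update_mark hm hcur (by simp [ind_true])
      run := h.run }
  · rintro t s' ⟨ht, h1⟩ -
    exact ⟨by omega, h1⟩

end

/-! ### The running time of the search -/

section

variable {m w : ℕ} {E : ℕ → ℕ → Prop} {st : Search} {s : Store}

theorem Rep.same {P : Prog} {s' : Store} (h : Rep m w E st s) (hs : Same P s s')
    (h1 : (P.wr rOne || P.wr rZero || P.wr rM || P.wr rW || P.wa aAdj) = false)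
    (h2 : (P.wr rDep || P.wr rCb || P.wr rPw || P.wr rV || P.wr rCid) = false)
    (h3 : (P.wa aStackBase || P.wa aStackV || P.wa aStackPw) = false)
    (h4 : (P.wr rRun || P.wa aSet || P.wa aDone) = false) : Rep m w E st s' := by
  simp only [Bool.or_eq_false_iff] at h4
  exact { h.toCtx.same hs h1, h.toNav.same hs h2 h3 with
    table := by rw [hs.arr _ h4.1.2, hs.arr _ h4.2]; exact h.table
    run := by rw [hs.reg _ h4.1.1, h.run] }

theorem Rep.setReg (h : Rep m w E st s) {x v : ℕ} (hx : rRun < x) :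
    Rep m w E st (s.setReg x v) :=
  { h.toCtx.setReg (x := x) (v := v) (by omega) with
    dep := by rw [Store.setReg_reg, if_neg (by omega), h.dep]
    base := by rw [Store.setReg_reg, if_neg (by omega), h.base]
    pw := by rw [Store.setReg_reg, if_neg (by omega), h.pw]
    vertex := by rw [Store.setReg_reg, if_neg (by omega), h.vertex]
    child := by rw [Store.setReg_reg, if_neg (by omega), h.child]
    path := h.path
    table := h.table
    run := by rw [Store.setReg_reg, if_neg (by omega), h.run] }

/-- After the set of the current node has been replaced in the store, the search starts again with
the first vertex of this node, or leaves it if the number of boundary vertices is too small. -/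
theorem restart_runs (h : Ctx m w E s) (hnav : Nav m st.cur st.v s) {W : Finset ℕ} {r : ℕ}
    (hr : rRun < r) (htab : Table m (st.grow W).F st.dn (s.arr aSet) (s.arr aDone))
    (hrun : s.reg rRun = ind (st.run = true)) {Q : Search → Prop}
    (hkeep : ¬ s.reg r < st.cur.length → Q (st.grow W))
    (hpop : s.reg r < st.cur.length → Q (st.grow W).pop) :
    Runs (.firstVertex ;; .cond (.lt r rDep) .popNode .skip) s fun t s' =>
      t ≤ 9 ∧ ∃ st', Q st' ∧ Rep m w E st' s' := by
  refine Runs.seq (firstVertex_runs h hnav.dep hnav.base hnav.pw hnav.path htab hrun) ?_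
  rintro t s1 ⟨ht, h1⟩ hs1
  have e1 : s1.reg r = s.reg r := by
    refine hs1.reg r ?_
    simp only [Prog.firstVertex, Prog.wr, Bool.or_eq_false_iff]
    constructor <;> rw [← Bool.not_eq_true, Nat.beq_eq] <;> omega
  have e2 : s1.reg rDep = st.cur.length := h1.dep
  rw [Runs.cond_iff, Test.holds_lt, e1, e2]
  refine ⟨fun hlt => ?_, fun hlt => ?_⟩
  · refine (popNode_runs h1).mono ?_
    rintro t' s2 ⟨ht', h2⟩ -
    exact ⟨by omega, _, hpop hlt, h2⟩
  · rw [Runs.skip_iff]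
    exact ⟨by omega, _, hkeep hlt, h1⟩

/-- A step of the search keeps the invariant, and its running time is paid for by the decrease of
the potential. -/
def StepSpec (m w : ℕ) (E : ℕ → ℕ → Prop) (K L : ℕ) (st : Search) (P : Prog) (s : Store) : Prop :=
  Runs P s fun t s' => ∃ st', (st'.Inv m w E ∧
    t + 2 + Search.potential m w K L st' ≤ Search.potential m w K L st) ∧ Rep m w E st' s'

variable {K L : ℕ}

theorem leafStep_runs (h : Rep m w E st s) (hI : st.Inv m w E) (hrun : st.run = true)
    (hm : 0 < m) (hl : st.cur.length = w) (hK : 22 * m ^ 2 + 21 * m + 30 ≤ K) :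
    StepSpec m w E K L st .leafStep s := by
  have hcur := hI.letter
  have hbd := (hI.stack hrun).bd_eq
  have hset := h.table.set _ hcur
  unfold StepSpec Prog.leafStep
  rw [Runs.seq_iff, Runs.copy_iff]
  have hring : m * (m * 8 + 7) + m * (m * 14 + 14) = 22 * m ^ 2 + 21 * m := by ring
  refine Runs.seq (findVertex_runs (h.toCtx.setReg (by omega)) (hI.sub st.cur)
    (by simpa [h.base] using hset)) ?_
  rintro t s1 ⟨ht, h1⟩ hs1
  have hr1 : Rep m w E st s1 := (h.setReg (by omega)).same hs1 rfl rfl rfl rfl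
  rw [Runs.cond_iff, Test.holds_eq, hr1.zero]
  rcases h1 with ⟨h1, h2⟩ | ⟨x, hx, hxF, hxb, h1, h2⟩
  · refine ⟨fun _ => ?_, fun h3 => absurd h1 h3⟩
    refine (closeNode_runs hr1 hm hcur).mono ?_
    rintro t' s2 ⟨ht', h3⟩ -
    have := hI.potential_close (K := K) (L := L) hrun hm
    exact ⟨_, ⟨hI.close_leaf hrun h2, by omega⟩, h3⟩
  · refine ⟨fun h3 => by omega, fun _ => ?_⟩
    have hg := hI.grow_leaf hrun hl hx hxb
    have hsub : insert x (st.F st.cur) ⊆ Finset.range m :=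
      Finset.insert_subset (Finset.mem_range.2 hx) (hI.sub _)
    have hpot := hI.potential_grow (K := K) (L := L) hrun hm hsub (Finset.ssubset_insert hxF)
    rw [if_neg (by omega)] at hpot
    rw [Runs.seq_iff, Runs.sub_iff, Runs.seq_iff, Runs.add_iff, Runs.seq_iff, Runs.store_iff]
    simp [-Runs.seq_iff, h1, hr1.one, hr1.base]
    refine (restart_runs (m := m) (w := w) (E := E) (st := st) (W := insert x (st.F st.cur))
      (Q := fun st' => st'.Inv m w E ∧ Search.potential m w K L st' + K ≤
        Search.potential m w K L st) (((hr1.setReg (x := rT) (by omega)).setReg (x := rX)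
        (by omega)).toCtx.setArr (by omega)) ?_ (by omega) ?_ ?_ ?_ ?_).mono ?_
    · have := ((hr1.setReg (x := rT) (v := x) (by omega)).setReg (x := rX)
        (v := code m st.cur + x) (by omega)).toNav
      exact ⟨this.dep, this.base, this.pw, this.vertex, this.child, by simpa using this.path⟩
    · simp [Search.grow]
      refine hr1.table.update_set hm hcur ?_ ?_
      · intro u hu
        rw [Function.update_apply, hr1.table.set _ hcur u hu]
        split_ifs with h3
        · exact (ind_true (by rw [Finset.mem_insert]; left; omega)).symm
        · refine ind_congr ?_
          rw [Finset.mem_insert]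
          exact ⟨Or.inr, fun h4 => h4.resolve_left fun h5 => h3 (by rw [h5])⟩
      · intro a ha
        exact Function.update_of_ne (ha x hx) _ _
    · simp [hr1.run]
    · intro h3
      simp [h2] at h3
      exact ⟨hg.1 (by omega), hpot.1⟩
    · intro h3
      simp [h2] at h3
      exact ⟨hg.2 (by omega), hpot.2⟩
    · rintro t' s2 ⟨ht', st', ⟨h3, h4⟩, h5⟩ -
      exact ⟨st', ⟨h3, by omega⟩, h5⟩

theorem extendChild_rep (h : Rep m w E st s) (hI : st.Inv m w E) (hm : 0 < m) (hv : st.v < m) :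
    Runs .extendChild s fun t s' => t ≤ m * 12 + 6 ∧ Rep m w E st.refresh s' := by
  have hcur := hI.letter
  have hchild : ∀ x ∈ st.v :: st.cur, x < m := by
    intro x hx
    rcases List.mem_cons.1 hx with rfl | hx
    · exact hv
    · exact hcur x hx
  refine (extendChild_runs h.toCtx (X := st.F (st.v :: st.cur)) (Y := st.F st.cur)
    (by rw [h.child]; exact h.table.set _ hchild) (by rw [h.base]; exact h.table.set _ hcur)
    (hI.sub _) (by rwa [h.vertex]) ?_).mono ?_
  · intro u hu u' hu'
    rw [h.base, h.child]
    exact code_add_ne hm hcur hchild (fun h => by have := congrArg List.length h; simp at this)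
      hu hu'
  · rintro t s' ⟨ht, h1, h2, h3⟩ hs
    rw [h.child, h.vertex] at h1
    rw [h.child] at h2 h3
    rw [h.vertex] at h3
    have hnav := h.toNav.same hs rfl rfl
    refine ⟨ht, { h.toCtx.same hs rfl with
      dep := hnav.dep
      base := hnav.base
      pw := hnav.pw
      vertex := hnav.vertex
      child := hnav.child
      path := hnav.path
      table := ?_
      run := by rw [hs.reg rRun rfl, h.run]; rfl }⟩
    have h4 := h.table.update_set hm hchild h1 h2
    by_cases hX : st.F (st.v :: st.cur) ∪ insert st.v (st.F st.cur) = st.F (st.v :: st.cur)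
    · rw [h3, if_pos hX]
      have : st.refresh.dn = st.dn := by
        simp only [Search.refresh, hX, decide_true, Bool.and_true, Function.update_eq_self]
      rw [this]
      exact h4
    · rw [h3, if_neg hX]
      refine h4.update_mark hm hchild ?_
      rw [decide_eq_false hX, Bool.and_false]
      exact (ind_false (by simp)).symm

/-- A step at an inner node, for a vertex `v` outside its set. Its branch has been closed and is passed
over, or it is entered, or it has so few boundary vertices that the current set can be replaced. -/
theorem branchStep_runs (h : Rep m w E st s) (hI : st.Inv m w E) (hrun : st.run = true)
    (hm : 0 < m) (hl : st.cur.length < w) (hv : st.v < m) (hvF : st.v ∉ st.F st.cur)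
    (hrefl : ∀ v, E v v) (hK : 22 * m ^ 2 + 40 * m + 60 ≤ K)
    (hL : 22 * m ^ 3 + 60 * m ^ 2 + 120 * m + 60 ≤ L) :
    Runs .branchStep s fun t s' => ∃ st', (st'.Inv m w E ∧
      t + 10 + Search.potential m w K L st' ≤ Search.potential m w K L st) ∧
        Rep m w E st' s' := by
  have hI1 := hI.refresh hrun hv
  have hcur := hI.letter
  have hchild : ∀ x ∈ st.v :: st.cur, x < m := by
    intro x hx
    rcases List.mem_cons.1 hx with rfl | hx
    · exact hv
    · exact hcur x hx
  have hbdY := (hI.stack hrun).bd_eq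
  have hpot0 := hI.potential_refresh (K := K) (L := L) hrun hm hv hl
  unfold Prog.branchStep
  refine Runs.seq (extendChild_rep h hI hm hv) ?_
  rintro t1 s1 ⟨ht1, hr1⟩ -
  rw [Runs.seq_iff, Runs.copy_iff]
  have hB := hr1.table.set _ hchild
  have hY := hr1.table.set _ hcur
  rw [Search.refresh_F_cur] at hY
  refine Runs.seq (countBoundary_runs (X := st.refresh.F (st.v :: st.cur))
    (hr1.setReg (by omega)).toCtx (hI1.sub _) ?_) ?_
  · have := hr1.child
    simp [this]
    exact hB
  rintro t2 s2 ⟨ht2, hbd, hbnd⟩ hs2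
  have hr2 : Rep m w E st.refresh s2 := (hr1.setReg (by omega)).same hs2 rfl rfl rfl rfl
  have hB2 : HasSet m (s2.arr aSet) (s2.reg rCid) (st.refresh.F (st.v :: st.cur)) := by
    rw [hr2.child]; exact hr2.table.set _ hchild
  have hY2 : HasSet m (s2.arr aSet) (s2.reg rCb) (st.F st.cur) := by
    have := hr2.table.set _ hcur
    rw [Search.refresh_F_cur] at this
    rw [hr2.base]; exact this
  have hring : m * (m * 8 + 15) = 8 * m ^ 2 + 15 * m := by ring
  have hdep : s2.reg rDep = st.cur.length := hr2.dep
  rw [Runs.cond_iff, Test.holds_lt, hdep, hbd]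
  constructor
  · intro hlt
    rw [Runs.seq_iff, Runs.load_iff, Runs.cond_iff, Test.holds_eq]
    have hdn : s2.arr aDone (s2.reg rCid) = ind (st.refresh.dn (st.v :: st.cur) = true) := by
      rw [hr2.child]; exact hr2.table.mark _ hchild
    have hr3 := hr2.setReg (x := rX) (v := s2.arr aDone (s2.reg rCid)) (by omega)
    rw [hr3.one, Store.setReg_reg, if_pos rfl, hdn, ind_eq_one]
    rw [hdn] at hr3
    constructor
    · intro hd
      refine (nextVertex_runs hr3).mono ?_
      rintro t3 s3 ⟨ht3, h3⟩ -
      have hpot1 := Search.potential_advance (m := m) (w := w) (K := K) (L := L)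
        (st := st.refresh) hv hl
      exact ⟨_, ⟨hI.advance_refresh hrun hv hd hlt, by omega⟩, h3⟩
    · intro hd
      refine (pushNode_runs hr3).mono ?_
      rintro t3 s3 ⟨ht3, h3⟩ -
      have hpot1 := Search.potential_descend (m := m) (w := w) (K := K) (L := L)
        (st := st.refresh) hl (hI.length_lt hrun hm)
      exact ⟨_, ⟨hI.descend_refresh hrun hv hl hvF (by simpa using hd) hlt, by omega⟩, h3⟩
  · intro hge
    have hsafe := hI.safe_refresh
    have hYB : st.F st.cur ⊆ st.refresh.F (st.v :: st.cur) :=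
      (Finset.subset_insert _ _).trans hsafe.1.1
    refine Runs.seq (minimize_runs hr2.toCtx hB2 hY2 hbnd hbd (hI1.sub _) hYB hrefl
      (fun U hU hU' => hsafe.le_add_one hU hU') ?_) ?_
    · intro u hu u' hu'
      rw [hr2.base, hr2.child]
      exact code_add_ne hm hcur hchild (fun h => by have := congrArg List.length h; simp at this)
        hu hu'
    rintro t3 s3 ⟨ht3, W, hYW, hWB, hmin, hne, hbdW, hsetW, hframe⟩ hs3
    rw [hr2.base] at hsetW hframe
    have hss : st.F st.cur ⊂ W := by
      refine Finset.ssubset_iff_subset_ne.2 ⟨hYW, ?_⟩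
      rintro rfl
      rcases hne with h3 | h3
      · exact hvF (h3 ▸ hsafe.1.1 (Finset.mem_insert_self _ _))
      · omega
    have hpot1 := hI1.potential_grow (K := K) (L := L) hrun hm (hWB.trans (hI1.sub _))
      (by change st.refresh.F st.cur ⊂ W; rwa [Search.refresh_F_cur])
    have hl' : st.refresh.cur.length < w := hl
    rw [if_pos hl'] at hpot1
    have hcommit := hI.commit hrun hv hl hYW hWB hmin
    have hWle : bd (Finset.range m) E W ≤ st.cur.length := by
      have := hmin _ (Finset.Subset.refl _) hYB
      omega
    have hring2 : m * ((m + 1) * (m * 22 + 13) + m * 7 + 29) + m * 14 + 9 =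
        22 * m ^ 3 + 42 * m ^ 2 + 56 * m + 9 := by ring
    have hm2 : m ≤ m ^ 2 := Nat.le_self_pow (by omega) m
    refine (restart_runs (m := m) (w := w) (E := E) (st := st.refresh) (W := W)
      (Q := fun st' => st'.Inv m w E ∧ Search.potential m w K L st' + L ≤
        Search.potential m w K L st) (hr2.toCtx.same hs3 rfl) (hr2.toNav.same hs3 rfl rfl)
        (by omega) ?_ ?_ ?_ ?_).mono ?_
    · rw [hs3.arr aDone rfl]
      exact hr2.table.update_set hm hcur hsetW hframe
    · rw [hs3.reg rRun rfl, hr2.run]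
    · intro h3
      rw [hbdW] at h3
      have h3' : ¬ bd (Finset.range m) E W < st.cur.length := h3
      exact ⟨hcommit.1 (by omega), by omega⟩
    · intro h3
      rw [hbdW] at h3
      exact ⟨hcommit.2 h3, by omega⟩
    · rintro t4 s4 ⟨ht4, st', ⟨h3, h4⟩, h5⟩ -
      exact ⟨st', ⟨h3, by omega⟩, h5⟩

theorem innerStep_runs (h : Rep m w E st s) (hI : st.Inv m w E) (hrun : st.run = true)
    (hm : 0 < m) (hl : st.cur.length < w)
    (hrefl : ∀ v, E v v) (hK : 22 * m ^ 2 + 40 * m + 60 ≤ K)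
    (hL : 22 * m ^ 3 + 60 * m ^ 2 + 120 * m + 60 ≤ L) :
    StepSpec m w E K L st .innerStep s := by
  have hcur := hI.letter
  unfold StepSpec Prog.innerStep
  rw [Runs.cond_iff, Test.holds_eq, h.vertex, h.m_eq]
  constructor
  · intro hv
    refine (closeNode_runs h hm hcur).mono ?_
    rintro t s1 ⟨ht, h1⟩ -
    have := hI.potential_close (K := K) (L := L) hrun hm
    exact ⟨_, ⟨hI.close_inner hrun hv, by omega⟩, h1⟩
  · intro hv
    have hvm : st.v < m := lt_of_le_of_ne hI.v_le hv
    rw [Runs.seq_iff, Runs.add_iff, Runs.seq_iff, Runs.load_iff, Runs.cond_iff, Test.holds_eq]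
    simp [-Runs.seq_iff, -Runs.cond_iff, h.one, h.base, h.vertex, h.table.set _ hcur _ hvm,
      ind_eq_one]
    have h1 := (h.setReg (x := rX) (v := code m st.cur + st.v) (by omega)).setReg (x := rX)
      (v := ind (st.v ∈ st.F st.cur)) (by omega)
    constructor
    · intro hvF
      refine (nextVertex_runs h1).mono ?_
      rintro t s1 ⟨ht, h2⟩ -
      have := Search.potential_advance (m := m) (w := w) (K := K) (L := L) hvm hl
      exact ⟨_, ⟨hI.advance hrun hvm (Or.inl hvF), by omega⟩, h2⟩
    · intro hvF
      refine (branchStep_runs h1 hI hrun hm hl hvm hvF hrefl hK hL).mono ?_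
      rintro t s1 ⟨st', ⟨h2, h3⟩, h4⟩ -
      exact ⟨st', ⟨h2, by omega⟩, h4⟩

/-- The search, started with empty sets, decides whether the vertices can be laid out: the set at
the address `0`, which is that of the root, finally consists of all vertices if and only if they
can. -/
theorem search_runs (h : Rep m w E Search.start s) (hm : 0 < m) (hrefl : ∀ v, E v v) :
    Runs .search s fun t s' => t ≤ 4000 * m ^ (w + 3) ∧
      ∃ F : Finset ℕ, F ⊆ Finset.range m ∧ HasSet m (s'.arr aSet) 0 F ∧
        (F = Finset.range m ↔ Reach (Finset.range m) E w ∅ (Finset.range m)) := by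
  have hm2 : m ≤ m ^ 2 := Nat.le_self_pow (by omega) m
  have hm3 : m ^ 2 ≤ m ^ 3 := Nat.pow_le_pow_right hm (by omega)
  -- a cheap step takes at most `130 * m ^ 2` time units, a step with a minimisation `300 * m ^ 3`
  have hK : 22 * m ^ 2 + 40 * m + 60 ≤ 130 * m ^ 2 := by omega
  have hL : 22 * m ^ 3 + 60 * m ^ 2 + 120 * m + 60 ≤ 300 * m ^ 3 := by omega
  unfold Prog.search
  refine (Runs.loop (I := fun τ s1 => ∃ st : Search, st.Inv m w E ∧ Rep m w E st s1 ∧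
    τ = Search.potential m w (130 * m ^ 2) (300 * m ^ 3) st)
    ⟨Search.start, Search.inv_start, h, rfl⟩ ?_).mono ?_
  · rintro τ s1 ⟨st, hI, hr, rfl⟩ - hb
    rw [Test.holds_eq, hr.run, hr.one, ind_eq_one] at hb
    rw [Runs.cond_iff, Test.holds_eq, hr.dep, hr.w_eq]
    constructor
    · intro hl
      refine (leafStep_runs hr hI hb hm hl (K := 130 * m ^ 2) (L := 300 * m ^ 3) (by omega)).mono ?_
      rintro t s2 ⟨st', ⟨h1, h2⟩, h3⟩ -
      exact ⟨_, ⟨st', h1, h3, rfl⟩, by omega⟩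
    · intro hl
      refine (innerStep_runs hr hI hb hm (lt_of_le_of_ne hI.depth hl) hrefl hK hL).mono ?_
      rintro t s2 ⟨st', ⟨h1, h2⟩, h3⟩ -
      exact ⟨_, ⟨st', h1, h3, rfl⟩, by omega⟩
  · rintro t s1 ⟨hb, τ', ⟨st, hI, hr, -⟩, ht⟩ -
    rw [Test.holds_eq, hr.run, hr.one, ind_eq_one] at hb
    have h1 := Search.potential_start_le hm (w := w) (a := 130) (b := 300)
    have h2 : 1 ≤ m ^ (w + 3) := Nat.one_le_pow _ _ hm
    refine ⟨by omega, st.F [], hI.sub _, hr.table.set [] (by simp), ?_⟩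
    exact hI.final_iff (by simpa using hb)

end

/-! ### Numbering the pallets -/

/-- The register for the number of sequences. -/
notation "rK" => 37

/-- The array of the addresses of the first occurrences of the vertices. -/
notation "aFst" => 3
/-- The array of the addresses of the last occurrences of the vertices. -/
notation "aLst" => 4

/-- The length of the `j`-th sequence. -/
def seqLen (Q : List (List ℕ)) (j : ℕ) : ℕ := (Q.getD j []).length

/-- The pallet symbol of the bin `b` of the `j`-th sequence. -/
def bin (Q : List (List ℕ)) (j b : ℕ) : ℕ := (Q.getD j []).getD b 0

/-- The address of the length of the `j`-th sequence in the input. -/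
def seqAddr (Q : List (List ℕ)) : ℕ → ℕ
  | 0 => 2
  | j + 1 => seqAddr Q j + 1 + seqLen Q j

/-- The array `f` contains the sequences of `Q`. -/
def Input (Q : List (List ℕ)) (f : ℕ → ℕ) : Prop :=
  ∀ j < Q.length, f (seqAddr Q j) = seqLen Q j ∧
    ∀ b < seqLen Q j, f (seqAddr Q j + 1 + b) = bin Q j b

/-- The symbols in the first `j` sequences. -/
def seen (Q : List (List ℕ)) (j : ℕ) : Finset ℕ :=
  (Finset.range j).biUnion fun j => (Finset.range (seqLen Q j)).image (bin Q j)

/-- The array `num` numbers the elements of `S` from `1` to `m`, and is `0` elsewhere. -/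
structure Numbered (S : Finset ℕ) (num : ℕ → ℕ) (m : ℕ) : Prop where
  pos : ∀ x ∈ S, 0 < num x
  le : ∀ x ∈ S, num x ≤ m
  out : ∀ x, x ∉ S → num x = 0
  inj : ∀ x ∈ S, ∀ y ∈ S, num x = num y → x = y
  card : m = S.card

theorem Numbered.insert {S : Finset ℕ} {num : ℕ → ℕ} {m x : ℕ} (h : Numbered S num m) :
    (num x = 0 → Numbered (insert x S) (Function.update num x (m + 1)) (m + 1)) ∧
      (num x ≠ 0 → Numbered (insert x S) num m) := by
  constructor
  · intro h0
    have hx : x ∉ S := fun hx => by have := h.pos x hx; omega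
    have hne : ∀ y ∈ S, y ≠ x := fun y hy he => hx (he ▸ hy)
    refine ⟨fun y hy => ?_, fun y hy => ?_, fun y hy => ?_, fun y hy z hz he => ?_, ?_⟩
    · rw [Function.update_apply]
      split_ifs with hyx
      · omega
      · exact h.pos y ((Finset.mem_insert.1 hy).resolve_left hyx)
    · rw [Function.update_apply]
      split_ifs with hyx
      · omega
      · have := h.le y ((Finset.mem_insert.1 hy).resolve_left hyx)
        omega
    · rw [Finset.mem_insert, not_or] at hy
      rw [Function.update_of_ne hy.1, h.out y hy.2]
    · rw [Function.update_apply, Function.update_apply] at he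
      split_ifs at he with h1 h2 h2
      · rw [h1, h2]
      · have := h.le z ((Finset.mem_insert.1 hz).resolve_left h2)
        omega
      · have := h.le y ((Finset.mem_insert.1 hy).resolve_left h1)
        omega
      · exact h.inj y ((Finset.mem_insert.1 hy).resolve_left h1) z
          ((Finset.mem_insert.1 hz).resolve_left h2) he
    · rw [Finset.card_insert_of_notMem hx, h.card]
  · intro h0
    rwa [Finset.insert_eq_of_mem (by by_contra hx; exact h0 (h.out x hx))]

theorem seen_succ (Q : List (List ℕ)) (j : ℕ) :
    seen Q (j + 1) = (Finset.range (seqLen Q j)).image (bin Q j) ∪ seen Q j := by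
  simp [seen, Finset.range_add_one, Finset.biUnion_insert]

namespace Prog

/-- Numbers the symbol at the address `rA`, unless it has a number. -/
def numberBin : Prog :=
  .load rX aIn rA ;; .load rY aNum rX ;;
  .cond (.eq rY rZero) (.add rM rM rOne ;; .store aNum rX rM) .skip ;; .add rA rA rOne

/-- Numbers the symbols and counts them in `rM`. -/
def numberAll : Prog :=
  .const rM 0 ;; .const rA 2 ;; .const rJ 0 ;;
  .forLoop rJ rK
    (.load rL aIn rA ;; .add rA rA rOne ;; .const rI 0 ;; .forLoop rI rL numberBin)

end Prog

theorem numberAll_runs {Q : List (List ℕ)} {s : Store} (hone : s.reg rOne = 1)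
    (hzero : s.reg rZero = 0) (hk : s.reg rK = Q.length) (hin : Input Q (s.arr aIn))
    (hnum : ∀ x, s.arr aNum x = 0) :
    Runs .numberAll s fun t s' =>
      t ≤ ∑ j ∈ Finset.range Q.length, (seqLen Q j * 8 + 6) + 4 ∧
      Numbered (seen Q Q.length) (s'.arr aNum) (s'.reg rM) := by
  unfold Prog.numberAll
  simp only [Runs.seq_iff, Runs.const_iff]
  refine (Runs.forLoop_sum (N := Q.length) (fun j => seqLen Q j * 8 + 4) (fun j s1 =>
    s1.reg rA = seqAddr Q j ∧ Numbered (seen Q j) (s1.arr aNum) (s1.reg rM)) rfl ?_ ?_ ?_ ?_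
    ?_).mono ?_
  · simp [hone]
  · simp [hk]
  · simp
  · simp [seqAddr]
    exact ⟨by simp [seen], by simp [seen], fun x _ => hnum x, by simp [seen], by simp [seen]⟩
  · intro j s1 hj hj1 hs ⟨h1, h2⟩
    have e1 : s1.arr aIn = s.arr aIn := by rw [hs.arr aIn rfl]; simp
    have e2 : s1.reg rOne = 1 := by rw [hs.reg rOne rfl]; simp [hone]
    have e3 : s1.reg rZero = 0 := by rw [hs.reg rZero rfl]; simp [hzero]
    obtain ⟨h3, h4⟩ := hin j hj
    simp only [Runs.seq_iff, Runs.const_iff, Runs.load_iff, Runs.add_iff]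
    refine (Runs.forLoop (N := seqLen Q j) (C := 6) (fun b s2 =>
      s2.reg rA = seqAddr Q j + 1 + b ∧
      Numbered ((Finset.range b).image (bin Q j) ∪ seen Q j) (s2.arr aNum) (s2.reg rM))
      rfl ?_ ?_ ?_ ?_ ?_).mono ?_
    · simp [e2]
    · simp [e1, h1, h3]
    · simp
    · simp [h1, e2, h2]
    · intro b s2 hb hb2 hs2 ⟨h5, h6⟩
      have f1 : s2.arr aIn = s.arr aIn := by rw [hs2.arr aIn rfl]; simp [e1]
      have f2 : s2.reg rOne = 1 := by rw [hs2.reg rOne rfl]; simp [e2]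
      have f3 : s2.reg rZero = 0 := by rw [hs2.reg rZero rfl]; simp [e3]
      have h7 := h6.insert (x := bin Q j b)
      simp [Prog.numberBin, f1, f2, f3, h5, h4 b hb, Finset.range_add_one]
      exact ⟨fun h => ⟨rfl, h7.1 h⟩, fun h => ⟨rfl, h7.2 h⟩⟩
    · rintro t s2 ⟨ht, -, h5, h6⟩ hs2
      simp at ht
      refine ⟨by omega, ?_⟩
      simp [h5, seqAddr, seen_succ]
      exact h6
  · rintro t s' ⟨ht, -, h1⟩ -
    have e : ∀ j, seqLen Q j * 8 + 4 + 2 = seqLen Q j * 8 + 6 := fun _ => rfl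
    simp only [e] at ht
    exact ⟨by omega, h1⟩

/-! ### The arcs between the numbered pallets -/

/-- The numbers of `u` and `v` occur in this order in some sequence, or `u = v`. -/
def NumBefore (Q : List (List ℕ)) (num : ℕ → ℕ) (k u v : ℕ) : Prop :=
  u = v ∨ ∃ j < k, ∃ b b', b < b' ∧ b' < seqLen Q j ∧ num (bin Q j b) = u + 1 ∧
    num (bin Q j b') = v + 1

/-- The arrays `f` and `l` hold the addresses of the first and the last occurrence of each vertex
among the first `i` bins of a sequence, whose bins stand from the address `a` on. Values less than `a`
belong to earlier sequences; `g b` is the vertex of the bin `b`. -/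
structure Occ (m : ℕ) (g : ℕ → ℕ) (a i : ℕ) (f l : ℕ → ℕ) : Prop where
  fst : ∀ u < m, ∀ c, a ≤ c → (a ≤ f u ∧ f u ≤ c ↔ ∃ b < i, a + b ≤ c ∧ g b = u)
  lst : ∀ u < m, ∀ c, a ≤ c → (c ≤ l u ↔ ∃ b < i, c ≤ a + b ∧ g b = u)
  fst_lt : ∀ u < m, f u < a + i
  lst_lt : ∀ u < m, l u < a + i

theorem Occ.start {m a : ℕ} {g f l : ℕ → ℕ} (hf : ∀ u < m, f u < a) (hl : ∀ u < m, l u < a) :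
    Occ m g a 0 f l where
  fst := fun u hu c hc => by
    have := hf u hu
    constructor
    · omega
    · rintro ⟨b, hb, -⟩; omega
  lst := fun u hu c hc => by
    have := hl u hu
    constructor
    · omega
    · rintro ⟨b, hb, -⟩; omega
  fst_lt := hf
  lst_lt := hl

theorem Occ.step {m a i : ℕ} {g f l : ℕ → ℕ} (h : Occ m g a i f l) :
    (f (g i) < a → Occ m g a (i + 1) (Function.update f (g i) (a + i))
      (Function.update l (g i) (a + i))) ∧
    (¬ f (g i) < a → Occ m g a (i + 1) f (Function.update l (g i) (a + i))) := by
  have hl : ∀ u < m, ∀ c, a ≤ c → (c ≤ Function.update l (g i) (a + i) u ↔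
      ∃ b < i + 1, c ≤ a + b ∧ g b = u) := by
    intro u hu c hc
    rw [Function.update_apply]
    split_ifs with h1
    · constructor
      · exact fun h2 => ⟨i, by omega, h2, h1.symm⟩
      · rintro ⟨b, h2, h3, -⟩; omega
    · rw [h.lst u hu c hc]
      constructor
      · rintro ⟨b, h2, h3⟩; exact ⟨b, by omega, h3⟩
      · rintro ⟨b, h2, h3, h4⟩
        have : b ≠ i := fun h5 => h1 (by rw [← h4, h5])
        exact ⟨b, by omega, h3, h4⟩
  have hllt : ∀ u < m, Function.update l (g i) (a + i) u < a + (i + 1) := by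
    intro u hu
    have := h.lst_lt u hu
    rw [Function.update_apply]
    split_ifs <;> omega
  have hother : ∀ u < m, u ≠ g i → ∀ c, a ≤ c →
      (a ≤ f u ∧ f u ≤ c ↔ ∃ b < i + 1, a + b ≤ c ∧ g b = u) := by
    intro u hu h1 c hc
    rw [h.fst u hu c hc]
    constructor
    · rintro ⟨b, h2, h3⟩; exact ⟨b, by omega, h3⟩
    · rintro ⟨b, h2, h3, h4⟩
      have : b ≠ i := fun h5 => h1 (by rw [← h4, h5])
      exact ⟨b, by omega, h3, h4⟩
  constructor
  · intro h0
    refine ⟨fun u hu c hc => ?_, hl, fun u hu => ?_, hllt⟩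
    · rw [Function.update_apply]
      split_ifs with h1
      · constructor
        · exact fun h2 => ⟨i, by omega, h2.2, h1.symm⟩
        · rintro ⟨b, h2, h3, h4⟩
          rcases Nat.lt_succ_iff_lt_or_eq.1 h2 with h2 | rfl
          · have := (h.fst u hu c hc).2 ⟨b, h2, h3, h4⟩
            rw [h1] at this
            omega
          · exact ⟨by omega, h3⟩
      · exact hother u hu h1 c hc
    · have := h.fst_lt u hu
      rw [Function.update_apply]
      split_ifs <;> omega
  · intro h0
    refine ⟨fun u hu c hc => ?_, hl, fun u hu => ?_, hllt⟩
    · by_cases h1 : u = g i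
      · constructor
        · intro h2
          obtain ⟨b, h3, h4⟩ := (h.fst u hu c hc).1 h2
          exact ⟨b, by omega, h4⟩
        · rintro ⟨b, h2, h3, h4⟩
          rw [← h1] at h0
          obtain ⟨b', h5, h6, h7⟩ := (h.fst u hu (f u) (by omega)).1 ⟨by omega, le_rfl⟩
          rcases Nat.lt_succ_iff_lt_or_eq.1 h2 with h2 | rfl
          · exact (h.fst u hu c hc).2 ⟨b, h2, h3, h4⟩
          · exact (h.fst u hu c hc).2 ⟨b', h5, by omega, h7⟩
      · exact hother u hu h1 c hc
    · have := h.fst_lt u hu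
      omega

theorem Occ.lt_iff {m a n : ℕ} {g f l : ℕ → ℕ} (h : Occ m g a n f l) {u v : ℕ} (hu : u < m)
    (hv : v < m) : (a ≤ f u ∧ f u < l v) ↔ ∃ b b', b < b' ∧ b' < n ∧ g b = u ∧ g b' = v := by
  constructor
  · rintro ⟨h1, h2⟩
    obtain ⟨b, h3, h4, h5⟩ := (h.fst u hu (f u) h1).1 ⟨h1, le_rfl⟩
    obtain ⟨b', h6, h7, h8⟩ := (h.lst v hv (f u + 1) (by omega)).1 h2
    exact ⟨b, b', by omega, h6, h5, h8⟩
  · rintro ⟨b, b', h1, h2, h3, h4⟩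
    have h5 := (h.fst u hu (a + b) (by omega)).2 ⟨b, by omega, le_rfl, h3⟩
    have h6 := (h.lst v hv (a + b + 1) (by omega)).2 ⟨b', h2, by omega, h4⟩
    omega

namespace Prog

/-- Puts the arcs `(u, u)` into the empty arc array. -/
def addLoops : Prog :=
  .const rI 0 ;; .const rA 0 ;;
  .forLoop rI rM (.store aAdj rA rOne ;; .add rA rA rM ;; .add rA rA rOne)

/-- Notes the bin at the address `rA` in the arrays of the first and the last occurrences; the bins
of its sequence start at `rT`. -/
def scanBin : Prog :=
  .load rX aIn rA ;; .load rX aNum rX ;; .sub rX rX rOne ;; .load rY aFst rX ;;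
  .cond (.lt rY rT) (.store aFst rX rA) .skip ;; .store aLst rX rA ;; .add rA rA rOne

/-- Adds the arcs from each vertex to the vertices whose last occurrence in the sequence with the
address `rT` comes later than its own first occurrence. -/
def addArcs : Prog :=
  .const rB 0 ;; .const rRoot 0 ;;
  .forLoop rRoot rM
    (.load rX aFst rRoot ;; .const rHead 0 ;;
      .forLoop rHead rM
        (.load rY aLst rHead ;;
          .cond (.lt rX rT) .skip (.cond (.lt rX rY) (.store aAdj rB rOne) .skip) ;;
          .add rB rB rOne))

/-- Computes the arc array. -/
def buildArcs : Prog :=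
  addLoops ;; .const rA 2 ;; .const rJ 0 ;;
  .forLoop rJ rK
    (.load rL aIn rA ;; .add rA rA rOne ;; .copy rT rA ;; .const rI 0 ;;
      .forLoop rI rL scanBin ;; addArcs)

end Prog

theorem mul_add_inj {m x y u v : ℕ} (hy : y < m) (hv : v < m) (h : x * m + y = u * m + v) :
    x = u ∧ y = v := by
  have h1 : y = v := by
    have h2 := congrArg (· % m) h
    simpa [Nat.add_mod, Nat.mod_eq_of_lt hy, Nat.mod_eq_of_lt hv] using h2
  subst h1
  exact ⟨Nat.eq_of_mul_eq_mul_right (by omega) (Nat.add_right_cancel h), rfl⟩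

/-- The cell `u * m + v` of `f` tells whether `E u v`. -/
def HasArcs (m : ℕ) (f : ℕ → ℕ) (E : ℕ → ℕ → Prop) : Prop :=
  ∀ u < m, ∀ v < m, f (u * m + v) = ind (E u v)

theorem HasArcs.congr {m : ℕ} {f : ℕ → ℕ} {E E' : ℕ → ℕ → Prop} (h : HasArcs m f E)
    (hE : ∀ u < m, ∀ v < m, (E u v ↔ E' u v)) : HasArcs m f E' :=
  fun u hu v hv => by rw [h u hu v hv, ind_congr (hE u hu v hv)]

theorem HasArcs.update {m : ℕ} {f : ℕ → ℕ} {E : ℕ → ℕ → Prop} (h : HasArcs m f E) {x y : ℕ}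
    (hy : y < m) :
    HasArcs m (Function.update f (x * m + y) 1) fun u v => E u v ∨ u = x ∧ v = y := by
  intro u hu v hv
  rw [Function.update_apply]
  split_ifs with h1
  · exact (ind_true (Or.inr (mul_add_inj hv hy h1))).symm
  · rw [h u hu v hv]
    refine ind_congr ⟨Or.inl, fun h2 => h2.resolve_right ?_⟩
    rintro ⟨rfl, rfl⟩
    exact h1 rfl

theorem addLoops_runs {m : ℕ} {s : Store} (hone : s.reg rOne = 1) (hm : s.reg rM = m)
    (hadj : ∀ x, s.arr aAdj x = 0) :
    Runs .addLoops s fun t s' => t ≤ m * 5 + 3 ∧ HasArcs m (s'.arr aAdj) fun u v => u = v := by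
  unfold Prog.addLoops
  simp only [Runs.seq_iff, Runs.const_iff]
  refine (Runs.forLoop (N := m) (C := 3) (fun j s1 => s1.reg rA = j * m + j ∧
    HasArcs m (s1.arr aAdj) fun u v => u < j ∧ u = v) rfl ?_ ?_ ?_ ?_ ?_).mono ?_
  · simp [hone]
  · simp [hm]
  · simp
  · simp
    intro u hu v hv
    simp [hadj, ind]
  · intro j s1 hj hj1 hs ⟨h1, h2⟩
    have e1 : s1.reg rOne = 1 := by rw [hs.reg rOne rfl]; simp [hone]
    have e2 : s1.reg rM = m := by rw [hs.reg rM rfl]; simp [hm]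
    simp [-Order.lt_add_one_iff, e1, e2, h1]
    refine ⟨by ring, (h2.update hj).congr fun u hu v hv => ?_⟩
    omega
  · rintro t s' ⟨ht, -, -, h1⟩ -
    simp at ht
    exact ⟨by omega, h1.congr fun u hu v hv => by simp [hu]⟩

theorem scanBin_runs {m a i : ℕ} {g : ℕ → ℕ} {s : Store} (hone : s.reg rOne = 1)
    (hA : s.reg rA = a + i) (hT : s.reg rT = a) (hg : s.arr aNum (s.arr aIn (a + i)) - 1 = g i)
    (h : Occ m g a i (s.arr aFst) (s.arr aLst)) :
    Runs .scanBin s fun t s' => t ≤ 8 ∧ s'.reg rA = a + (i + 1) ∧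
      Occ m g a (i + 1) (s'.arr aFst) (s'.arr aLst) := by
  have h1 := h.step
  simp [Prog.scanBin, hone, hA, hT, hg]
  exact ⟨fun h2 => ⟨rfl, h1.1 h2⟩, fun h2 => ⟨rfl, h1.2 (by omega)⟩⟩

theorem addArcs_runs {m a : ℕ} {A E : ℕ → ℕ → Prop} {s : Store} (hone : s.reg rOne = 1)
    (hm : s.reg rM = m) (hT : s.reg rT = a)
    (hA : ∀ u < m, ∀ v < m, (a ≤ s.arr aFst u ∧ s.arr aFst u < s.arr aLst v ↔ A u v))
    (hE : HasArcs m (s.arr aAdj) E) :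
    Runs .addArcs s fun t s' => t ≤ m * (m * 7 + 5) + 3 ∧
      HasArcs m (s'.arr aAdj) fun u v => E u v ∨ A u v := by
  unfold Prog.addArcs
  simp only [Runs.seq_iff, Runs.const_iff]
  refine (Runs.forLoop (N := m) (C := m * 7 + 3) (fun x s1 => s1.reg rB = x * m ∧
    HasArcs m (s1.arr aAdj) fun u v => E u v ∨ u < x ∧ A u v) rfl ?_ ?_ ?_ ?_ ?_).mono ?_
  · simp [hone]
  · simp [hm]
  · simp
  · simp
    exact hE
  · intro x s1 hx hx1 hs ⟨h1, h2⟩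
    have e1 : s1.reg rOne = 1 := by rw [hs.reg rOne rfl]; simp [hone]
    have e2 : s1.reg rM = m := by rw [hs.reg rM rfl]; simp [hm]
    have e3 : s1.reg rT = a := by rw [hs.reg rT rfl]; simp [hT]
    have e4 : s1.arr aFst = s.arr aFst := by rw [hs.arr aFst rfl]; simp
    have e5 : s1.arr aLst = s.arr aLst := by rw [hs.arr aLst rfl]; simp
    simp only [Runs.seq_iff, Runs.const_iff, Runs.load_iff]
    refine (Runs.forLoop (N := m) (C := 5) (fun y s2 => s2.reg rB = x * m + y ∧
      HasArcs m (s2.arr aAdj) fun u v => E u v ∨ (u < x ∨ u = x ∧ v < y) ∧ A u v)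
      rfl ?_ ?_ ?_ ?_ ?_).mono ?_
    · simp [e1]
    · simp [e2]
    · simp
    · simp [h1]
      exact h2
    · intro y s2 hy hy1 hs2 ⟨h3, h4⟩
      have f1 : s2.reg rOne = 1 := by rw [hs2.reg rOne rfl]; simp [e1]
      have f2 : s2.reg rX = s.arr aFst x := by rw [hs2.reg rX rfl]; simp [e4, hx1]
      have f3 : s2.reg rT = a := by rw [hs2.reg rT rfl]; simp [e3]
      have f4 : s2.arr aLst = s.arr aLst := by rw [hs2.arr aLst rfl]; simp [e5]
      have hxy := hA x hx y hy
      have hno : ¬ A x y → HasArcs m (s2.arr aAdj)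
          fun u v => E u v ∨ (u < x ∨ u = x ∧ v < y + 1) ∧ A u v := fun hn =>
        h4.congr fun u hu v hv => by
          refine or_congr_right (and_congr_left fun hA' => or_congr_right
            (and_congr_right fun hux => ?_))
          have : v ≠ y := by rintro rfl; exact hn (hux ▸ hA')
          omega
      simp [-Order.lt_add_one_iff, f1, f2, f3, f4, hy1, h3]
      refine ⟨fun h5 => ⟨rfl, hno fun h6 => ?_⟩, fun h5 => ⟨fun h6 => ⟨rfl, ?_⟩,
        fun h6 => ⟨rfl, hno fun h7 => ?_⟩⟩⟩
      · have := (hxy.2 h6).1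
        omega
      · refine (h4.update hy).congr fun u hu v hv => ?_
        have h7 : A x y := hxy.1 ⟨h5, h6⟩
        constructor
        · rintro ((h8 | h8) | ⟨rfl, rfl⟩)
          · exact Or.inl h8
          · exact Or.inr ⟨by omega, h8.2⟩
          · exact Or.inr ⟨by omega, h7⟩
        · rintro (h8 | ⟨h8, h9⟩)
          · exact Or.inl (Or.inl h8)
          · by_cases h10 : u = x ∧ v = y
            · exact Or.inr h10
            · exact Or.inl (Or.inr ⟨by omega, h9⟩)
      · have := (hxy.2 h7).2
        omega
    · rintro t s2 ⟨ht, -, h3, h4⟩ -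
      simp at ht
      simp [-Order.lt_add_one_iff, h3]
      refine ⟨by omega, by ring, h4.congr fun u hu v hv => ?_⟩
      have : (u < x ∨ u = x ∧ v < m) ↔ u < x + 1 := by omega
      rw [this]
  · rintro t s' ⟨ht, -, -, h1⟩ -
    simp at ht
    refine ⟨by rw [show m * (m * 7 + 5) = m * (m * 7 + 3 + 2) from rfl]; omega,
      h1.congr fun u hu v hv => by simp [hu]⟩

/-- The arcs of one more sequence, whose vertices are the numbers of the symbols decreased by one. -/
theorem numBefore_succ {Q : List (List ℕ)} {num : ℕ → ℕ} {k u v : ℕ}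
    (hpos : ∀ b < seqLen Q k, 0 < num (bin Q k b)) :
    (NumBefore Q num k u v ∨ ∃ b b', b < b' ∧ b' < seqLen Q k ∧ num (bin Q k b) - 1 = u ∧
      num (bin Q k b') - 1 = v) ↔ NumBefore Q num (k + 1) u v := by
  constructor
  · rintro ((h | ⟨j, hj, h⟩) | ⟨b, b', h1, h2, h3, h4⟩)
    · exact Or.inl h
    · exact Or.inr ⟨j, by omega, h⟩
    · have := hpos b (by omega)
      have := hpos b' h2
      exact Or.inr ⟨k, by omega, b, b', h1, h2, by omega, by omega⟩
  · rintro (h | ⟨j, hj, b, b', h1, h2, h3, h4⟩)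
    · exact Or.inl (Or.inl h)
    · rcases Nat.lt_succ_iff_lt_or_eq.1 hj with hj | rfl
      · exact Or.inl (Or.inr ⟨j, hj, b, b', h1, h2, h3, h4⟩)
      · exact Or.inr ⟨b, b', h1, h2, by omega, by omega⟩

/-- The arrays of the occurrences are not reset between sequences: entries below the address of the
current sequence count as missing, so that a sequence costs its length and `O(m ^ 2)`. -/
theorem buildArcs_runs {Q : List (List ℕ)} {m : ℕ} {s : Store} (hone : s.reg rOne = 1)
    (hm : s.reg rM = m) (hk : s.reg rK = Q.length) (hin : Input Q (s.arr aIn))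
    (hpos : ∀ j < Q.length, ∀ b < seqLen Q j, 0 < s.arr aNum (bin Q j b))
    (hadj : ∀ x, s.arr aAdj x = 0) (hfst : ∀ x, s.arr aFst x = 0)
    (hlst : ∀ x, s.arr aLst x = 0) :
    Runs .buildArcs s fun t s' =>
      t ≤ m * 5 + 6 +
        ∑ j ∈ Finset.range Q.length, (seqLen Q j * 10 + m * (m * 7 + 5) + 10) ∧
      HasArcs m (s'.arr aAdj) (NumBefore Q (s.arr aNum) Q.length) := by
  unfold Prog.buildArcs
  refine Runs.seq (addLoops_runs hone hm hadj) ?_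
  rintro t0 s0 ⟨ht0, h0⟩ hs0
  simp only [Runs.seq_iff, Runs.const_iff]
  refine (Runs.forLoop_sum (N := Q.length) (fun j => seqLen Q j * 10 + m * (m * 7 + 5) + 8)
    (fun j s1 => s1.reg rA = seqAddr Q j ∧ (∀ u < m, s1.arr aFst u < seqAddr Q j) ∧
      (∀ u < m, s1.arr aLst u < seqAddr Q j) ∧
      HasArcs m (s1.arr aAdj) (NumBefore Q (s.arr aNum) j)) rfl ?_ ?_ ?_ ?_ ?_).mono ?_
  · simp [hs0.reg rOne rfl, hone]
  · simp [hs0.reg rK rfl, hk]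
  · simp
  · simp [seqAddr, hs0.arr aFst rfl, hs0.arr aLst rfl, hfst, hlst]
    exact h0.congr fun u hu v hv => by simp [NumBefore]
  · intro j s1 hj hj1 hs ⟨h1, h2, h2', h3⟩
    have e1 : s1.arr aIn = s.arr aIn := by rw [hs.arr aIn rfl]; simp [hs0.arr aIn rfl]
    have e2 : s1.reg rOne = 1 := by rw [hs.reg rOne rfl]; simp [hs0.reg rOne rfl, hone]
    have e3 : s1.arr aNum = s.arr aNum := by rw [hs.arr aNum rfl]; simp [hs0.arr aNum rfl]
    have e4 : s1.reg rM = m := by rw [hs.reg rM rfl]; simp [hs0.reg rM rfl, hm]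
    obtain ⟨h4, h5⟩ := hin j hj
    rw [Runs.seq_iff, Runs.load_iff, Runs.seq_iff, Runs.add_iff, Runs.seq_iff, Runs.copy_iff,
      Runs.seq_iff, Runs.const_iff]
    refine Runs.seq (Runs.forLoop (N := seqLen Q j) (C := 8) (fun b s2 =>
      s2.reg rA = seqAddr Q j + 1 + b ∧ Occ m (fun b => s.arr aNum (bin Q j b) - 1)
        (seqAddr Q j + 1) b (s2.arr aFst) (s2.arr aLst)) rfl ?_ ?_ ?_ ?_ ?_) ?_
    · simp [e2]
    · simp [e1, h1, h4]
    · simp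
    · simp [h1, e2]
      exact Occ.start (fun u hu => by have := h2 u hu; omega)
        fun u hu => by have := h2' u hu; omega
    · intro b s2 hb hb2 hs2 ⟨h6, h7⟩
      have f1 : s2.arr aIn = s.arr aIn := by rw [hs2.arr aIn rfl]; simp [e1]
      have f2 : s2.reg rOne = 1 := by rw [hs2.reg rOne rfl]; simp [e2]
      have f3 : s2.arr aNum = s.arr aNum := by rw [hs2.arr aNum rfl]; simp [e3]
      have f4 : s2.reg rT = seqAddr Q j + 1 := by rw [hs2.reg rT rfl]; simp [h1, e2]
      refine (scanBin_runs f2 h6 f4 (by rw [f1, f3, h5 b hb]) h7).mono ?_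
      rintro t s3 ⟨ht, h8, h9⟩ -
      simp [h8]
      exact ⟨ht, h9⟩
    · rintro t s2 ⟨ht, -, h6, h7⟩ hs2
      have f2 : s2.reg rOne = 1 := by rw [hs2.reg rOne rfl]; simp [e2]
      have f3 : s2.reg rM = m := by rw [hs2.reg rM rfl]; simp [e4]
      have f4 : s2.reg rT = seqAddr Q j + 1 := by rw [hs2.reg rT rfl]; simp [h1, e2]
      have f5 : s2.arr aAdj = s1.arr aAdj := by rw [hs2.arr aAdj rfl]; simp
      refine (addArcs_runs f2 f3 f4 (fun u hu v hv => h7.lt_iff hu hv)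
        (by rw [f5]; exact h3)).mono ?_
      rintro t' s3 ⟨ht', h8⟩ hs3
      simp at ht
      simp [hs3.reg rA rfl, hs3.arr aFst rfl, hs3.arr aLst rfl, h6, seqAddr]
      exact ⟨by omega, h7.fst_lt, h7.lst_lt,
        h8.congr fun u hu v hv => numBefore_succ (hpos j hj)⟩
  · rintro t s' ⟨ht, -, -, -, h1⟩ -
    have e : ∀ j, seqLen Q j * 10 + m * (m * 7 + 5) + 8 + 2 =
      seqLen Q j * 10 + m * (m * 7 + 5) + 10 := fun _ => rfl
    simp only [e] at ht
    exact ⟨by omega, h1⟩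

/-! ### The numbered pallets and the processings -/

section Numbering

variable {Q : List (List ℕ)}

theorem getD_eq_get {j : ℕ} (hj : j < Q.length) : Q.getD j [] = Q.get ⟨j, hj⟩ := by
  rw [List.getD_eq_getElem _ _ hj, List.get_eq_getElem]

theorem mem_seen {k x : ℕ} : x ∈ seen Q k ↔ ∃ j < k, ∃ b < seqLen Q j, bin Q j b = x := by
  simp [seen]

theorem seen_length : seen Q Q.length = plts Q := by
  ext x
  rw [mem_seen, mem_plts]
  constructor
  · rintro ⟨j, hj, b, hb, rfl⟩
    refine ⟨⟨j, hj⟩, ?_⟩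
    rw [seqLen] at hb
    rw [bin, ← getD_eq_get hj, List.getD_eq_getElem _ _ hb]
    exact List.getElem_mem _
  · rintro ⟨⟨j, hj⟩, hx⟩
    rw [← getD_eq_get hj] at hx
    obtain ⟨b, hb, h⟩ := List.mem_iff_getElem.1 hx
    exact ⟨j, hj, b, hb, by rw [bin, List.getD_eq_getElem _ _ hb, h]⟩

theorem before_iff {x y : ℕ} : Before Q x y ↔ x = y ∨ ∃ j < Q.length, ∃ b b', b < b' ∧
    b' < seqLen Q j ∧ bin Q j b = x ∧ bin Q j b' = y := by
  refine or_congr_right ⟨?_, ?_⟩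
  · rintro ⟨⟨j, hj⟩, i, hx, hy⟩
    rw [← getD_eq_get hj] at hx hy
    obtain ⟨b, hb, h1⟩ := List.mem_take_iff_getElem.1 hx
    obtain ⟨b', hb', h2⟩ := List.mem_drop_iff_getElem.1 hy
    refine ⟨j, hj, b, i + b', by omega, by rw [seqLen]; omega, ?_, ?_⟩
    · rw [bin, List.getD_eq_getElem _ _ (by omega), h1]
    · rw [bin, List.getD_eq_getElem _ _ (by omega), h2]
  · rintro ⟨j, hj, b, b', h1, h2, rfl, rfl⟩
    rw [seqLen] at h2
    refine ⟨⟨j, hj⟩, b', ?_, ?_⟩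
    · rw [← getD_eq_get hj, bin, List.getD_eq_getElem (Q.getD j []) 0 (by omega)]
      exact List.mem_take_iff_getElem.2 ⟨b, by omega, rfl⟩
    · rw [← getD_eq_get hj, bin, List.getD_eq_getElem _ _ h2]
      exact List.mem_drop_iff_getElem.2 ⟨0, by omega, by simp⟩

/-- The layouts of the pallets are those of their numbers, decreased by one. -/
theorem Numbered.reach_iff {num : ℕ → ℕ} {m w : ℕ} (h : Numbered (plts Q) num m) :
    Reach (plts Q) (Before Q) w ∅ (plts Q) ↔
      Reach (Finset.range m) (NumBefore Q num Q.length) w ∅ (Finset.range m) := by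
  have hf : Set.InjOn (fun x => num x - 1) (plts Q : Set ℕ) := fun x hx y hy hxy => by
    have h1 := h.pos x hx
    have h2 := h.pos y hy
    exact h.inj x hx y hy (by simp only at hxy; omega)
  refine (reach_image_iff hf ?_ ?_).symm
  · refine Finset.eq_of_subset_of_card_le (fun y hy => ?_) ?_
    · obtain ⟨x, hx, rfl⟩ := Finset.mem_image.1 hy
      have h1 := h.pos x hx
      have h2 := h.le x hx
      exact Finset.mem_range.2 (by omega)
    · rw [Finset.card_image_of_injOn hf, Finset.card_range, h.card]
  · intro u hu v hv
    have h1 := h.pos u hu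
    have h2 := h.pos v hv
    rw [before_iff, NumBefore, Nat.sub_add_cancel h1, Nat.sub_add_cancel h2]
    refine or_congr ⟨fun h => by rw [h], fun he => hf hu hv he⟩ ?_
    have hmem : ∀ j < Q.length, ∀ b < seqLen Q j, bin Q j b ∈ plts Q := fun j hj b hb => by
      rw [← seen_length]
      exact mem_seen.2 ⟨j, hj, b, hb, rfl⟩
    refine exists_congr fun j => and_congr_right fun hj => exists_congr fun b =>
      exists_congr fun b' => and_congr_right fun hbb => and_congr_right fun hb' =>
        and_congr ?_ ?_
    · exact ⟨fun h => by rw [h], h.inj _ (hmem j hj b (by omega)) u hu⟩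
    · exact ⟨fun h => by rw [h], h.inj _ (hmem j hj b' hb') v hv⟩

/-! ### The input words -/

theorem seqAddr_cons (q : List ℕ) (j : ℕ) :
    seqAddr (q :: Q) (j + 1) = seqAddr Q j + 1 + q.length := by
  induction j with
  | zero => simp [seqAddr, seqLen]
  | succ j ih =>
    rw [seqAddr, ih, seqAddr]
    simp only [seqLen, List.getD_cons_succ]
    omega

theorem input_encode (a b : ℕ) :
    Input Q fun i => (a :: b :: Q.flatMap fun q => q.length :: q).getD i 0 := by
  induction Q with
  | nil => intro j hj; simp at hj
  | cons q Q ih =>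
    have hshift : ∀ i, 2 ≤ i →
        (a :: b :: (q :: Q).flatMap fun q => q.length :: q).getD (i + 1 + q.length) 0 =
          (a :: b :: Q.flatMap fun q => q.length :: q).getD i 0 := by
      intro i hi
      obtain ⟨i, rfl⟩ := Nat.exists_eq_add_of_le' hi
      rw [show i + 2 + 1 + q.length = i + q.length + 1 + 1 + 1 by omega]
      simp only [List.flatMap_cons, List.cons_append, List.getD_cons_succ]
      rw [List.getD_append_right _ _ _ _ (by omega), Nat.add_sub_cancel]
    have haddr : ∀ j, 2 ≤ seqAddr Q j := fun j => by
      induction j with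
      | zero => exact le_rfl
      | succ j ih => rw [seqAddr]; omega
    intro j hj
    cases j with
    | zero =>
      refine ⟨by simp [seqAddr, seqLen], fun c hc => ?_⟩
      have hc' : c < q.length := by simpa [seqLen] using hc
      simp only [seqAddr, bin, List.flatMap_cons, List.cons_append]
      rw [show 2 + 1 + c = c + 1 + 1 + 1 by omega]
      simp only [List.getD_cons_succ, List.getD_cons_zero]
      rw [List.getD_append _ _ _ _ hc']
    | succ j =>
      obtain ⟨h1, h2⟩ := ih j (by simpa using hj)
      rw [seqAddr_cons]
      beta_reduce at h1 h2 ⊢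
      refine ⟨by rw [hshift _ (haddr j), h1]; simp [seqLen], fun c hc => ?_⟩
      have hc' : c < seqLen Q j := by simpa [seqLen] using hc
      rw [show seqAddr Q j + 1 + q.length + 1 + c = seqAddr Q j + 1 + c + 1 + q.length by omega,
        hshift _ (by have := haddr j; omega), h2 c hc']
      simp [bin]

theorem sum_seqLen : ∑ j ∈ Finset.range Q.length, seqLen Q j = Q.flatten.length := by
  induction Q with
  | nil => simp
  | cons q Q ih =>
    rw [List.length_cons, Finset.sum_range_succ', List.flatten_cons, List.length_append, ← ih]
    simp only [seqLen, List.getD_cons_succ, List.getD_cons_zero]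
    omega

end Numbering

/-! ### The algorithm -/

namespace Prog

/-- Sets the registers for the start of the search. -/
def startSearch : Prog :=
  .const rRun 1 ;; .const rDep 0 ;; .const rCb 0 ;; .copy rPw rM ;; .const rV 0 ;; .copy rCid rM

/-- Sets `rOut` to `1` if the set at the address `0` contains all vertices, and to `0` otherwise. -/
def answer : Prog :=
  .const rF 0 ;; .const rI 0 ;;
  .forLoop rI rM (.load rX aSet rI ;; .add rF rF rX) ;;
  .cond (.eq rF rM) (.const rOut 1) (.const rOut 0)

/-- The algorithm for FIFO Stack-Up. -/
def stackUp : Prog :=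
  .const rOne 1 ;; .const rX 0 ;; .load rW aIn rX ;; .sub rW rW rOne ;; .load rK aIn rOne ;;
  numberAll ;; buildArcs ;;
  .cond (.lt rZero rM) (startSearch ;; search) .skip ;; answer

end Prog

theorem startSearch_runs {m w : ℕ} {E : ℕ → ℕ → Prop} {s : Store} (hc : Ctx m w E s)
    (hset : ∀ x, s.arr aSet x = 0) (hdone : ∀ x, s.arr aDone x = 0) :
    Runs .startSearch s fun t s' => t = 6 ∧ Rep m w E Search.start s' := by
  unfold Prog.startSearch
  simp only [Runs.seq_iff, Runs.const_iff, Runs.copy_iff]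
  refine ⟨trivial, (((((((hc.setReg ?_).setReg ?_).setReg ?_).setReg ?_).setReg ?_).setReg ?_)), ?_, ?_,
    ?_⟩
  any_goals omega
  · constructor <;> simp [Search.start, code, Path, hc.m_eq]
  · constructor
    · intro t _ u _
      simp [Search.start, hset, ind]
    · intro t _
      simp [Search.start, hdone, ind]
  · simp [Search.start, ind]

theorem answer_runs {m : ℕ} {F : Finset ℕ} {s : Store} (hone : s.reg rOne = 1)
    (hm : s.reg rM = m) (hF : F ⊆ Finset.range m) (h : HasSet m (s.arr aSet) 0 F) :
    Runs .answer s fun t s' => t ≤ m * 4 + 5 ∧ (s'.reg rOut = 1 ↔ F = Finset.range m) := by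
  unfold Prog.answer
  rw [Runs.seq_iff, Runs.const_iff, Runs.seq_iff, Runs.const_iff]
  refine Runs.seq (Runs.forLoop (N := m) (C := 2) (fun j s1 =>
    s1.reg rF = ∑ u ∈ Finset.range j, ind (u ∈ F)) rfl ?_ ?_ ?_ ?_ ?_) ?_
  · simp [hone]
  · simp [hm]
  · simp
  · simp
  · intro j s1 hj hj1 hs h1
    have h2 := h j hj
    rw [Nat.zero_add] at h2
    have e1 : s1.arr aSet = s.arr aSet := by rw [hs.arr aSet rfl]; simp
    simp [e1, hj1, h2, h1, Finset.sum_range_succ]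
  · rintro t s1 ⟨ht, -, h1⟩ hs
    have e1 : s1.reg rM = m := by rw [hs.reg rM rfl]; simp [hm]
    have e2 : ∑ u ∈ Finset.range m, ind (u ∈ F) = F.card := by
      classical
      rw [← card_filter_eq_sum_ind]
      congr 1
      ext u
      simp only [Finset.mem_filter]
      exact ⟨fun h => h.2, fun h => ⟨hF h, h⟩⟩
    have e3 : F.card = m ↔ F = Finset.range m := by
      refine ⟨fun h => Finset.eq_of_subset_of_card_le hF ?_, fun h => ?_⟩
      · rw [Finset.card_range, h]
      · rw [h, Finset.card_range]
    simp at ht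
    simp [e1, h1, e2, e3]
    exact ⟨fun h => ⟨by omega, h⟩, fun h => ⟨by omega, h⟩⟩

/-- The algorithm is correct, with a bound for its running time that holds for any number of
sequences. -/
theorem stackUp_runs (I : Inst) :
    Runs .stackUp (Store.init I.encode) fun t s' =>
      t ≤ 4100 * (1 + I.n + I.k + I.k * I.m ^ 2 + I.m ^ (I.p + 2)) ∧ (s'.reg rOut = 1 ↔ I.Yes) := by
  have hp := I.p_pos
  have hin : Input I.seqs ((Store.init I.encode).arr aIn) := input_encode I.p I.seqs.length
  have i0 : (Store.init I.encode).arr aIn 0 = I.p := rfl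
  have i1 : (Store.init I.encode).arr aIn 1 = I.k := rfl
  have harr : ∀ a, a ≠ aIn → ∀ x, (Store.init I.encode).arr a x = 0 := fun a ha x => if_neg ha
  have hreg : ∀ r, (Store.init I.encode).reg r = 0 := fun _ => rfl
  generalize Store.init I.encode = s at *
  unfold Prog.stackUp
  simp only [Runs.seq_iff (P := .const _ _), Runs.seq_iff (P := .load _ _ _),
    Runs.seq_iff (P := .sub _ _ _), Runs.const_iff, Runs.load_iff, Runs.sub_iff]
  refine Runs.seq (numberAll_runs (Q := I.seqs) ?_ ?_ ?_ hin (harr aNum (by omega))) ?_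
  · simp
  · simp [hreg]
  · simp [i1, Inst.k]
  rintro t1 s1 ⟨ht1, h1⟩ hs1
  rw [seen_length] at h1
  have hm : s1.reg rM = I.m := h1.card
  refine Runs.seq (buildArcs_runs (Q := I.seqs) (m := I.m) ?_ hm ?_ ?_ ?_ ?_ ?_ ?_) ?_
  · simp [hs1.reg rOne rfl]
  · simp [hs1.reg rK rfl, i1, Inst.k]
  · rw [hs1.arr aIn rfl]; exact hin
  · intro j hj b hb
    refine h1.pos _ ?_
    rw [← seen_length]
    exact mem_seen.2 ⟨j, hj, b, hb, rfl⟩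
  · intro x; rw [hs1.arr aAdj rfl]; exact harr aAdj (by omega) x
  · intro x; rw [hs1.arr aFst rfl]; exact harr aFst (by omega) x
  · intro x; rw [hs1.arr aLst rfl]; exact harr aLst (by omega) x
  rintro t2 s2 ⟨ht2, h2⟩ hs2
  have hc : Ctx I.m (I.p - 1) (NumBefore I.seqs (s1.arr aNum) I.seqs.length) s2 := by
    refine ⟨?_, ?_, ?_, ?_, fun u hu v hv => h2 v hv u hu⟩
    · simp [hs2.reg rOne rfl, hs1.reg rOne rfl]
    · simp [hs2.reg rZero rfl, hs1.reg rZero rfl, hreg]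
    · rw [hs2.reg rM rfl, hm]
    · simp [hs2.reg rW rfl, hs1.reg rW rfl, i0]
  have hset : ∀ x, s2.arr aSet x = 0 := fun x => by
    rw [hs2.arr aSet rfl, hs1.arr aSet rfl]; exact harr aSet (by omega) x
  have hdone : ∀ x, s2.arr aDone x = 0 := fun x => by
    rw [hs2.arr aDone rfl, hs1.arr aDone rfl]; exact harr aDone (by omega) x
  have hyes : I.Yes ↔ Reach (Finset.range I.m)
      (NumBefore I.seqs (s1.arr aNum) I.seqs.length) (I.p - 1) ∅ (Finset.range I.m) := by
    have h3 : I.m = s1.reg rM := hm.symm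
    rw [h3, ← h1.reach_iff]
    exact processable_iff_reach hp I.two_bins
  have hpow : I.p - 1 + 3 = I.p + 2 := by omega
  refine Runs.seq (Q' := fun t s3 => t ≤ 4000 * I.m ^ (I.p + 2) + 7 ∧ ∃ F : Finset ℕ,
    F ⊆ Finset.range I.m ∧ HasSet I.m (s3.arr aSet) 0 F ∧ (F = Finset.range I.m ↔ I.Yes)) ?_ ?_
  · rw [Runs.cond_iff]
    constructor
    · intro hlt
      have hpos : 0 < I.m := by
        have : s2.reg rZero < s2.reg rM := hlt
        rwa [hc.zero, hc.m_eq] at this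
      refine Runs.seq (startSearch_runs hc hset hdone) ?_
      rintro t s3 ⟨rfl, hr⟩ -
      refine (search_runs hr hpos fun v => Or.inl rfl).mono ?_
      rintro t s4 ⟨ht, F, hF1, hF2, hF3⟩ -
      rw [hpow] at ht
      exact ⟨by omega, F, hF1, hF2, hF3.trans hyes.symm⟩
    · intro hlt
      have hz : I.m = 0 := by
        have : ¬ s2.reg rZero < s2.reg rM := hlt
        rw [hc.zero, hc.m_eq] at this
        omega
      rw [Runs.skip_iff, hyes, hz]
      exact ⟨by omega, ∅, by simp, fun u hu => by omega, by simp; exact .refl⟩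
  · rintro t3 s3 ⟨ht3, F, hF1, hF2, hF3⟩ hs3
    have hc3 := hc.same hs3 rfl
    refine (answer_runs hc3.one hc3.m_eq hF1 hF2).mono ?_
    rintro t4 s4 ⟨ht4, h4⟩ -
    refine ⟨?_, h4.trans hF3⟩
    have hk : I.seqs.length = I.k := rfl
    have hn : ∑ j ∈ Finset.range I.k, seqLen I.seqs j = I.n := sum_seqLen
    simp only [Finset.sum_add_distrib, ← Finset.sum_mul, Finset.sum_const, Finset.card_range,
      smul_eq_mul, hk, hn] at ht1 ht2
    have hm1 : I.m ≤ I.m ^ 2 := Nat.le_self_pow (by omega) _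
    have hm2 : I.m ≤ I.m ^ (I.p + 2) := Nat.le_self_pow (by omega) _
    have hm3 : I.k * I.m * (I.m * 7 + 5) ≤ I.k * I.m ^ 2 * 12 := by
      rw [mul_assoc, mul_assoc]
      refine Nat.mul_le_mul_left _ ?_
      rw [show I.m * (I.m * 7 + 5) = I.m ^ 2 * 7 + I.m * 5 by ring]
      omega
    omega

/-! ### Running times -/

theorem size_le (I : Inst) : 2 + I.n + I.k ≤ pFifoStackUp.size I := by
  have h1 : ∀ l : List ℕ, l.length ≤ (l.map fun x => max 1 x.size).sum := fun l => by
    induction l with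
    | nil => simp
    | cons x l ih =>
      rw [List.map_cons, List.sum_cons, List.length_cons]
      have : 1 ≤ max 1 x.size := le_max_left _ _
      omega
  have h2 : ∀ Q : List (List ℕ), (Q.flatMap fun q => q.length :: q).length =
      Q.flatten.length + Q.length := fun Q => by
    induction Q with
    | nil => simp
    | cons q Q ih =>
      rw [List.flatMap_cons, List.length_append, ih]
      simp only [List.length_cons, List.flatten_cons, List.length_append]
      omega
  refine le_trans ?_ (h1 I.encode)
  rw [Inst.encode, List.length_cons, List.length_cons, h2]
  simp only [Inst.n, Inst.k]
  omega

theorem m_le_n (I : Inst) : I.m ≤ I.n := List.toFinset_card_le _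

end FifoStackUp

/-- There is an xp-algorithm that solves FIFO Stack-Up, parameterized by the number `p` of stack-up
places, in time `O(n + m ^ (p + 2))`, with an absolute constant, for all instances with fewer
sequences than pallets. -/
theorem mainTheorem9 :
    ∃ A : FifoStackUp.Prog,
      FifoStackUp.pFifoStackUp.IsXPAlgorithm A ∧
      ∃ c : ℕ, ∀ I : FifoStackUp.Inst, I.k < I.m →
        A.HaltsWithin I.encode (c * (I.n + I.m ^ (I.p + 2))) := by
  refine ⟨.stackUp, ⟨fun I => ?_, fun _ => 20500, fun p => p + 2, .const _,
    (Primrec.nat_add.comp .id (.const 2)).to_comp, fun I => ?_⟩, 16400, fun I hI => ?_⟩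
  · obtain ⟨t, s, h1, h2, h3⟩ := FifoStackUp.stackUp_runs I
    refine ⟨⟨_, t, s, h1, h2⟩, fun ⟨t', s', h4, h5⟩ => ?_, fun h => ⟨t, s, h1, h3.2 h⟩⟩
    obtain ⟨-, rfl⟩ := h1.unique h4
    exact h3.1 h5
  · obtain ⟨t, s, h1, h2, -⟩ := FifoStackUp.stackUp_runs I
    refine ⟨t, s, h1, h2.trans ?_⟩
    have hs := FifoStackUp.size_le I
    have hm := FifoStackUp.m_le_n I
    change _ ≤ 20500 * FifoStackUp.pFifoStackUp.size I ^ (I.p + 2)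
    generalize FifoStackUp.pFifoStackUp.size I = N at *
    have h3 : N ≤ N ^ (I.p + 2) := Nat.le_self_pow (by omega) N
    have h4 : I.k * I.m ^ 2 ≤ N ^ (I.p + 2) :=
      calc I.k * I.m ^ 2 ≤ N * N ^ 2 :=
            Nat.mul_le_mul (by omega) (Nat.pow_le_pow_left (by omega) 2)
        _ = N ^ 3 := by ring
        _ ≤ _ := Nat.pow_le_pow_right (by omega) (by have := I.p_pos; omega)
    have h5 : I.m ^ (I.p + 2) ≤ N ^ (I.p + 2) := Nat.pow_le_pow_left (by omega) _
    omega
  · -- with fewer sequences than pallets, the terms `k`, `k * m ^ 2` and `1` are at most `m ^ (p + 2)`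
    obtain ⟨t, s, h1, h2, -⟩ := FifoStackUp.stackUp_runs I
    refine ⟨t, s, h1, h2.trans ?_⟩
    have h3 : I.m ≤ I.m ^ (I.p + 2) := Nat.le_self_pow (by omega) _
    have h4 : I.k * I.m ^ 2 ≤ I.m ^ (I.p + 2) :=
      calc I.k * I.m ^ 2 ≤ I.m * I.m ^ 2 := Nat.mul_le_mul_right _ hI.le
        _ = I.m ^ 3 := by ring
        _ ≤ _ := Nat.pow_le_pow_right (by omega) (by have := I.p_pos; omega)
    omega
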